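/- Let $M$ be a smooth $n$-dimensional manifold (Hausdorff, $\sigma$-compact, without boundary) with a volume form $\nu$, oriented by $\nu$, and let $E\to M$ be a smooth real vector bundle of rank $m$. Let $J^\infty E$ be its infinite jet bundle, with local coordinates $(x^i,u^a_I)$, and let $Loc_E$ be the algebra of functions on $J^\infty E$ that are pull-backs of smooth functions on some finite jet bundle $J^pE$. Let $\Omega^{n,1}_0$ be the $Loc_E$-module of forms on $J^\infty E$ that are locally $\sum_a f_a\,\theta^a\wedge d^nx$ with $f_a\in Loc_E$ and $\theta^a=du^a-u^a_i\,dx^i$, and let $\omega:\Omega^{n,1}_0\times\Omega^{n,1}_0\to Loc_E$ be skew-symmetric and $Loc_E$-linear in each variable. Write $\omega^{ab}=\omega(\theta^a\wedge\nu,\theta^b\wedge\nu)$ in local coordinates. The Euler–Lagrange operator is $\mathbf E(P)=\mathbf E(P\nu)=\sum_a\big(\sum_I(-D)_I\frac{\partial L}{\partial u^a_I}\big)\,\theta^a\wedge d^nx$, where $P\nu=L\,d^nx$ locally and $D_i=\frac{\partial}{\partial x^i}+u^a_{iJ}\frac{\partial}{\partial u^a_J}$. Let $\mathcal F$ be the space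 of local functionals $\mathcal P(\phi)=\int_M(P\circ j\phi)\,\nu$ on the compactly supported smooth sections $\phi$ of $E$, where $P\in Loc_E$ is such that, for every such $\phi$, both $P$ and $\mathbf E(P\nu)$ vanish along $j\phi$ outside a compact subset of $M$. The bracket of $\mathcal P=\int_M P\nu$ and $\mathcal Q=\int_M Q\nu$ is $$\{\mathcal P,\mathcal Q\}(\phi)=\int_M[\omega(\mathbf E(P),\mathbf E(Q))\circ j\phi]\,\nu .$$ Let $\psi:E\to E$ be a diffeomorphism that sends fibers to fibers and covers an orientation-preserving diffeomorphism $\psi_M$ of $M$ ($\psi$ need not be linear on the fibers). Put $\hat\psi(\phi)=\psi\circ\phi\circ\psi_M^{-1}$ and assume that $\hat\psi$ maps compactly supported sections to compactly supported sections (which holds if $\psi$ is linear on the fibers or if $M$ is compact). Let $j\psi$ be the induced automorphism of $J^\infty E$, $j\psi(j\phi(x))=j(\hat\psi\phi)(\psi_M(x))$, and let $\det\psi_M$ be the function with $\psi_M^*\nu=(\det\psi_M)\,\nu$. Then $\Psi(\mathcal P)=\mathcal P\circ\hat\psi$ maps $\mathcal F$ to $\mathcal F$, and $$\{\Psi(\mathcal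 P),\Psi(\mathcal Q)\}=\Psi(\{\mathcal P,\mathcal Q\})\quad\text{for all }\mathcal P,\mathcal Q\in\mathcal F$$ if and only if $\omega$ is covariant with respect to $\psi$, that is, $$\omega((j\psi)^*\theta,(j\psi)^*\theta')=(\det\psi_M)\,(j\psi)^*(\omega(\theta,\theta'))\quad\text{for all }\theta,\theta'\in\Omega^{n,1}_0 .$$ Moreover, $\omega$ is covariant with respect to $\psi$ if and only if, in all bundle charts $(x,u)$ around the point $x\in M$ under a jet and $(\tilde x,\tilde u)$ around $\psi_M(x)$, $$\tilde\omega^{ab}\circ j\psi=(\det\psi_M)\,\omega^{cd}\,\frac{\partial\psi^a}{\partial u^c}\frac{\partial\psi^b}{\partial u^d},\qquad \psi^a=\tilde u^a\circ\psi .$$ -/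

import Mathlib

open Bundle Set MeasureTheory
open scoped Manifold ContDiff

namespace LocalFunctionals

noncomputable section

/-! ## Multi-indices and operators indexed by them -/

/-- Symmetric multi-indices `I = (I 0, …, I (n-1))`; the order is `|I| = ∑ i, I i`. -/
abbrev MultiIndex (n : ℕ) := Fin n → ℕ

/-- The multi-indices of order at most `p`. -/
def multiIndexLE (n p : ℕ) : Finset (MultiIndex n) :=
  (Fintype.piFinset fun _ => Finset.range (p + 1)).filter fun I => ∑ i, I i ≤ p

/-- `T^I = T_0^{I 0} ∘ ⋯ ∘ T_{n-1}^{I (n-1)}` for operators `T_0, …, T_{n-1}`. -/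
def multiPow {n : ℕ} {α : Type*} (T : Fin n → α → α) (I : MultiIndex n) (f : α) : α :=
  (List.finRange n).foldr (fun i g => (T i)^[I i] g) f

/-- The `i`-th partial derivative of a function on `ℝⁿ`. -/
def partialD {n : ℕ} (i : Fin n) (f : EuclideanSpace ℝ (Fin n) → ℝ) :
    EuclideanSpace ℝ (Fin n) → ℝ :=
  fun y => fderiv ℝ f y (EuclideanSpace.basisFun (Fin n) ℝ i)

/-! ## Coordinates on the infinite jet bundle: total derivatives and Euler operators -/

/-- Coordinates `(x^i, u^a_I)` on the infinite jet bundle over a chart; `z.1 i` is `x^i` and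
`z.2 a I` is `u^a_I`. -/
abbrev JetCoord (n m : ℕ) := EuclideanSpace ℝ (Fin n) × (Fin m → MultiIndex n → ℝ)

/-- The coordinates of order at most `p`. -/
def JetCoord.trunc {n m : ℕ} (p : ℕ) (z : JetCoord n m) :
    EuclideanSpace ℝ (Fin n) × (Fin m → {I // I ∈ multiIndexLE n p} → ℝ) :=
  (z.1, fun a I => z.2 a I)

/-- `∂f/∂x^i`. -/
def partialX {n m : ℕ} (i : Fin n) (f : JetCoord n m → ℝ) : JetCoord n m → ℝ :=
  fun z => deriv (fun t : ℝ => f (z.1 + t • EuclideanSpace.basisFun (Fin n) ℝ i, z.2)) 0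

/-- `∂f/∂u^a_I`. -/
def partialU {n m : ℕ} (a : Fin m) (I : MultiIndex n) (f : JetCoord n m → ℝ) :
    JetCoord n m → ℝ :=
  fun z => deriv (fun t : ℝ => f (z.1, z.2 + Pi.single a (Pi.single I t))) 0

/-- The total derivative `D_i = ∂/∂x^i + ∑ u^a_{iJ} ∂/∂u^a_J`. The sum is finite for functions
that depend on finitely many of the coordinates. -/
def totalD {n m : ℕ} (i : Fin n) (f : JetCoord n m → ℝ) : JetCoord n m → ℝ :=
  fun z => partialX i f z +
    ∑ᶠ q : Fin m × MultiIndex n, z.2 q.1 (q.2 + Pi.single i 1) * partialU q.1 q.2 f z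

/-- The Euler operator `E_a(L) = ∑_I (-D)_I (∂L/∂u^a_I)` in coordinates. -/
def eulerCoord {n m : ℕ} (a : Fin m) (L : JetCoord n m → ℝ) : JetCoord n m → ℝ :=
  fun z => ∑ᶠ I : MultiIndex n, (-1) ^ (∑ i, I i) * multiPow totalD I (partialU a I L) z

/-! ## The base manifold: volume forms and integration -/

section Base

variable {n : ℕ} {M : Type*} [TopologicalSpace M] [ChartedSpace (EuclideanSpace ℝ (Fin n)) M]

/-- Alternating `n`-forms on the tangent space at `x`. -/
abbrev TopForm (n : ℕ) {M : Type*} [TopologicalSpace M]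
    [ChartedSpace (EuclideanSpace ℝ (Fin n)) M] (x : M) :=
  (TangentSpace (𝓡 n) x) [⋀^Fin n]→ₗ[ℝ] ℝ

/-- The coordinate vector `∂/∂x^i` of the chart at `c`, at the point with coordinates `y`. -/
def coordVec (c : M) (y : EuclideanSpace ℝ (Fin n)) (i : Fin n) :
    TangentSpace (𝓡 n) ((chartAt (EuclideanSpace ℝ (Fin n)) c).symm y) :=
  mfderiv (𝓡 n) (𝓡 n) (chartAt (EuclideanSpace ℝ (Fin n)) c).symm y
    (EuclideanSpace.basisFun (Fin n) ℝ i)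

/-- The form `d^n x = dx^1 ∧ ⋯ ∧ dx^n` of the chart at `c`, at the point `x`. -/
def coordForm (c x : M) : TopForm n x :=
  AlternatingMap.compLinearMap (EuclideanSpace.basisFun (Fin n) ℝ).toBasis.det
    (mfderiv (𝓡 n) (𝓡 n) (chartAt (EuclideanSpace ℝ (Fin n)) c) x).toLinearMap

/-- The coefficient `f` of an `n`-form `ν = f d^n x` in the chart at `c`, as a function of the
coordinates. -/
def formCoeff (ν : ∀ x : M, TopForm n x) (c : M) (y : EuclideanSpace ℝ (Fin n)) : ℝ :=
  ν ((chartAt (EuclideanSpace ℝ (Fin n)) c).symm y) (coordVec c y)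

variable (n M) in
/-- A volume form on `M`: a smooth nowhere vanishing `n`-form. -/
structure VolumeForm where
  /-- the underlying `n`-form -/
  form : ∀ x : M, TopForm n x
  smooth : ∀ c : M,
    ContDiffOn ℝ ∞ (formCoeff form c) (chartAt (EuclideanSpace ℝ (Fin n)) c).target
  ne_zero : ∀ x, form x ≠ 0

variable (n M) in
/-- A smooth partition of unity subordinate to the charts of `M`. -/
def chartPartition [IsManifold (𝓡 n) ∞ M] [T2Space M] [SigmaCompactSpace M] :
    SmoothPartitionOfUnity M (𝓡 n) M univ :=
  (SmoothPartitionOfUnity.exists_isSubordinate_chartAt_source (𝓡 n) M).choose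

/-- The measure on `M` with `∫_M g ν = ∫ g ∂(ν.measure)`, for the orientation of `M` given by `ν`:
`∑_c ρ_c |f_c| d^n x`, where `(ρ_c)` is a partition of unity subordinate to the charts and
`ν = f_c d^n x` in the chart at `c`. -/
def VolumeForm.measure [IsManifold (𝓡 n) ∞ M] [T2Space M] [SigmaCompactSpace M]
    [MeasurableSpace M] (ν : VolumeForm n M) : Measure M :=
  Measure.sum fun c : M =>
    Measure.map (chartAt (EuclideanSpace ℝ (Fin n)) c).symm
      ((volume.restrict (chartAt (EuclideanSpace ℝ (Fin n)) c).target).withDensity fun y =>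
        ENNReal.ofReal
          (chartPartition n M c ((chartAt (EuclideanSpace ℝ (Fin n)) c).symm y) *
            |formCoeff ν.form c y|))

/-- The pull-back of an `n`-form at `f x` to an `n`-form at `x`. -/
def pullbackForm (f : M → M) (x : M) : TopForm n (f x) →ₗ[ℝ] TopForm n x :=
  { toFun := fun κ => κ.compLinearMap (mfderiv (𝓡 n) (𝓡 n) f x).toLinearMap
    map_add' := fun _ _ => rfl
    map_smul' := fun _ _ => rfl }

/-- The determinant `det f` of a map `f : M → M` with respect to `ν`: the function with
`f^* ν = (det f) ν`. -/
def VolumeForm.det (ν : VolumeForm n M) (f : M → M) (x : M) : ℝ :=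
  pullbackForm f x (ν.form (f x)) (fun i => EuclideanSpace.basisFun (Fin n) ℝ i) /
    ν.form x (fun i => EuclideanSpace.basisFun (Fin n) ℝ i)

end Base

/-! ## The vector bundle `E`, with fibers `V x`, and its jets -/

section Bundle

variable {n m : ℕ} {M : Type*} [TopologicalSpace M] [ChartedSpace (EuclideanSpace ℝ (Fin n)) M]
  {V : M → Type*} [TopologicalSpace (TotalSpace (EuclideanSpace ℝ (Fin m)) V)]
  [∀ x, AddCommGroup (V x)] [∀ x, Module ℝ (V x)] [∀ x, TopologicalSpace (V x)]
  [FiberBundle (EuclideanSpace ℝ (Fin m)) V]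

variable (n m V) in
/-- The space `ΓE` of smooth sections. -/
abbrev Sec := ContMDiffSection (𝓡 n) (EuclideanSpace ℝ (Fin m)) ∞ V

/-- `φ` has compact support. -/
def CompactSupp (φ : Sec n m V) : Prop := ∃ K : Set M, IsCompact K ∧ ∀ x ∉ K, φ x = 0

variable (n m V) in
/-- The compactly supported smooth sections. -/
abbrev CompactSec := {φ : Sec n m V // CompactSupp φ}

variable (m V) in
/-- The bundle chart at `c`: the trivialization of `E` at `c`, used with the chart of `M` at `c`. -/
abbrev triv (c : M) :=
  trivializationAt (EuclideanSpace ℝ (Fin m)) V c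

variable (n m V) in
/-- The domain in `M` of the bundle chart at `c`. -/
def dom (c : M) : Set M :=
  (chartAt (EuclideanSpace ℝ (Fin n)) c).source ∩ (triv m V c).baseSet

variable (n m V) in
/-- The image in `ℝⁿ` of the domain of the bundle chart at `c`. -/
def domCoord (c : M) : Set (EuclideanSpace ℝ (Fin n)) :=
  (chartAt (EuclideanSpace ℝ (Fin n)) c).target ∩
    (chartAt (EuclideanSpace ℝ (Fin n)) c).symm ⁻¹' (triv m V c).baseSet

/-- The component `u^a ∘ φ` of a section in the bundle chart at `c`, as a function of the
coordinates on `M`. -/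
def secCoord (c : M) (φ : Sec n m V) (a : Fin m) (y : EuclideanSpace ℝ (Fin n)) : ℝ :=
  (triv m V c ⟨(chartAt (EuclideanSpace ℝ (Fin n)) c).symm y,
    φ ((chartAt (EuclideanSpace ℝ (Fin n)) c).symm y)⟩).2 a

variable (n m V) in
/-- Two sections have the same infinite jet at `x` if in bundle charts around `x` all their partial
derivatives (of order `≥ 0`) agree at `x`. -/
def jetSetoid (x : M) : Setoid (Sec n m V) where
  r φ φ' := ∀ c : M, x ∈ dom n m V c → ∀ (a : Fin m) (I : MultiIndex n),
    multiPow partialD I (secCoord c φ a) (chartAt (EuclideanSpace ℝ (Fin n)) c x) =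
      multiPow partialD I (secCoord c φ' a) (chartAt (EuclideanSpace ℝ (Fin n)) c x)
  iseqv :=
    ⟨fun _ _ _ _ _ => rfl, fun h c hc a I => (h c hc a I).symm,
      fun h h' c hc a I => (h c hc a I).trans (h' c hc a I)⟩

variable (n m V) in
/-- The infinite jet bundle `J^∞E`. -/
def JetBundle := Σ x : M, Quotient (jetSetoid n m V x)

/-- The projection `π^∞ : J^∞E → M`. -/
def JetBundle.base (j : JetBundle n m V) : M := j.1

/-- The infinite jet `j^∞φ (x)`. -/
def jet (φ : Sec n m V) (x : M) : JetBundle n m V := ⟨x, Quotient.mk _ φ⟩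

/-- A section whose jet at `j.base` is `j`. -/
def JetBundle.repr (j : JetBundle n m V) : Sec n m V := Quotient.out j.2

/-- The point of `E` under a jet. -/
def JetBundle.val (j : JetBundle n m V) : V j.base := j.repr j.base

/-- The coordinates `(x^i, u^a_I)` of a jet over the bundle chart at `c`. Over `dom n m V c` they do
not depend on the section that represents the jet. -/
def jetCoord (c : M) (j : JetBundle n m V) : JetCoord n m :=
  (chartAt (EuclideanSpace ℝ (Fin n)) c j.base, fun a I =>
    multiPow partialD I (secCoord c j.repr a) (chartAt (EuclideanSpace ℝ (Fin n)) c j.base))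

/-! ## Local functions -/

/-- `f` is a representative of `P : J^∞E → ℝ` in the bundle chart at `c`, of order at most `p`:
`f` is a smooth function of the coordinates of order at most `p`, and `P` is `f` in coordinates. -/
def IsRep (c : M) (p : ℕ) (P : JetBundle n m V → ℝ) (f : JetCoord n m → ℝ) : Prop :=
  (∃ g : EuclideanSpace ℝ (Fin n) × (Fin m → {I // I ∈ multiIndexLE n p} → ℝ) → ℝ,
    ContDiffOn ℝ ∞ g (domCoord n m V c ×ˢ univ) ∧ ∀ z, f z = g (z.trunc p)) ∧
  ∀ j : JetBundle n m V, j.base ∈ dom n m V c → P j = f (jetCoord c j)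

/-- `P ∈ Loc_E`: `P` is the pull-back of a smooth function on a finite jet bundle `J^pE`. -/
def IsLocal (P : JetBundle n m V → ℝ) : Prop :=
  ∃ p : ℕ, ∀ c : M, ∃ f, IsRep c p P f

open Classical in
/-- A representative of a local function in the bundle chart at `c`. Any two agree over
`domCoord n m V c`. -/
def rep (c : M) (P : JetBundle n m V → ℝ) : JetCoord n m → ℝ :=
  if h : ∃ f, ∃ p, IsRep c p P f then h.choose else 0

/-! ## The forms `Ω₀^{n,1}` and the Euler-Lagrange operator -/

variable (n m V) in
/-- Families `α` that assign to a jet `j` over `x` a linear map from the vertical space `E_x` to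
the `n`-forms at `x`. The form `θ ∧ κ`, with `θ` a contact one-form of order zero and `κ` an
`n`-form on `M`, is the family `v ↦ θ(v) κ`; it determines `θ ∧ κ`, since such a `θ` vanishes on the
horizontal vectors and depends only on the vertical part in `E` of a vector. -/
abbrev FormFamily := ∀ j : JetBundle n m V, V j.base →ₗ[ℝ] TopForm n j.base

section Vector

variable [VectorBundle ℝ (EuclideanSpace ℝ (Fin m)) V]

/-- The form `θ^a ∧ κ`, where `θ^a = du^a - u^a_i dx^i` in the bundle chart at `c`: the family
`v ↦ v^a κ`. -/
def contactWedge (c : M) (a : Fin m) (κ : ∀ x : M, TopForm n x) : FormFamily n m V :=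
  fun j => ((EuclideanSpace.proj a).toLinearMap ∘ₗ
    (triv m V c).linearMapAt ℝ j.base : V j.base →ₗ[ℝ] ℝ).smulRight (κ j.base)

/-- `α ∈ Ω₀^{n,1}`: over each bundle chart, `α = ∑ f_a θ^a ∧ d^n x` with local functions `f_a`. -/
def IsSourceForm (α : FormFamily n m V) : Prop :=
  ∃ p : ℕ, ∀ c : M, ∃ (A : Fin m → JetBundle n m V → ℝ),
    (∀ a, ∃ f, IsRep c p (A a) f) ∧
    ∀ j : JetBundle n m V, j.base ∈ dom n m V c →
      α j = ∑ a, A a j • contactWedge c a (coordForm c) j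

/-- The Euler-Lagrange operator: `E(Pν) = ∑ E_a(L) θ^a ∧ d^n x`, where `Pν = L d^n x`. At a jet over
`x` it is computed in the bundle chart at `x`. -/
def eulerForm (ν : VolumeForm n M) (P : JetBundle n m V → ℝ) : FormFamily n m V :=
  fun j => ∑ a, eulerCoord a (fun z => formCoeff ν.form j.base z.1 * rep j.base P z)
    (jetCoord j.base j) • contactWedge j.base a (coordForm j.base) j

/-- `w : Ω₀^{n,1} × Ω₀^{n,1} → Loc_E` is a skew-symmetric `Loc_E`-module homomorphism in each
variable. Nothing is said about the values of `w` on families outside `Ω₀^{n,1}`. -/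
structure IsSkewHom (w : FormFamily n m V → FormFamily n m V → JetBundle n m V → ℝ) : Prop where
  isLocal : ∀ α β, IsSourceForm α → IsSourceForm β → IsLocal (w α β)
  add_left : ∀ α α' β, IsSourceForm α → IsSourceForm α' → IsSourceForm β →
    w (α + α') β = w α β + w α' β
  add_right : ∀ α β β', IsSourceForm α → IsSourceForm β → IsSourceForm β' →
    w α (β + β') = w α β + w α β'
  smul_left : ∀ f α β, IsLocal f → IsSourceForm α → IsSourceForm β →
    w (fun j => f j • α j) β = fun j => f j * w α β j
  smul_right : ∀ f α β, IsLocal f → IsSourceForm α → IsSourceForm β →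
    w α (fun j => f j • β j) = fun j => f j * w α β j
  skew : ∀ α β, IsSourceForm α → IsSourceForm β → w α β = -w β α

/-! ## Local functionals and their bracket -/

/-- `Pν ∈ Ω_c^{n,0}`: `P` is a local function, and `P` and `E(Pν)` have compact support along each
compactly supported section. -/
def IsCompactLocal (ν : VolumeForm n M) (P : JetBundle n m V → ℝ) : Prop :=
  IsLocal P ∧ ∀ φ : Sec n m V, CompactSupp φ → ∃ K : Set M, IsCompact K ∧
    ∀ x ∉ K, P (jet φ x) = 0 ∧ eulerForm ν P (jet φ x) = 0

section Functionals

variable [IsManifold (𝓡 n) ∞ M] [T2Space M] [SigmaCompactSpace M] [MeasurableSpace M]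

/-- The functional `φ ↦ ∫_M (P ∘ jφ) ν`. -/
def integralOf (ν : VolumeForm n M) (P : JetBundle n m V → ℝ) : CompactSec n m V → ℝ :=
  fun φ => ∫ x, P (jet φ.1 x) ∂ν.measure

variable (m V) in
/-- The space `𝓕` of local functionals `∫_M P ν`. -/
def localFunctionals (ν : VolumeForm n M) : Set (CompactSec n m V → ℝ) :=
  {S | ∃ P, IsCompactLocal ν P ∧ integralOf ν P = S}

open Classical in
/-- A local function `P` with `S = ∫_M P ν`. The form `E(Pν)` depends only on `S`. -/
def density (ν : VolumeForm n M) (S : CompactSec n m V → ℝ) : JetBundle n m V → ℝ :=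
  if h : S ∈ localFunctionals m V ν then h.choose else 0

/-- The bracket `{S, T}(φ) = ∫_M [w(E(P), E(Q)) ∘ jφ] ν` of `S = ∫_M P ν` and `T = ∫_M Q ν`. -/
def bracket (ν : VolumeForm n M) (w : FormFamily n m V → FormFamily n m V → JetBundle n m V → ℝ)
    (S T : CompactSec n m V → ℝ) : CompactSec n m V → ℝ :=
  integralOf ν (w (eulerForm ν (density ν S)) (eulerForm ν (density ν T)))

end Functionals

end Vector

/-! ## Automorphisms of `E` that send fibers to fibers -/

variable (n m V) in
/-- A diffeomorphism `ψ` of the total space `E` that sends the fiber over `x` to the fiber over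
`ψ_M x`, for a diffeomorphism `ψ_M` of `M`. It need not be linear on the fibers. -/
structure BundleAut where
  /-- the diffeomorphism `ψ` of the total space -/
  toDiffeo : Diffeomorph ((𝓡 n).prod (𝓡 m)) ((𝓡 n).prod (𝓡 m))
    (TotalSpace (EuclideanSpace ℝ (Fin m)) V) (TotalSpace (EuclideanSpace ℝ (Fin m)) V) ∞
  /-- the induced diffeomorphism `ψ_M` of the base -/
  base : Diffeomorph (𝓡 n) (𝓡 n) M M ∞
  proj_eq : ∀ p, (toDiffeo p).proj = base p.proj

namespace BundleAut

variable (ψ : BundleAut n m V)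

/-- The map `ψ ∘ φ ∘ ψ_M⁻¹ : M → E`. -/
def transport (φ : Sec n m V) (x : M) : TotalSpace (EuclideanSpace ℝ (Fin m)) V :=
  ψ.toDiffeo ⟨ψ.base.symm x, φ (ψ.base.symm x)⟩

set_option linter.unusedSectionVars false in
theorem transport_proj (φ : Sec n m V) (x : M) : (ψ.transport φ x).proj = x := by
  simp [transport, ψ.proj_eq]

set_option linter.unusedSectionVars false in
theorem mk_cast {x : M} (p : TotalSpace (EuclideanSpace ℝ (Fin m)) V) (h : p.proj = x) :
    (⟨x, h ▸ p.2⟩ : TotalSpace (EuclideanSpace ℝ (Fin m)) V) = p := by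
  subst h; rfl

/-- The induced map `ψ̂ : ΓE → ΓE`, `ψ̂ φ = ψ ∘ φ ∘ ψ_M⁻¹`. -/
def onSec (φ : Sec n m V) : Sec n m V where
  toFun x := ψ.transport_proj φ x ▸ (ψ.transport φ x).2
  contMDiff_toFun := by
    have h : ContMDiff (𝓡 n) ((𝓡 n).prod (𝓡 m)) ∞ (ψ.transport φ) :=
      ψ.toDiffeo.contMDiff.comp (φ.contMDiff.comp ψ.base.symm.contMDiff)
    convert h using 1
    funext x
    exact mk_cast _ _

theorem mk_onSec (φ : Sec n m V) (x : M) :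
    (⟨x, ψ.onSec φ x⟩ : TotalSpace (EuclideanSpace ℝ (Fin m)) V) =
      ψ.toDiffeo ⟨ψ.base.symm x, φ (ψ.base.symm x)⟩ :=
  mk_cast _ (ψ.transport_proj φ x)

/-- `ψ̂` maps compactly supported sections to compactly supported sections. This holds, for instance,
if `M` is compact or if `ψ` is linear on the fibers. -/
def PreservesCompactSupp : Prop := ∀ φ : Sec n m V, CompactSupp φ → CompactSupp (ψ.onSec φ)

/-- The map `ψ̂` on compactly supported sections. -/
def onCompactSec (h : ψ.PreservesCompactSupp) (φ : CompactSec n m V) : CompactSec n m V :=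
  ⟨ψ.onSec φ.1, h φ.1 φ.2⟩

/-- The induced map `jψ : J^∞E → J^∞E`, `jψ (j^∞φ (x)) = j^∞(ψ ∘ φ ∘ ψ_M⁻¹) (ψ_M x)`. The right side
depends only on the jet of `φ` at `x`. -/
def onJet (j : JetBundle n m V) : JetBundle n m V := jet (ψ.onSec j.repr) (ψ.base j.base)

/-- The map `(u^b) ↦ (ψ^a)` between the fibers over `x` and `ψ_M x`, in the bundle charts at `c` and
`c'`. -/
def fiberCoord (c c' x : M) (w : EuclideanSpace ℝ (Fin m)) : EuclideanSpace ℝ (Fin m) :=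
  (triv m V c' (ψ.toDiffeo ⟨x, (triv m V c).symm x w⟩)).2

/-- `∂ψ^a/∂u^b` at the point `j.val` of `E`, in the bundle charts at `c` and `c'`. -/
def partialPsi (c c' : M) (j : JetBundle n m V) (a b : Fin m) : ℝ :=
  fderiv ℝ (ψ.fiberCoord c c' j.base) (triv m V c ⟨j.base, j.val⟩).2
    (EuclideanSpace.basisFun (Fin m) ℝ b) a

variable [VectorBundle ℝ (EuclideanSpace ℝ (Fin m)) V]

/-- The derivative at the point `j.val` of `ψ` as a map from the fiber over `x = j.base` to the
fiber over `ψ_M x`. -/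
def vertD (j : JetBundle n m V) : V j.base →ₗ[ℝ] V (ψ.onJet j).base :=
  ((triv m V (ψ.base j.base)).symmₗ ℝ (ψ.base j.base)) ∘ₗ
    (fderiv ℝ (ψ.fiberCoord j.base (ψ.base j.base) j.base)
      (triv m V j.base ⟨j.base, j.val⟩).2).toLinearMap ∘ₗ
    (triv m V j.base).linearMapAt ℝ j.base

/-- The pull-back `(jψ)^* α`. Its value on a vertical vector `v` at `j` is the pull-back by `ψ_M` of
the `n`-form which is the value of `α` at `jψ j` on the image of `v` under `ψ`. -/
def pullback (α : FormFamily n m V) : FormFamily n m V :=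
  fun j => pullbackForm ψ.base j.base ∘ₗ α (ψ.onJet j) ∘ₗ ψ.vertD j

/-- `w` is covariant with respect to `ψ`:
`w((jψ)^*θ, (jψ)^*θ') = (det ψ_M) (jψ)^*(w(θ, θ'))` for `θ, θ' ∈ Ω₀^{n,1}`. -/
def Covariant (ν : VolumeForm n M)
    (w : FormFamily n m V → FormFamily n m V → JetBundle n m V → ℝ) : Prop :=
  ∀ θ θ', IsSourceForm θ → IsSourceForm θ' → ∀ j : JetBundle n m V,
    w (ψ.pullback θ) (ψ.pullback θ') j = ν.det ψ.base j.base * w θ θ' (ψ.onJet j)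

end BundleAut

variable [VectorBundle ℝ (EuclideanSpace ℝ (Fin m)) V]

open Classical in
/-- A form in `Ω₀^{n,1}` that coincides with `θ^a ∧ ν` (bundle chart at `c`) over a neighborhood of
`x ∈ dom n m V c`. -/
def globalContact (ν : VolumeForm n M) (c : M) (a : Fin m) (x : M) : FormFamily n m V :=
  Classical.epsilon fun α => IsSourceForm α ∧
    ∃ U ∈ nhds x, ∀ j : JetBundle n m V, j.base ∈ U → α j = contactWedge c a ν.form j

/-- The components `w^{ab} = w(θ^a ∧ ν, θ^b ∧ ν)` in the bundle chart at `c`. -/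
def omegaComp (ν : VolumeForm n M)
    (w : FormFamily n m V → FormFamily n m V → JetBundle n m V → ℝ) (c : M) (a b : Fin m)
    (j : JetBundle n m V) : ℝ :=
  w (globalContact ν c a j.base) (globalContact ν c b j.base) j

end Bundle

end

end LocalFunctionals

/-! The proof rests on two transformation laws. Put `P' = (det ψ_M) (P ∘ jψ)`, so that `P' ν` is the
pull-back of `P ν`. The change of variables `x ↦ ψ_M x` gives `Ψ(∫ P ν) = ∫ P' ν`
(`VolumeForm.integral_det_mul`; positivity of the determinant removes the absolute value), and
naturality of the Euler operator gives `E(P' ν) = (jψ)^* E(P ν)` (`BundleAut.eulerForm_pullback`).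
Hence the bracket of `Ψ(𝒫)` and `Ψ(𝒬)` is the integral of `ω((jψ)^*E(P), (jψ)^*E(Q))`, while `Ψ` of
the bracket is the integral of `(det ψ_M) (jψ)^*(ω(E(P), E(Q)))` (`bracket_comp`, `comp_bracket`).
Covariance makes the two integrands equal.

For the converse, let `ρ` be a cut-off function in a bundle chart. The density `ρ u^a` has
Euler-Lagrange form `ρ θ^a ∧ ν` (`eulerForm_coordDensity`). Preservation of the bracket is applied
to `ρ u^a` and `σ ρ u^b`. Linearity over local functions takes the arbitrary function `σ` out of
both integrands, so the fundamental lemma of the calculus of variations makes them equal along every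
compactly supported section; every jet is the jet of such a section. With `ρ = 1` near a point this
is covariance on the frame `θ^a ∧ ν` there. The frame suffices, because multiplication by cut-offs
shows that the value of `ω` at a jet is determined by the coefficients of its arguments at that jet
(`IsSkewHom.eq_sum_omegaComp`). The same expansion gives the component form of covariance
(`covariant_iff`).

Naturality of the Euler operator is proved variationally in coordinates (`CoordMap.eulerCoord_pr`).
A Lagrangian and its pull-back are differentiated along `u + t η`, integrated, and integrated by
parts on the source and on the target; this compares both Euler expressions against arbitrary test
functions, and no formula for iterated total derivatives is needed. The same first variation shows
that `E(P ν)` depends only on the functional (`eulerForm_eq_of_integralOf_eq`), so the bracket does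
not depend on the chosen densities. A change of bundle chart is the identity automorphism seen in
two charts, so chart independence comes from the lemmas on `ψ` applied to `BundleAut.refl`. -/

namespace LocalFunctionals

noncomputable section

/-! ### Multi-index powers of operators -/

section MultiPow

variable {n : ℕ} {α β : Type*}

/-- The operator `∏_{i ∈ l} T_i^{I i}`. -/
def listPow (T : Fin n → α → α) (I : MultiIndex n) (l : List (Fin n)) (f : α) : α :=
  l.foldr (fun i g => (T i)^[I i] g) f

theorem multiPow_eq_listPow (T : Fin n → α → α) (I : MultiIndex n) (f : α) :
    multiPow T I f = listPow T I (List.finRange n) f := rfl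

theorem iterate_rel {Q : α → β → Prop} {T : α → α} {S : β → β}
    (h : ∀ f g, Q f g → Q (T f) (S g)) (k : ℕ) {f : α} {g : β} (hfg : Q f g) :
    Q (T^[k] f) (S^[k] g) := by
  induction k generalizing f g with
  | zero => exact hfg
  | succ k ih => exact ih (h _ _ hfg)

/-- Most facts about `multiPow` below are instances of this relational induction. With `Q`
expressing equality on an open set, smoothness, an order bound or a derivative in a parameter, only
a single operator step has to be checked. -/
theorem listPow_rel {Q : α → β → Prop} {T : Fin n → α → α} {S : Fin n → β → β}
    (h : ∀ i f g, Q f g → Q (T i f) (S i g)) (I : MultiIndex n) (l : List (Fin n)) {f : α} {g : β}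
    (hfg : Q f g) : Q (listPow T I l f) (listPow S I l g) := by
  induction l with
  | nil => exact hfg
  | cons k l ih => exact iterate_rel (h k) _ ih

/-- A relation compatible with `T_i` and `S_i` is compatible with their multi-index powers. -/
theorem multiPow_rel {Q : α → β → Prop} {T : Fin n → α → α} {S : Fin n → β → β}
    (h : ∀ i f g, Q f g → Q (T i f) (S i g)) (I : MultiIndex n) {f : α} {g : β}
    (hfg : Q f g) : Q (multiPow T I f) (multiPow S I g) :=
  listPow_rel h I _ hfg

theorem multiPow_map (φ : α → β) {T : Fin n → α → α} {S : Fin n → β → β}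
    (h : ∀ i f, φ (T i f) = S i (φ f)) (I : MultiIndex n) (f : α) :
    φ (multiPow T I f) = multiPow S I (φ f) :=
  multiPow_rel (Q := fun f g => φ f = g) (fun i f g hfg => by rw [h, hfg]) I rfl

theorem multiPow_pred {Q : α → Prop} {T : Fin n → α → α}
    (h : ∀ i f, Q f → Q (T i f)) (I : MultiIndex n) {f : α} (hf : Q f) : Q (multiPow T I f) :=
  multiPow_rel (Q := fun f (_ : Unit) => Q f) (S := fun _ => id) (fun i f _ => h i f) I
    (g := ()) hf

theorem multiPow_zero (T : Fin n → α → α) (f : α) : multiPow T 0 f = f := by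
  rw [multiPow_eq_listPow]
  induction List.finRange n with
  | nil => rfl
  | cons k l ih => exact ih

/-- Order bookkeeping: paired through `multiPow_rel` with operators that raise the order by one, the
successor on `ℕ` counts the order of the result. -/
theorem multiPow_succ_eq (I : MultiIndex n) (p : ℕ) :
    multiPow (fun _ q => q + 1) I p = p + ∑ i, I i := by
  have h : ∀ l : List (Fin n), listPow (fun _ q => q + 1) I l p = p + (l.map I).sum := by
    intro l
    induction l with
    | nil => rfl
    | cons k l ih =>
      have : ∀ a b : ℕ, (fun q => q + 1)^[a] b = b + a := by
        intro a b
        induction a generalizing b with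
        | zero => rfl
        | succ a ih => rw [Function.iterate_succ_apply, ih]; omega
      change (fun q => q + 1)^[I k] (listPow (fun _ q => q + 1) I l p) = _
      rw [ih, this]
      simp; omega
  rw [multiPow_eq_listPow, h, ← List.ofFn_eq_map, List.sum_ofFn]

variable {T : Fin n → α → α} {S : α → Prop} {R : α → α → Prop}

/-- Partial derivatives commute only on smooth functions and only over the open set in question; the
predicate `S` and the relation `R` stand for these two restrictions. -/
theorem listPow_comm (hR : ∀ i f g, R f g → R (T i f) (T i g)) (refl : ∀ f, R f f)
    (trans : ∀ f g h, R f g → R g h → R f h) (hS : ∀ i f, S f → S (T i f))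
    (comm : ∀ i k f, S f → R (T i (T k f)) (T k (T i f))) (I : MultiIndex n)
    (l : List (Fin n)) (i : Fin n) {f : α} (hf : S f) :
    R (listPow T I l (T i f)) (T i (listPow T I l f)) := by
  have hSl : ∀ l, S (listPow T I l f) := fun l =>
    listPow_rel (Q := fun f (_ : Unit) => S f) (S := fun _ => id) (fun i f _ => hS i f) I l
      (g := ()) hf
  have key : ∀ (k : Fin n) (a : ℕ) (g : α), S g → R ((T k)^[a] (T i g)) (T i ((T k)^[a] g)) := by
    intro k a
    induction a with
    | zero => exact fun g _ => refl _
    | succ a ih =>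
      intro g hg
      exact trans _ _ _ (iterate_rel (hR k) a (comm k i g hg)) (ih _ (hS k g hg))
  induction l with
  | nil => exact refl _
  | cons k l ih => exact trans _ _ _ (iterate_rel (hR k) _ ih) (key k _ _ (hSl l))

/-- `T^{I + e_i} = T_i T^I` for operators that commute up to the relation `R`. -/
theorem multiPow_add_single (hR : ∀ i f g, R f g → R (T i f) (T i g)) (refl : ∀ f, R f f)
    (trans : ∀ f g h, R f g → R g h → R f h) (hS : ∀ i f, S f → S (T i f))
    (comm : ∀ i k f, S f → R (T i (T k f)) (T k (T i f))) (I : MultiIndex n)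
    (i : Fin n) {f : α} (hf : S f) :
    R (multiPow T (I + Pi.single i 1) f) (T i (multiPow T I f)) := by
  have hSl : ∀ l, S (listPow T I l f) := fun l =>
    listPow_rel (Q := fun f (_ : Unit) => S f) (S := fun _ => id) (fun i f _ => hS i f) I l
      (g := ()) hf
  have key : ∀ (k : Fin n) (a : ℕ) (g : α), S g → R ((T k)^[a] (T i g)) (T i ((T k)^[a] g)) := by
    intro k a
    induction a with
    | zero => exact fun g _ => refl _
    | succ a ih =>
      intro g hg
      exact trans _ _ _ (iterate_rel (hR k) a (comm k i g hg)) (ih _ (hS k g hg))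
  -- The exponents of `I` and `I + e_i` differ only at `i`, which occurs exactly once in the list of
  -- indices. At that entry the extra factor is already outermost; at the other entries it is moved
  -- out by `key`.
  have notMem : ∀ l : List (Fin n), i ∉ l →
      listPow T (I + Pi.single i 1 : MultiIndex n) l f = listPow T I l f := by
    intro l hl
    induction l with
    | nil => rfl
    | cons k l ih =>
      rw [List.mem_cons, not_or] at hl
      change (T k)^[(I + Pi.single i 1 : MultiIndex n) k] (listPow T (I + Pi.single i 1 : MultiIndex n) l f) = _
      rw [ih hl.2, Pi.add_apply, Pi.single_eq_of_ne (Ne.symm hl.1), add_zero]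
      rfl
  have mem : ∀ l : List (Fin n), l.Nodup → i ∈ l →
      R (listPow T (I + Pi.single i 1 : MultiIndex n) l f) (T i (listPow T I l f)) := by
    intro l hl hi
    induction l with
    | nil => simp at hi
    | cons k l ih =>
      rw [List.nodup_cons] at hl
      change R ((T k)^[(I + Pi.single i 1 : MultiIndex n) k] (listPow T (I + Pi.single i 1 : MultiIndex n) l f))
        (T i ((T k)^[I k] (listPow T I l f)))
      by_cases hk : k = i
      · subst hk
        rw [notMem l hl.1, Pi.add_apply, Pi.single_eq_same, Function.iterate_succ_apply']
        exact refl _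
      · rw [Pi.add_apply, Pi.single_eq_of_ne hk, add_zero]
        have := ih hl.2 (by simpa [Ne.symm hk] using hi)
        exact trans _ _ _ (iterate_rel (hR k) _ this) (key k _ _ (hSl l))
  exact mem _ (List.nodup_finRange n) (List.mem_finRange i)

/-- Induction on the order `∑ i, I i`: a nonzero multi-index has a positive entry, which can be
lowered by one. -/
theorem MultiIndex.induction_single {P : MultiIndex n → Prop} (zero : P 0)
    (add : ∀ I i, P I → P (I + Pi.single i 1)) (I : MultiIndex n) : P I := by
  induction h : ∑ i, I i generalizing I with
  | zero =>
    have : I = 0 := by ext i; simpa using (Finset.sum_eq_zero_iff.mp h) i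
    exact this ▸ zero
  | succ k ih =>
    obtain ⟨i, hi⟩ : ∃ i, I i ≠ 0 := by
      by_contra! hc
      simp [hc] at h
    have hI : I - Pi.single i 1 + Pi.single i 1 = I := by
      ext k
      by_cases hk : k = i
      · subst hk; simp; omega
      · simp [hk]
    rw [← hI]
    refine add _ i (ih _ ?_)
    have := congrArg (fun I : MultiIndex n => ∑ i, I i) hI
    simp only [Pi.add_apply, Finset.sum_add_distrib, Finset.sum_pi_single', Finset.mem_univ,
      if_true] at this
    omega

theorem mem_multiIndexLE {p : ℕ} {I : MultiIndex n} : I ∈ multiIndexLE n p ↔ ∑ i, I i ≤ p := by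
  simp only [multiIndexLE, Finset.mem_filter, Fintype.mem_piFinset, Finset.mem_range,
    and_iff_right_iff_imp]
  intro h i
  have := Finset.single_le_sum (f := I) (fun i _ => Nat.zero_le _) (Finset.mem_univ i)
  omega

theorem mem_multiIndexLE_zero {I : MultiIndex n} : I ∈ multiIndexLE n 0 ↔ I = 0 := by
  rw [mem_multiIndexLE, Nat.le_zero, Finset.sum_eq_zero_iff]
  simp [funext_iff]

end MultiPow

/-! ### Partial derivatives on open subsets of `ℝⁿ` -/

section PartialD

variable {n : ℕ} {Ω : Set (EuclideanSpace ℝ (Fin n))}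

theorem _root_.ContDiffOn.differentiableAt_of_isOpen {E F : Type*} [NormedAddCommGroup E] [NormedSpace ℝ E]
    [NormedAddCommGroup F] [NormedSpace ℝ F] {f : E → F} {s : Set E} (hf : ContDiffOn ℝ ∞ f s)
    (hs : IsOpen s) {x : E} (hx : x ∈ s) : DifferentiableAt ℝ f x :=
  (hf.contDiffAt (hs.mem_nhds hx)).differentiableAt (by simp)

theorem contDiffOn_fderiv_apply {E F : Type*} [NormedAddCommGroup E] [NormedSpace ℝ E]
    [NormedAddCommGroup F] [NormedSpace ℝ F] {f : E → F} {s : Set E} (hf : ContDiffOn ℝ ∞ f s)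
    (hs : IsOpen s) (v : E) : ContDiffOn ℝ ∞ (fun x => fderiv ℝ f x v) s :=
  (hf.fderiv_of_isOpen hs (by simp)).clm_apply contDiffOn_const

theorem fderiv_fderiv_apply_comm {E F : Type*} [NormedAddCommGroup E] [NormedSpace ℝ E]
    [NormedAddCommGroup F] [NormedSpace ℝ F] {f : E → F} {s : Set E} (hf : ContDiffOn ℝ ∞ f s)
    (hs : IsOpen s) {x : E} (hx : x ∈ s) (v w : E) :
    fderiv ℝ (fun x => fderiv ℝ f x v) x w = fderiv ℝ (fun x => fderiv ℝ f x w) x v := by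
  have hd : DifferentiableAt ℝ (fderiv ℝ f) x :=
    ContDiffOn.differentiableAt_of_isOpen (hf.fderiv_of_isOpen hs (by simp)) hs hx
  have key : ∀ v w, fderiv ℝ (fun x => fderiv ℝ f x v) x w = fderiv ℝ (fderiv ℝ f) x w v := by
    intro v w
    rw [fderiv_clm_apply hd (differentiableAt_const v)]
    simp
  rw [key, key]
  exact ((hf.contDiffAt (hs.mem_nhds hx)).isSymmSndFDerivAt
    (by simpa using WithTop.coe_le_coe.2 (le_top : (2 : ℕ∞) ≤ ⊤))).eq w v

theorem contDiffOn_partialD (hΩ : IsOpen Ω) (i : Fin n) {f : EuclideanSpace ℝ (Fin n) → ℝ}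
    (hf : ContDiffOn ℝ ∞ f Ω) : ContDiffOn ℝ ∞ (partialD i f) Ω :=
  contDiffOn_fderiv_apply hf hΩ _

theorem partialD_congr (hΩ : IsOpen Ω) (i : Fin n) {f g : EuclideanSpace ℝ (Fin n) → ℝ}
    (h : EqOn f g Ω) : EqOn (partialD i f) (partialD i g) Ω := by
  intro y hy
  simp only [partialD]
  rw [(Filter.eventuallyEq_of_mem (hΩ.mem_nhds hy) h).fderiv_eq]

theorem multiPow_partialD_congr (hΩ : IsOpen Ω) (I : MultiIndex n)
    {f g : EuclideanSpace ℝ (Fin n) → ℝ} (h : EqOn f g Ω) :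
    EqOn (multiPow partialD I f) (multiPow partialD I g) Ω :=
  multiPow_rel (Q := fun f g => EqOn f g Ω) (fun i _ _ => partialD_congr hΩ i) I h

theorem contDiffOn_multiPow (hΩ : IsOpen Ω) (I : MultiIndex n) {f : EuclideanSpace ℝ (Fin n) → ℝ}
    (hf : ContDiffOn ℝ ∞ f Ω) : ContDiffOn ℝ ∞ (multiPow partialD I f) Ω :=
  multiPow_pred (Q := fun f => ContDiffOn ℝ ∞ f Ω) (fun i _ => contDiffOn_partialD hΩ i) I hf

theorem partialD_comm (hΩ : IsOpen Ω) (i k : Fin n) {f : EuclideanSpace ℝ (Fin n) → ℝ}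
    (hf : ContDiffOn ℝ ∞ f Ω) :
    EqOn (partialD i (partialD k f)) (partialD k (partialD i f)) Ω :=
  fun _ hy => fderiv_fderiv_apply_comm hf hΩ hy _ _

theorem multiPow_partialD_add_single (hΩ : IsOpen Ω) (I : MultiIndex n) (i : Fin n)
    {f : EuclideanSpace ℝ (Fin n) → ℝ} (hf : ContDiffOn ℝ ∞ f Ω) :
    EqOn (multiPow partialD (I + Pi.single i 1) f) (partialD i (multiPow partialD I f)) Ω :=
  multiPow_add_single (S := fun f => ContDiffOn ℝ ∞ f Ω) (R := fun f g => EqOn f g Ω)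
    (fun i _ _ => partialD_congr hΩ i) (fun _ _ _ => rfl) (fun _ _ _ h h' => h.trans h')
    (fun i _ => contDiffOn_partialD hΩ i) (fun i k _ => partialD_comm hΩ i k) I i hf

theorem multiPow_partialD_comm (hΩ : IsOpen Ω) (I : MultiIndex n) (i : Fin n)
    {f : EuclideanSpace ℝ (Fin n) → ℝ} (hf : ContDiffOn ℝ ∞ f Ω) :
    EqOn (multiPow partialD I (partialD i f)) (partialD i (multiPow partialD I f)) Ω :=
  listPow_comm (S := fun f => ContDiffOn ℝ ∞ f Ω) (R := fun f g => EqOn f g Ω)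
    (fun i _ _ => partialD_congr hΩ i) (fun _ _ _ => rfl) (fun _ _ _ h h' => h.trans h')
    (fun i _ => contDiffOn_partialD hΩ i) (fun i k _ => partialD_comm hΩ i k) I _ i hf

theorem multiPow_partialD_lin (hΩ : IsOpen Ω) (I : MultiIndex n) (t : ℝ)
    {f g : EuclideanSpace ℝ (Fin n) → ℝ} (hf : ContDiffOn ℝ ∞ f Ω) (hg : ContDiffOn ℝ ∞ g Ω) :
    EqOn (multiPow partialD I (fun y => f y + t * g y))
      (fun y => multiPow partialD I f y + t * multiPow partialD I g y) Ω := by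
  -- The recursion runs on pairs, so that smoothness of both summands is available at each step.
  have := multiPow_rel (T := fun i (q : (EuclideanSpace ℝ (Fin n) → ℝ) ×
      (EuclideanSpace ℝ (Fin n) → ℝ)) => (partialD i q.1, partialD i q.2)) (S := partialD)
    (Q := fun q h => (ContDiffOn ℝ ∞ q.1 Ω ∧ ContDiffOn ℝ ∞ q.2 Ω) ∧
      EqOn h (fun y => q.1 y + t * q.2 y) Ω) ?_ I (f := (f, g)) (g := fun y => f y + t * g y)
    ⟨⟨hf, hg⟩, fun _ _ => rfl⟩
  · have h1 : ∀ q : (EuclideanSpace ℝ (Fin n) → ℝ) × (EuclideanSpace ℝ (Fin n) → ℝ),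
        multiPow (fun i (q : (EuclideanSpace ℝ (Fin n) → ℝ) ×
          (EuclideanSpace ℝ (Fin n) → ℝ)) => (partialD i q.1, partialD i q.2)) I q =
        (multiPow partialD I q.1, multiPow partialD I q.2) := fun q =>
      Prod.ext (multiPow_map Prod.fst (fun _ _ => rfl) I q)
        (multiPow_map Prod.snd (fun _ _ => rfl) I q)
    have h2 := this.2
    rwa [h1] at h2
  · rintro i ⟨f, g⟩ h ⟨⟨hf, hg⟩, hh⟩
    refine ⟨⟨contDiffOn_partialD hΩ i hf, contDiffOn_partialD hΩ i hg⟩, ?_⟩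
    refine (partialD_congr hΩ i hh).trans fun y hy => ?_
    have h1 := ContDiffOn.differentiableAt_of_isOpen hf hΩ hy
    have h2 := ContDiffOn.differentiableAt_of_isOpen hg hΩ hy
    simp only [partialD]
    rw [fderiv_fun_add h1 (h2.const_mul t), fderiv_const_mul h2]
    simp

/-- The derivative in a parameter commutes with partial derivatives. -/
theorem hasDerivAt_multiPow_partialD (hΩ : IsOpen Ω) (I : MultiIndex n)
    {H : ℝ → EuclideanSpace ℝ (Fin n) → ℝ} {h : EuclideanSpace ℝ (Fin n) → ℝ}
    (hH : ContDiffOn ℝ ∞ (Function.uncurry H) (univ ×ˢ Ω))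
    (hh : ∀ y ∈ Ω, HasDerivAt (fun t => H t y) (h y) 0) {y : EuclideanSpace ℝ (Fin n)}
    (hy : y ∈ Ω) :
    HasDerivAt (fun t => multiPow partialD I (H t) y) (multiPow partialD I h y) 0 := by
  have hΩ' : IsOpen ((univ : Set ℝ) ×ˢ Ω) := isOpen_univ.prod hΩ
  have slice : ∀ {F : ℝ → EuclideanSpace ℝ (Fin n) → ℝ},
      ContDiffOn ℝ ∞ (Function.uncurry F) (univ ×ˢ Ω) → ∀ t, ∀ y ∈ Ω,
      HasDerivAt (fun t => F t y) (fderiv ℝ (Function.uncurry F) (t, y) (1, 0)) t ∧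
      ∀ i, partialD i (F t) y =
        fderiv ℝ (Function.uncurry F) (t, y) (0, EuclideanSpace.basisFun (Fin n) ℝ i) := by
    intro F hF t y hy
    have hd := (ContDiffOn.differentiableAt_of_isOpen hF hΩ' (x := (t, y)) ⟨mem_univ _, hy⟩).hasFDerivAt
    constructor
    · have := hd.comp_hasDerivAt t ((hasDerivAt_id t).prodMk (hasDerivAt_const t y))
      exact this
    · intro i
      have := hd.comp y ((hasFDerivAt_const t y).prodMk (hasFDerivAt_id y))
      have h2 := this.fderiv
      simp only [partialD]
      change fderiv ℝ (Function.uncurry F ∘ Prod.mk t) y _ = _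
      rw [h2]
      simp
  -- Joint smoothness in the parameter and the point is part of the relation: it allows the
  -- interchange of derivatives at every stage.
  have key := multiPow_rel (T := fun i (F : ℝ → EuclideanSpace ℝ (Fin n) → ℝ) t =>
      partialD i (F t)) (S := partialD)
    (Q := fun F f => ContDiffOn ℝ ∞ (Function.uncurry F) (univ ×ˢ Ω) ∧
      ∀ y ∈ Ω, HasDerivAt (fun t => F t y) (f y) 0) ?_ I ⟨hH, hh⟩
  · have h1 : ∀ t, multiPow (fun i (F : ℝ → EuclideanSpace ℝ (Fin n) → ℝ) t =>
        partialD i (F t)) I H t = multiPow partialD I (H t) := fun t =>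
      multiPow_map (fun F : ℝ → EuclideanSpace ℝ (Fin n) → ℝ => F t) (fun _ _ => rfl) I H
    have h2 := key.2 y hy
    simp only [h1] at h2
    exact h2
  · rintro i F f ⟨hF, hf⟩
    set e := EuclideanSpace.basisFun (Fin n) ℝ i
    have hF' : ContDiffOn ℝ ∞ (Function.uncurry fun t => partialD i (F t)) (univ ×ˢ Ω) :=
      (contDiffOn_fderiv_apply hF hΩ' (0, e)).congr fun q hq => (slice hF q.1 q.2 hq.2).2 i
    refine ⟨hF', fun y hy => ?_⟩
    have h0 : ((0 : ℝ), y) ∈ (univ : Set ℝ) ×ˢ Ω := ⟨mem_univ _, hy⟩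
    have h1 := (slice hF' 0 y hy).1
    convert h1 using 1
    have h2 : fderiv ℝ (Function.uncurry fun t => partialD i (F t)) (0, y) =
        fderiv ℝ (fun q => fderiv ℝ (Function.uncurry F) q (0, e)) (0, y) :=
      Filter.EventuallyEq.fderiv_eq (Filter.eventuallyEq_of_mem (hΩ'.mem_nhds h0)
        fun q hq => (slice hF q.1 q.2 hq.2).2 i)
    -- Symmetry of the second derivative in the directions `(0, e)` and `(1, 0)` exchanges the space
    -- and the parameter derivative.
    rw [h2, fderiv_fderiv_apply_comm hF hΩ' h0]
    have hg := contDiffOn_fderiv_apply hF hΩ' (1, 0)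
    have h3 := (slice (F := fun t y => fderiv ℝ (Function.uncurry F) (t, y) (1, 0)) hg 0 y hy).2 i
    have h4 : EqOn f (fun y => fderiv ℝ (Function.uncurry F) (0, y) (1, 0)) Ω := fun y hy =>
      (hf y hy).unique (slice hF 0 y hy).1
    rw [partialD_congr hΩ i h4 hy, h3]
    rfl

end PartialD

end

end LocalFunctionals

namespace LocalFunctionals

noncomputable section

/-! ### Test functions -/

section TestFn

variable {n : ℕ} {Ω : Set (EuclideanSpace ℝ (Fin n))}

/-- `h` is a smooth function on `ℝⁿ` with compact support in `Ω`. -/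
structure IsTestFn (Ω : Set (EuclideanSpace ℝ (Fin n))) (h : EuclideanSpace ℝ (Fin n) → ℝ) :
    Prop where
  contDiff : ContDiff ℝ ∞ h
  compact : HasCompactSupport h
  subset : tsupport h ⊆ Ω

namespace IsTestFn

variable {h : EuclideanSpace ℝ (Fin n) → ℝ}

theorem eq_zero (hh : IsTestFn Ω h) {y : EuclideanSpace ℝ (Fin n)} (hy : y ∉ Ω) : h y = 0 :=
  image_eq_zero_of_notMem_tsupport fun h' => hy (hh.subset h')

theorem integrable (hh : IsTestFn Ω h) : Integrable h :=
  hh.contDiff.continuous.integrable_of_hasCompactSupport hh.compact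

theorem zero : IsTestFn Ω (fun _ => 0) :=
  ⟨contDiff_const, HasCompactSupport.zero, by simp [tsupport]⟩

theorem mono {Ω' : Set (EuclideanSpace ℝ (Fin n))} (hh : IsTestFn Ω h) (hΩ : Ω ⊆ Ω') :
    IsTestFn Ω' h := ⟨hh.contDiff, hh.compact, hh.subset.trans hΩ⟩

/-- `F` is arbitrary outside `Ω`. Points of `tsupport h` lie in `Ω`, where `F` is smooth; near all
other points the product vanishes. -/
theorem mul_left (hh : IsTestFn Ω h) (hΩ : IsOpen Ω) {F : EuclideanSpace ℝ (Fin n) → ℝ}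
    (hF : ContDiffOn ℝ ∞ F Ω) : IsTestFn Ω (fun y => F y * h y) := by
  have hs : tsupport (fun y => F y * h y) ⊆ tsupport h := tsupport_mul_subset_right
  refine ⟨contDiff_iff_contDiffAt.2 fun y => ?_, hh.compact.mul_left, hs.trans hh.subset⟩
  by_cases hy : y ∈ tsupport h
  · exact (hF.contDiffAt (hΩ.mem_nhds (hh.subset hy))).mul hh.contDiff.contDiffAt
  · exact contDiffAt_const.congr_of_eventuallyEq
      (notMem_tsupport_iff_eventuallyEq.1 fun h' => hy (hs h'))

theorem partialD (hh : IsTestFn Ω h) (i : Fin n) : IsTestFn Ω (partialD i h) := by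
  have h1 : tsupport (LocalFunctionals.partialD i h) ⊆ tsupport h :=
    (closure_mono fun y hy => by
      rw [Function.mem_support] at hy ⊢
      intro h0
      exact hy (by simp [LocalFunctionals.partialD, h0])).trans (tsupport_fderiv_subset ℝ)
  exact ⟨contDiffOn_univ.1 (contDiffOn_partialD isOpen_univ i (contDiffOn_univ.2 hh.contDiff)),
    hh.compact.mono' (subset_closure.trans h1), h1.trans hh.subset⟩

theorem sum {ι : Type*} {s : Finset ι} {h : ι → EuclideanSpace ℝ (Fin n) → ℝ}
    (hh : ∀ i ∈ s, IsTestFn Ω (h i)) : IsTestFn Ω (fun y => ∑ i ∈ s, h i y) := by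
  classical
  induction s using Finset.induction_on with
  | empty => simpa using zero
  | insert i s hi ih =>
    have h1 := hh i (Finset.mem_insert_self _ _)
    have h2 := ih fun k hk => hh k (Finset.mem_insert_of_mem hk)
    simp only [Finset.sum_insert hi]
    exact ⟨h1.contDiff.add h2.contDiff, h1.compact.add h2.compact,
      (tsupport_add _ _).trans (union_subset h1.subset h2.subset)⟩

theorem setIntegral_eq (hh : IsTestFn Ω h) : ∫ y in Ω, h y = ∫ y, h y :=
  setIntegral_eq_integral_of_forall_compl_eq_zero fun _ hy => hh.eq_zero hy

theorem integral_partialD (hh : IsTestFn Ω h) (i : Fin n) :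
    ∫ y, LocalFunctionals.partialD i h y = 0 := by
  -- Integration by parts against the constant function `1`.
  have := integral_mul_fderiv_eq_neg_fderiv_mul_of_integrable (μ := volume) (𝕜 := ℝ)
    (f := fun _ : EuclideanSpace ℝ (Fin n) => (1 : ℝ)) (g := h)
    (v := EuclideanSpace.basisFun (Fin n) ℝ i) (by simp)
    (by simp only [one_mul]; exact (hh.partialD i).integrable)
    (by simpa using hh.integrable) (fun _ _ => differentiableAt_const _)
    (fun _ _ => hh.contDiff.differentiable (by simp) _)
  simpa [LocalFunctionals.partialD] using this

theorem multiPow (hh : IsTestFn Ω h) (I : MultiIndex n) :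
    IsTestFn Ω (multiPow LocalFunctionals.partialD I h) :=
  multiPow_pred (Q := IsTestFn Ω) (fun i _ hf => hf.partialD i) I hh

theorem integral_mul_partialD (hh : IsTestFn Ω h) (hΩ : IsOpen Ω) (i : Fin n)
    {F : EuclideanSpace ℝ (Fin n) → ℝ} (hF : ContDiffOn ℝ ∞ F Ω) :
    ∫ y in Ω, F y * LocalFunctionals.partialD i h y =
      -∫ y in Ω, LocalFunctionals.partialD i F y * h y := by
  have h1 := (hh.partialD i).mul_left hΩ hF
  have h2 := hh.mul_left hΩ (contDiffOn_partialD hΩ i hF)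
  rw [← add_eq_zero_iff_eq_neg, ← integral_add h1.integrable.integrableOn h2.integrable.integrableOn,
    ← (hh.mul_left hΩ hF).integral_partialD i, ← ((hh.mul_left hΩ hF).partialD i).setIntegral_eq]
  refine setIntegral_congr_fun hΩ.measurableSet fun y hy => ?_
  simp only [LocalFunctionals.partialD]
  rw [fderiv_fun_mul (hF.differentiableAt_of_isOpen hΩ hy) (hh.contDiff.differentiable (by simp) y)]
  simp
  ring

/-- Integration by parts. -/
theorem integral_mul_multiPow (hΩ : IsOpen Ω) (I : MultiIndex n) :
    ∀ {h : EuclideanSpace ℝ (Fin n) → ℝ}, IsTestFn Ω h → ∀ {F : EuclideanSpace ℝ (Fin n) → ℝ},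
    ContDiffOn ℝ ∞ F Ω → ∫ y in Ω, F y * LocalFunctionals.multiPow LocalFunctionals.partialD I h y =
      (-1) ^ (∑ i, I i) *
        ∫ y in Ω, LocalFunctionals.multiPow LocalFunctionals.partialD I F y * h y := by
  induction I using MultiIndex.induction_single with
  | zero => intro h hh F hF; simp [multiPow_zero]
  | add I i ih =>
    intro h hh F hF
    have hs : ContDiffOn ℝ ∞ h Ω := hh.contDiff.contDiffOn
    -- On `h` the extra derivative is put innermost, so that the induction hypothesis applies to
    -- `partialD i h`; on `F` it is put outermost, which is where one integration by parts produces
    -- it.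
    have h1 : ∫ y in Ω, F y * LocalFunctionals.multiPow LocalFunctionals.partialD
        (I + Pi.single i 1) h y = ∫ y in Ω, F y *
          LocalFunctionals.multiPow LocalFunctionals.partialD I
            (LocalFunctionals.partialD i h) y :=
      setIntegral_congr_fun hΩ.measurableSet fun y hy => by
        simp only [multiPow_partialD_add_single hΩ I i hs hy, multiPow_partialD_comm hΩ I i hs hy]
    have h2 : ∫ y in Ω, LocalFunctionals.multiPow LocalFunctionals.partialD
        (I + Pi.single i 1) F y * h y = ∫ y in Ω, LocalFunctionals.partialD i
          (LocalFunctionals.multiPow LocalFunctionals.partialD I F) y * h y :=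
      setIntegral_congr_fun hΩ.measurableSet fun y hy => by
        simp only [multiPow_partialD_add_single hΩ I i hF hy]
    rw [h1, h2, ih (hh.partialD i) hF, hh.integral_mul_partialD hΩ i (contDiffOn_multiPow hΩ I hF)]
    simp only [Pi.add_apply, Finset.sum_add_distrib, Finset.sum_pi_single', Finset.mem_univ,
      if_true, pow_succ]
    ring

end IsTestFn

/-- The fundamental lemma of the calculus of variations. -/
theorem eq_zero_of_integral_testFn (hΩ : IsOpen Ω) {F : EuclideanSpace ℝ (Fin n) → ℝ}
    (hF : ContinuousOn F Ω) (h : ∀ η, IsTestFn Ω η → ∫ y in Ω, F y * η y = 0) :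
    ∀ y ∈ Ω, F y = 0 := by
  have h1 := IsOpen.ae_eq_zero_of_integral_contDiff_smul_eq_zero (μ := volume) hΩ
    (hF.locallyIntegrableOn hΩ.measurableSet) fun η hη hc hs => by
      have := h η ⟨hη, hc, hs⟩
      rw [← this, eq_comm]
      rw [setIntegral_eq_integral_of_forall_compl_eq_zero fun y hy => by
        rw [image_eq_zero_of_notMem_tsupport fun h' => hy (hs h'), mul_zero]]
      simp [mul_comm]
  have h2 : F =ᵐ[volume.restrict Ω] fun _ => 0 :=
    (ae_restrict_iff' hΩ.measurableSet).2 h1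
  exact fun y hy => Measure.eqOn_open_of_ae_eq h2 hΩ hF continuousOn_const hy

end TestFn

/-! ### Smooth functions of finitely many jet coordinates -/

section SmOn

variable {n m : ℕ} {Ω : Set (EuclideanSpace ℝ (Fin n))} {p q : ℕ}

/-- The jet coordinates of a function `u` at `y`. -/
def jc (u : Fin m → EuclideanSpace ℝ (Fin n) → ℝ) (y : EuclideanSpace ℝ (Fin n)) :
    JetCoord n m :=
  (y, fun a I => multiPow partialD I (u a) y)

/-- `f` is, over `Ω`, a smooth function of the jet coordinates of order at most `p`. -/
def SmOn (Ω : Set (EuclideanSpace ℝ (Fin n))) (p : ℕ) (f : JetCoord n m → ℝ) : Prop :=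
  ∃ g : EuclideanSpace ℝ (Fin n) × (Fin m → {I // I ∈ multiIndexLE n p} → ℝ) → ℝ,
    ContDiffOn ℝ ∞ g (Ω ×ˢ univ) ∧ ∀ z : JetCoord n m, z.1 ∈ Ω → f z = g (z.trunc p)

namespace SmOn

variable {f f' : JetCoord n m → ℝ}

theorem congr (hf : SmOn Ω p f) (h : ∀ z, z.1 ∈ Ω → f' z = f z) : SmOn Ω p f' := by
  obtain ⟨g, hg, hfg⟩ := hf
  exact ⟨g, hg, fun z hz => (h z hz).trans (hfg z hz)⟩

theorem subset {Ω' : Set (EuclideanSpace ℝ (Fin n))} (hf : SmOn Ω p f) (h : Ω' ⊆ Ω) :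
    SmOn Ω' p f := by
  obtain ⟨g, hg, hfg⟩ := hf
  exact ⟨g, hg.mono (prod_mono h subset_rfl), fun z hz => hfg z (h hz)⟩

theorem base {h : EuclideanSpace ℝ (Fin n) → ℝ} (hh : ContDiffOn ℝ ∞ h Ω) :
    SmOn Ω p (fun z : JetCoord n m => h z.1) :=
  ⟨fun w => h w.1, hh.comp contDiff_fst.contDiffOn fun _ hw => hw.1, fun _ _ => rfl⟩

theorem const (r : ℝ) : SmOn Ω p (fun _ : JetCoord n m => r) := base contDiffOn_const

theorem coord (a : Fin m) {I : MultiIndex n} (hI : I ∈ multiIndexLE n p) :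
    SmOn Ω p (fun z : JetCoord n m => z.2 a I) :=
  ⟨fun w => w.2 a ⟨I, hI⟩, by fun_prop, fun _ _ => rfl⟩

/-- Only the `F a I` with `I` of order at most `p` matter, since `f` factors through `trunc p`.
Monotonicity in the order and composition with a prolongation are both instances. -/
theorem comp {Ω' : Set (EuclideanSpace ℝ (Fin n))} (hf : SmOn Ω' p f)
    {τ : EuclideanSpace ℝ (Fin n) → EuclideanSpace ℝ (Fin n)} (hτ : ContDiffOn ℝ ∞ τ Ω)
    (hm : MapsTo τ Ω Ω') {F : Fin m → MultiIndex n → JetCoord n m → ℝ}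
    (hF : ∀ a, ∀ I ∈ multiIndexLE n p, SmOn Ω q (F a I)) :
    SmOn Ω q (fun z => f (τ z.1, fun a I => F a I z)) := by
  obtain ⟨g, hg, hfg⟩ := hf
  choose! G hG hFG using hF
  refine ⟨fun w => g (τ w.1, fun a I => G a I w), ?_, fun z hz => ?_⟩
  · refine hg.comp (ContDiffOn.prodMk ?_ ?_) fun w hw => ⟨hm hw.1, mem_univ _⟩
    · exact hτ.comp contDiff_fst.contDiffOn fun _ hw => hw.1
    · exact contDiffOn_pi.2 fun a => contDiffOn_pi.2 fun I => hG a I I.2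
  · refine (hfg _ (hm hz)).trans (congrArg g ?_)
    exact Prod.ext rfl (funext fun a => funext fun I => hFG a I I.2 z hz)

theorem mono (hf : SmOn Ω p f) (h : p ≤ q) : SmOn Ω q f :=
  hf.comp (τ := id) contDiffOn_id (mapsTo_id _) (F := fun a I z => z.2 a I) fun a _ hI =>
    coord a (mem_multiIndexLE.2 ((mem_multiIndexLE.1 hI).trans h))

theorem add (hf : SmOn Ω p f) (hf' : SmOn Ω p f') : SmOn Ω p (fun z => f z + f' z) := by
  obtain ⟨g, hg, hfg⟩ := hf
  obtain ⟨g', hg', hfg'⟩ := hf'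
  exact ⟨fun w => g w + g' w, hg.add hg', fun z hz => by simp only [hfg z hz, hfg' z hz]⟩

theorem mul (hf : SmOn Ω p f) (hf' : SmOn Ω p f') : SmOn Ω p (fun z => f z * f' z) := by
  obtain ⟨g, hg, hfg⟩ := hf
  obtain ⟨g', hg', hfg'⟩ := hf'
  exact ⟨fun w => g w * g' w, hg.mul hg', fun z hz => by simp only [hfg z hz, hfg' z hz]⟩

theorem sum {ι : Type*} {s : Finset ι} {f : ι → JetCoord n m → ℝ}
    (hf : ∀ i ∈ s, SmOn Ω p (f i)) : SmOn Ω p (fun z => ∑ i ∈ s, f i z) := by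
  choose! g hg hfg using hf
  exact ⟨fun w => ∑ i ∈ s, g i w, ContDiffOn.sum hg, fun z hz =>
    Finset.sum_congr rfl fun i hi => hfg i hi z hz⟩

theorem contDiffOn_jc (hf : SmOn Ω p f) (hΩ : IsOpen Ω)
    {u : Fin m → EuclideanSpace ℝ (Fin n) → ℝ} (hu : ∀ a, ContDiffOn ℝ ∞ (u a) Ω) :
    ContDiffOn ℝ ∞ (fun y => f (jc u y)) Ω := by
  obtain ⟨g, hg, hfg⟩ := hf
  refine ContDiffOn.congr (f := fun y => g ((jc u y).trunc p)) ?_ fun y hy => hfg _ hy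
  refine hg.comp (contDiffOn_id.prodMk ?_) fun y hy => ⟨hy, mem_univ _⟩
  exact contDiffOn_pi.2 fun a => contDiffOn_pi.2 fun I => contDiffOn_multiPow hΩ I (hu a)

theorem hasFDerivAt (hΩ : IsOpen Ω)
    {g : EuclideanSpace ℝ (Fin n) × (Fin m → {I // I ∈ multiIndexLE n p} → ℝ) → ℝ}
    (hg : ContDiffOn ℝ ∞ g (Ω ×ˢ univ)) {z : JetCoord n m} (hz : z.1 ∈ Ω) :
    HasFDerivAt g (fderiv ℝ g (z.trunc p)) (z.trunc p) :=
  (hg.differentiableAt_of_isOpen (hΩ.prod isOpen_univ) ⟨hz, mem_univ _⟩).hasFDerivAt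

/-- `partialX` and `partialU` are one-variable derivatives in a space with infinitely many
coordinates. Through the representative `g` on a finite-dimensional space they become directional
Fréchet derivatives, hence are smooth functions of the same coordinates. -/
theorem partialX_eq (hΩ : IsOpen Ω)
    {g : EuclideanSpace ℝ (Fin n) × (Fin m → {I // I ∈ multiIndexLE n p} → ℝ) → ℝ}
    (hg : ContDiffOn ℝ ∞ g (Ω ×ˢ univ)) (hfg : ∀ z : JetCoord n m, z.1 ∈ Ω → f z = g (z.trunc p))
    (i : Fin n) {z : JetCoord n m} (hz : z.1 ∈ Ω) :
    partialX i f z = fderiv ℝ g (z.trunc p) (EuclideanSpace.basisFun (Fin n) ℝ i, 0) := by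
  have h1 := ((hasFDerivAt hΩ hg hz).hasLineDerivAt (EuclideanSpace.basisFun (Fin n) ℝ i, 0))
  rw [HasLineDerivAt] at h1
  rw [← h1.deriv]
  refine Filter.EventuallyEq.deriv_eq ?_
  have hc : Continuous fun t : ℝ => z.1 + t • EuclideanSpace.basisFun (Fin n) ℝ i := by fun_prop
  have : ∀ᶠ t : ℝ in nhds 0, z.1 + t • EuclideanSpace.basisFun (Fin n) ℝ i ∈ Ω :=
    hc.continuousAt.eventually (hΩ.mem_nhds (by simpa using hz))
  filter_upwards [this] with t ht
  rw [hfg _ ht]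
  congr 1
  exact Prod.ext rfl (by simp [JetCoord.trunc])

theorem partialU_eq (hΩ : IsOpen Ω)
    {g : EuclideanSpace ℝ (Fin n) × (Fin m → {I // I ∈ multiIndexLE n p} → ℝ) → ℝ}
    (hg : ContDiffOn ℝ ∞ g (Ω ×ˢ univ)) (hfg : ∀ z : JetCoord n m, z.1 ∈ Ω → f z = g (z.trunc p))
    (a : Fin m) {I : MultiIndex n} (hI : I ∈ multiIndexLE n p) {z : JetCoord n m} (hz : z.1 ∈ Ω) :
    partialU a I f z =
      fderiv ℝ g (z.trunc p) (0, Pi.single a (Pi.single ⟨I, hI⟩ 1)) := by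
  have h1 := ((hasFDerivAt hΩ hg hz).hasLineDerivAt (0, Pi.single a (Pi.single ⟨I, hI⟩ 1)))
  rw [HasLineDerivAt] at h1
  rw [← h1.deriv, partialU]
  congr 1
  funext t
  refine (hfg _ (by exact hz)).trans (congrArg g ?_)
  refine Prod.ext (by simp [JetCoord.trunc]) ?_
  funext b J
  by_cases hb : b = a
  · subst hb
    by_cases hJ : J.1 = I
    · obtain ⟨J, hJ'⟩ := J
      simp only at hJ
      subst hJ
      simp [JetCoord.trunc]
    · have : J ≠ ⟨I, hI⟩ := fun h => hJ (by rw [h])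
      simp [JetCoord.trunc, Pi.single_eq_of_ne hJ, Pi.single_eq_of_ne this]
  · simp [JetCoord.trunc, Pi.single_eq_of_ne hb]

theorem partialU_eq_zero (hf : SmOn Ω p f) (a : Fin m) {I : MultiIndex n}
    (hI : I ∉ multiIndexLE n p) {z : JetCoord n m} (hz : z.1 ∈ Ω) : partialU a I f z = 0 := by
  obtain ⟨g, hg, hfg⟩ := hf
  have : (fun t : ℝ => f (z.1, z.2 + Pi.single a (Pi.single I t))) = fun _ => g (z.trunc p) := by
    funext t
    refine (hfg _ (by exact hz)).trans (congrArg g ?_)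
    refine Prod.ext rfl ?_
    funext b J
    have hJ : J.1 ≠ I := fun h => hI (h ▸ J.2)
    by_cases hb : b = a
    · subst hb
      simp [JetCoord.trunc, Pi.single_eq_of_ne hJ]
    · simp [JetCoord.trunc, Pi.single_eq_of_ne hb]
  rw [partialU, this, deriv_const]

theorem partialX (hf : SmOn Ω p f) (hΩ : IsOpen Ω) (i : Fin n) :
    SmOn Ω p (LocalFunctionals.partialX i f) := by
  obtain ⟨g, hg, hfg⟩ := hf
  exact ⟨_, contDiffOn_fderiv_apply hg (hΩ.prod isOpen_univ) _, fun z hz =>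
    partialX_eq hΩ hg hfg i hz⟩

theorem partialU (hf : SmOn Ω p f) (hΩ : IsOpen Ω) (a : Fin m) (I : MultiIndex n) :
    SmOn Ω p (LocalFunctionals.partialU a I f) := by
  by_cases hI : I ∈ multiIndexLE n p
  · obtain ⟨g, hg, hfg⟩ := hf
    exact ⟨_, contDiffOn_fderiv_apply hg (hΩ.prod isOpen_univ) _, fun z hz =>
      partialU_eq hΩ hg hfg a hI hz⟩
  · exact (const 0).congr fun z hz => hf.partialU_eq_zero a hI hz

theorem totalD_eq (hf : SmOn Ω p f) (i : Fin n) {z : JetCoord n m} (hz : z.1 ∈ Ω) :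
    LocalFunctionals.totalD i f z = LocalFunctionals.partialX i f z +
      ∑ a, ∑ I ∈ multiIndexLE n p,
        z.2 a (I + Pi.single i 1) * LocalFunctionals.partialU a I f z := by
  rw [LocalFunctionals.totalD, ← Finset.sum_product', finsum_eq_sum_of_support_subset]
  intro q hq
  simp only [Finset.coe_product, Finset.coe_univ, mem_prod, mem_univ, true_and]
  by_contra hI
  exact hq (by simp only [hf.partialU_eq_zero q.1 hI hz, mul_zero])

theorem totalD (hf : SmOn Ω p f) (hΩ : IsOpen Ω) (i : Fin n) :
    SmOn Ω (p + 1) (LocalFunctionals.totalD i f) := by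
  refine SmOn.congr ?_ fun z hz => hf.totalD_eq i hz
  refine ((hf.partialX hΩ i).mono p.le_succ).add (sum fun a _ => sum fun I hI => ?_)
  refine (coord a (mem_multiIndexLE.2 ?_)).mul ((hf.partialU hΩ a I).mono p.le_succ)
  have := mem_multiIndexLE.1 hI
  simpa [Finset.sum_add_distrib] using this

theorem multiPow_totalD (hf : SmOn Ω p f) (hΩ : IsOpen Ω) (I : MultiIndex n) :
    SmOn Ω (p + ∑ i, I i) (multiPow LocalFunctionals.totalD I f) := by
  rw [← multiPow_succ_eq]
  exact multiPow_rel (Q := fun f p => SmOn Ω p f) (fun i f p hf => hf.totalD hΩ i) I hf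

/-- The chain rule along a curve in the space of jet coordinates. -/
theorem hasDerivAt_curve (hf : SmOn Ω p f) (hΩ : IsOpen Ω) {γ : ℝ → JetCoord n m} {t : ℝ}
    (hγ : (γ t).1 ∈ Ω) {e : EuclideanSpace ℝ (Fin n)} {d : Fin m → MultiIndex n → ℝ}
    (h1 : HasDerivAt (fun t => (γ t).1) e t)
    (h2 : ∀ a, ∀ I ∈ multiIndexLE n p, HasDerivAt (fun t => (γ t).2 a I) (d a I) t) :
    HasDerivAt (fun t => f (γ t)) (∑ i, e i * LocalFunctionals.partialX i f (γ t) +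
      ∑ a, ∑ I ∈ multiIndexLE n p, d a I * LocalFunctionals.partialU a I f (γ t)) t := by
  obtain ⟨g, hg, hfg⟩ := hf
  have h3 : HasDerivAt (fun t => (γ t).trunc p)
      (e, fun a (I : {I // I ∈ multiIndexLE n p}) => d a I) t :=
    h1.prodMk (hasDerivAt_pi.2 fun a => hasDerivAt_pi.2 fun I => h2 a I I.2)
  have h4 := (hasFDerivAt hΩ hg hγ).comp_hasDerivAt t h3
  have h5 : (fun t => f (γ t)) =ᶠ[nhds t] (g ∘ fun t => (γ t).trunc p) := by
    filter_upwards [h1.continuousAt.eventually (hΩ.mem_nhds hγ)] with s hs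
    exact hfg _ hs
  refine (h4.congr_of_eventuallyEq h5).congr_deriv ?_
  have h6 : (e, fun a (I : {I // I ∈ multiIndexLE n p}) => d a I) =
      ∑ i, e i • ((EuclideanSpace.basisFun (Fin n) ℝ i,
        (0 : Fin m → {I // I ∈ multiIndexLE n p} → ℝ)) : EuclideanSpace ℝ (Fin n) × _) +
      ∑ a, ∑ I : {I // I ∈ multiIndexLE n p}, d a I •
        ((0, Pi.single a (Pi.single I 1)) : EuclideanSpace ℝ (Fin n) × _) := by
    refine Prod.ext ?_ ?_
    · simp only [Prod.fst_add, Prod.fst_sum, Prod.smul_fst, smul_zero, Finset.sum_const_zero,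
        add_zero]
      have := (EuclideanSpace.basisFun (Fin n) ℝ).sum_repr e
      simpa using this.symm
    · funext b J
      simp only [Prod.snd_add, Prod.snd_sum, Prod.smul_snd, smul_zero, Finset.sum_const_zero,
        zero_add, Finset.sum_apply, Pi.smul_apply, smul_eq_mul]
      rw [Finset.sum_eq_single b, Finset.sum_eq_single J]
      · simp
      · intro I _ hI
        simp [Pi.single_eq_of_ne (Ne.symm hI)]
      · simp
      · intro a _ ha
        simp [Pi.single_eq_of_ne (Ne.symm ha)]
      · simp
  rw [h6]
  simp only [map_add, map_sum, map_smul, smul_eq_mul]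
  congr 1
  · exact Finset.sum_congr rfl fun i _ => by rw [partialX_eq hΩ hg hfg i hγ]
  · refine Finset.sum_congr rfl fun a _ => ?_
    rw [← Finset.sum_coe_sort (multiIndexLE n p) fun I =>
      d a I * LocalFunctionals.partialU a I f (γ t)]
    exact Finset.sum_congr rfl fun I _ => by rw [partialU_eq hΩ hg hfg a I.2 hγ]

/-- `∂_i (f ∘ ju) = (D_i f) ∘ ju`. -/
theorem partialD_jc (hf : SmOn Ω p f) (hΩ : IsOpen Ω) (i : Fin n)
    {u : Fin m → EuclideanSpace ℝ (Fin n) → ℝ} (hu : ∀ a, ContDiffOn ℝ ∞ (u a) Ω) :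
    EqOn (partialD i fun y => f (jc u y)) (fun y => LocalFunctionals.totalD i f (jc u y)) Ω := by
  intro y hy
  set e := EuclideanSpace.basisFun (Fin n) ℝ i with he
  have line : ∀ {F : EuclideanSpace ℝ (Fin n) → ℝ}, ContDiffOn ℝ ∞ F Ω →
      HasDerivAt (fun t : ℝ => F (y + t • e)) (partialD i F y) 0 := fun hF =>
    (hF.differentiableAt_of_isOpen hΩ hy).hasFDerivAt.hasLineDerivAt e
  have h1 := line (hf.contDiffOn_jc hΩ hu)
  -- The curve `t ↦ ju (y + t e_i)` has velocity `u^a_{I + e_i}` in the coordinate `u^a_I`, which is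
  -- the coefficient in the definition of `totalD`.
  have h2 := hf.hasDerivAt_curve hΩ (γ := fun t : ℝ => jc u (y + t • e)) (t := 0) (e := e)
    (d := fun a I => (jc u y).2 a (I + Pi.single i 1)) (by simpa [jc] using hy)
    (by simpa [jc] using ((hasDerivAt_id (0 : ℝ)).smul_const e).const_add y)
    (fun a I _ => by
      have := line (contDiffOn_multiPow hΩ I (hu a))
      rw [← multiPow_partialD_add_single hΩ I i (hu a) hy] at this
      exact this)
  refine (h1.unique h2).trans (Eq.trans ?_ (hf.totalD_eq i (z := jc u y) hy).symm)
  simp only [zero_smul, add_zero]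
  congr 1
  rw [Finset.sum_eq_single i]
  · simp [he]
  · intro k _ hk
    simp [he, hk]
  · simp

theorem multiPow_jc (hf : SmOn Ω p f) (hΩ : IsOpen Ω) (I : MultiIndex n)
    {u : Fin m → EuclideanSpace ℝ (Fin n) → ℝ} (hu : ∀ a, ContDiffOn ℝ ∞ (u a) Ω) :
    EqOn (multiPow partialD I fun y => f (jc u y))
      (fun y => multiPow LocalFunctionals.totalD I f (jc u y)) Ω :=
  (multiPow_rel (T := LocalFunctionals.totalD) (S := partialD)
    (Q := fun G g => (∃ p, SmOn Ω p G) ∧ EqOn g (fun y => G (jc u y)) Ω)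
    (fun i _ _ ⟨⟨_, hG⟩, h⟩ => ⟨⟨_, hG.totalD hΩ i⟩,
      (partialD_congr hΩ i h).trans (hG.partialD_jc hΩ i hu)⟩) I
    (f := f) (g := fun y => f (jc u y)) ⟨⟨p, hf⟩, fun _ _ => rfl⟩).2

end SmOn

/-! ### Euler operators -/

theorem partialU_congr {f f' : JetCoord n m → ℝ} (h : ∀ z, z.1 ∈ Ω → f z = f' z) (a : Fin m)
    (I : MultiIndex n) {z : JetCoord n m} (hz : z.1 ∈ Ω) : partialU a I f z = partialU a I f' z := by
  simp only [partialU]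
  congr 1
  funext t
  exact h _ hz

theorem totalD_congr (hΩ : IsOpen Ω) {f f' : JetCoord n m → ℝ} (h : ∀ z, z.1 ∈ Ω → f z = f' z)
    (i : Fin n) {z : JetCoord n m} (hz : z.1 ∈ Ω) : totalD i f z = totalD i f' z := by
  simp only [totalD, partialU_congr h _ _ hz]
  congr 1
  refine Filter.EventuallyEq.deriv_eq ?_
  have hc : Continuous fun t : ℝ => z.1 + t • EuclideanSpace.basisFun (Fin n) ℝ i := by fun_prop
  filter_upwards [hc.continuousAt.eventually (hΩ.mem_nhds (by simpa using hz : _ ∈ Ω))] with t ht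
  exact h _ ht

theorem multiPow_totalD_congr (hΩ : IsOpen Ω) {f f' : JetCoord n m → ℝ}
    (h : ∀ z, z.1 ∈ Ω → f z = f' z) (I : MultiIndex n) {z : JetCoord n m} (hz : z.1 ∈ Ω) :
    multiPow totalD I f z = multiPow totalD I f' z :=
  multiPow_rel (T := totalD) (S := totalD) (Q := fun f f' : JetCoord n m → ℝ => ∀ z : JetCoord n m, z.1 ∈ Ω → f z = f' z)
    (fun i _ _ h _ hz => totalD_congr hΩ h i hz) I h z hz

theorem eulerCoord_congr (hΩ : IsOpen Ω) {f f' : JetCoord n m → ℝ}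
    (h : ∀ z, z.1 ∈ Ω → f z = f' z) (a : Fin m) {z : JetCoord n m} (hz : z.1 ∈ Ω) :
    eulerCoord a f z = eulerCoord a f' z := by
  simp only [eulerCoord]
  refine finsum_congr fun I => ?_
  rw [multiPow_totalD_congr hΩ (fun z hz => partialU_congr h a I hz) I hz]

theorem multiPow_totalD_zero (I : MultiIndex n) :
    multiPow totalD I (fun _ : JetCoord n m => (0 : ℝ)) = fun _ => 0 :=
  multiPow_pred (Q := fun f : JetCoord n m → ℝ => f = fun _ => 0)
    (fun i f hf => by subst hf; funext z; simp [totalD, partialX, partialU]) I rfl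

variable {L : JetCoord n m → ℝ}

theorem SmOn.eulerCoord_eq (hL : SmOn Ω p L) (hΩ : IsOpen Ω) (a : Fin m) {z : JetCoord n m}
    (hz : z.1 ∈ Ω) : LocalFunctionals.eulerCoord a L z = ∑ I ∈ multiIndexLE n p,
      (-1) ^ (∑ i, I i) * multiPow LocalFunctionals.totalD I (LocalFunctionals.partialU a I L) z := by
  rw [LocalFunctionals.eulerCoord, finsum_eq_sum_of_support_subset]
  intro I hI
  by_contra hI'
  refine hI ?_
  have := multiPow_totalD_congr hΩ (f := LocalFunctionals.partialU a I L) (f' := fun _ => 0)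
    (fun z hz => hL.partialU_eq_zero a hI' hz) I hz
  simp only [this, multiPow_totalD_zero, mul_zero]

theorem SmOn.eulerCoord (hL : SmOn Ω p L) (hΩ : IsOpen Ω) (a : Fin m) :
    SmOn Ω (p + p) (LocalFunctionals.eulerCoord a L) := by
  refine SmOn.congr (sum fun I hI => ?_) fun z hz => hL.eulerCoord_eq hΩ a hz
  refine (const _).mul (((hL.partialU hΩ a I).multiPow_totalD hΩ I).mono ?_)
  have := mem_multiIndexLE.1 hI
  omega

/-- The first variation formula. -/
theorem SmOn.first_variation (hL : SmOn Ω p L) (hΩ : IsOpen Ω)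
    {u : Fin m → EuclideanSpace ℝ (Fin n) → ℝ} (hu : ∀ a, ContDiffOn ℝ ∞ (u a) Ω)
    {η : Fin m → EuclideanSpace ℝ (Fin n) → ℝ} (hη : ∀ a, IsTestFn Ω (η a)) :
    ∫ y in Ω, ∑ a, ∑ I ∈ multiIndexLE n p,
        multiPow partialD I (η a) y * LocalFunctionals.partialU a I L (jc u y) =
      ∫ y in Ω, ∑ a, LocalFunctionals.eulerCoord a L (jc u y) * η a y := by
  have h1 : ∀ a I, ContDiffOn ℝ ∞ (fun y => LocalFunctionals.partialU a I L (jc u y)) Ω :=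
    fun a I => (hL.partialU hΩ a I).contDiffOn_jc hΩ hu
  have h2 : ∀ a I, IsTestFn Ω (fun y => LocalFunctionals.partialU a I L (jc u y) *
      multiPow partialD I (η a) y) := fun a I => ((hη a).multiPow I).mul_left hΩ (h1 a I)
  have h3 : ∀ a, IsTestFn Ω (fun y => LocalFunctionals.eulerCoord a L (jc u y) * η a y) := fun a =>
    (hη a).mul_left hΩ ((hL.eulerCoord hΩ a).contDiffOn_jc hΩ hu)
  have h4 : ∀ a I, IsTestFn Ω (fun y => multiPow LocalFunctionals.totalD I
      (LocalFunctionals.partialU a I L) (jc u y) * η a y) := fun a I =>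
    (hη a).mul_left hΩ (((hL.partialU hΩ a I).multiPow_totalD hΩ I).contDiffOn_jc hΩ hu)
  simp only [mul_comm (multiPow partialD _ _ _)]
  rw [integral_finsetSum _ fun a _ => (IsTestFn.sum fun I _ => h2 a I).integrable.integrableOn,
    integral_finsetSum _ fun a _ => (h3 a).integrable.integrableOn]
  refine Finset.sum_congr rfl fun a _ => ?_
  rw [integral_finsetSum _ fun I _ => (h2 a I).integrable.integrableOn]
  have h5 : ∫ y in Ω, LocalFunctionals.eulerCoord a L (jc u y) * η a y =
      ∫ y in Ω, ∑ I ∈ multiIndexLE n p, (-1) ^ (∑ i, I i) *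
        (multiPow LocalFunctionals.totalD I (LocalFunctionals.partialU a I L) (jc u y) * η a y) :=
    setIntegral_congr_fun hΩ.measurableSet fun y hy => by
      simp only [hL.eulerCoord_eq hΩ a (z := jc u y) hy, Finset.sum_mul, mul_assoc]
  rw [h5, integral_finsetSum _ fun I _ => ((h4 a I).integrable.integrableOn.const_mul _)]
  refine Finset.sum_congr rfl fun I _ => ?_
  -- Integration by parts supplies the sign of the Euler operator; the partial derivatives then
  -- falling on `∂L/∂u^a_I ∘ ju` are total derivatives by `multiPow_jc`.
  rw [IsTestFn.integral_mul_multiPow hΩ I (hη a) (h1 a I), integral_const_mul]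
  congr 1
  refine setIntegral_congr_fun hΩ.measurableSet fun y hy => ?_
  rw [(hL.partialU hΩ a I).multiPow_jc hΩ I hu hy]

end SmOn

end

end LocalFunctionals

namespace LocalFunctionals

noncomputable section

/-! ### Fiber-preserving maps in coordinates and naturality of the Euler operator -/

section CoordMap

variable {n m : ℕ} {p : ℕ}

theorem multiIndexLE_zero : multiIndexLE n 0 = {0} := by
  ext I
  rw [mem_multiIndexLE_zero, Finset.mem_singleton]

/-- The derivative of a local function along `t ↦ u + t η`. -/
theorem SmOn.hasDerivAt_variation {Ω : Set (EuclideanSpace ℝ (Fin n))} {f : JetCoord n m → ℝ}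
    (hf : SmOn Ω p f) (hΩ : IsOpen Ω)
    {u η : Fin m → EuclideanSpace ℝ (Fin n) → ℝ} (hu : ∀ a, ContDiffOn ℝ ∞ (u a) Ω)
    (hη : ∀ a, ContDiffOn ℝ ∞ (η a) Ω) {y : EuclideanSpace ℝ (Fin n)} (hy : y ∈ Ω) :
    HasDerivAt (fun t : ℝ => f (jc (fun a y => u a y + t * η a y) y))
      (∑ a, ∑ I ∈ multiIndexLE n p,
        multiPow partialD I (η a) y * LocalFunctionals.partialU a I f (jc u y)) 0 := by
  have h := hf.hasDerivAt_curve hΩ (γ := fun t : ℝ => jc (fun a y => u a y + t * η a y) y) (t := 0)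
    (e := 0) (d := fun a I => multiPow partialD I (η a) y) hy (hasDerivAt_const _ _)
    (fun a I _ => by
      have h1 : ∀ t : ℝ, (jc (fun a y => u a y + t * η a y) y).2 a I =
          multiPow partialD I (u a) y + t * multiPow partialD I (η a) y := fun t =>
        multiPow_partialD_lin hΩ I t (hu a) (hη a) hy
      simp only [h1]
      simpa using ((hasDerivAt_id (0 : ℝ)).mul_const
        (multiPow partialD I (η a) y)).const_add (multiPow partialD I (u a) y))
  simpa using h

variable (n m) in
/-- A smooth map `(y, w) ↦ (τ y, Φ(y, w))` that covers a diffeomorphism `τ` between open subsets of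
`ℝⁿ`; `σ` is the inverse of `τ`. -/
structure CoordMap where
  /-- the domain of `τ` -/
  src : Set (EuclideanSpace ℝ (Fin n))
  /-- the range of `τ` -/
  tgt : Set (EuclideanSpace ℝ (Fin n))
  /-- the map of base points -/
  τ : EuclideanSpace ℝ (Fin n) → EuclideanSpace ℝ (Fin n)
  /-- the inverse of `τ` -/
  σ : EuclideanSpace ℝ (Fin n) → EuclideanSpace ℝ (Fin n)
  /-- the components of the map in the fiber direction -/
  Φ : Fin m → JetCoord n m → ℝ
  isOpen_src : IsOpen src
  isOpen_tgt : IsOpen tgt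
  mapsTo : MapsTo τ src tgt
  mapsTo_inv : MapsTo σ tgt src
  left_inv : ∀ y ∈ src, σ (τ y) = y
  right_inv : ∀ y ∈ tgt, τ (σ y) = y
  smooth_τ : ContDiffOn ℝ ∞ τ src
  smooth_σ : ContDiffOn ℝ ∞ σ tgt
  smooth_Φ : ∀ a, SmOn src 0 (Φ a)

namespace CoordMap

variable (A : CoordMap n m)

/-- The operator on functions of the jet coordinates that corresponds to the `i`-th partial
derivative on the target. -/
def targetD (i : Fin n) (G : JetCoord n m → ℝ) : JetCoord n m → ℝ :=
  fun z => ∑ k, (fderiv ℝ A.σ (A.τ z.1) (EuclideanSpace.basisFun (Fin n) ℝ i)) k * totalD k G z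

/-- The prolongation to jets. -/
def pr (z : JetCoord n m) : JetCoord n m :=
  (A.τ z.1, fun a I => multiPow A.targetD I (A.Φ a) z)

/-- The Jacobian determinant of `τ`. -/
def jac (y : EuclideanSpace ℝ (Fin n)) : ℝ := (fderiv ℝ A.τ y).det

theorem smOn_targetD (i : Fin n) {G : JetCoord n m → ℝ} (hG : SmOn A.src p G) :
    SmOn A.src (p + 1) (A.targetD i G) := by
  refine SmOn.sum fun k _ => (SmOn.base (h := fun y => (fderiv ℝ A.σ (A.τ y)
    (EuclideanSpace.basisFun (Fin n) ℝ i)) k) ?_).mul (hG.totalD A.isOpen_src k)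
  have h1 := (contDiffOn_fderiv_apply A.smooth_σ A.isOpen_tgt
    (EuclideanSpace.basisFun (Fin n) ℝ i)).comp A.smooth_τ A.mapsTo
  exact (contDiffOn_euclidean.1 h1) k

theorem smOn_pr_coord (a : Fin m) (I : MultiIndex n) :
    SmOn A.src (∑ i, I i) (multiPow A.targetD I (A.Φ a)) := by
  have := multiPow_rel (T := A.targetD) (S := fun _ q => q + 1) (Q := fun f p => SmOn A.src p f)
    (fun i f p hf => A.smOn_targetD i hf) I (A.smooth_Φ a)
  rwa [multiPow_succ_eq, zero_add] at this

theorem smOn_comp_pr {L : JetCoord n m → ℝ} (hL : SmOn A.tgt p L) :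
    SmOn A.src p (fun z => L (A.pr z)) :=
  hL.comp A.smooth_τ A.mapsTo fun a I hI => (A.smOn_pr_coord a I).mono (mem_multiIndexLE.1 hI)

section

variable {A}
variable {u v : Fin m → EuclideanSpace ℝ (Fin n) → ℝ} (hu : ∀ a, ContDiffOn ℝ ∞ (u a) A.src)
  (hv : ∀ a, EqOn (v a) (fun y => A.Φ a (jc u (A.σ y))) A.tgt)

-- Chain rule for `G ∘ ju ∘ σ`. The transform of `u` is `Φ ∘ ju ∘ σ`, so iterating this identity
-- computes all its derivatives; this is the reason for the definition of `targetD`.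
include hu in
theorem partialD_comp_σ (i : Fin n) {G : JetCoord n m → ℝ} (hG : SmOn A.src p G) :
    EqOn (partialD i fun y => G (jc u (A.σ y))) (fun y => A.targetD i G (jc u (A.σ y))) A.tgt := by
  intro y hy
  have h1 := ((hG.contDiffOn_jc A.isOpen_src hu).differentiableAt_of_isOpen A.isOpen_src
    (A.mapsTo_inv hy)).hasFDerivAt
  have h2 := (A.smooth_σ.differentiableAt_of_isOpen A.isOpen_tgt hy).hasFDerivAt
  have h3 := (h1.comp y h2).fderiv
  change fderiv ℝ ((fun y => G (jc u y)) ∘ A.σ) y _ = _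
  rw [h3]
  change _ = ∑ k, (fderiv ℝ A.σ (A.τ (A.σ y)) (EuclideanSpace.basisFun (Fin n) ℝ i)) k *
    totalD k G (jc u (A.σ y))
  rw [A.right_inv y hy, ContinuousLinearMap.comp_apply]
  set e := fderiv ℝ A.σ y (EuclideanSpace.basisFun (Fin n) ℝ i)
  conv_lhs => rw [← (EuclideanSpace.basisFun (Fin n) ℝ).sum_repr e]
  rw [map_sum]
  refine Finset.sum_congr rfl fun k _ => ?_
  rw [map_smul, smul_eq_mul]
  congr 1
  exact hG.partialD_jc A.isOpen_src k hu (A.mapsTo_inv hy)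

include hu hv in
/-- The prolongation of `(τ, Φ)` sends the jet of `u` to the jet of its transform. -/
theorem jc_eq_pr {y : EuclideanSpace ℝ (Fin n)} (hy : y ∈ A.src) :
    jc v (A.τ y) = A.pr (jc u y) := by
  refine Prod.ext rfl (funext fun a => funext fun I => ?_)
  have := (multiPow_rel (T := A.targetD) (S := partialD)
    (Q := fun G g => (∃ p, SmOn A.src p G) ∧ EqOn g (fun y => G (jc u (A.σ y))) A.tgt)
    (fun i _ _ ⟨⟨_, hG⟩, h⟩ => ⟨⟨_, A.smOn_targetD i hG⟩,
      (partialD_congr A.isOpen_tgt i h).trans (partialD_comp_σ hu i hG)⟩) I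
    (f := A.Φ a) (g := v a) ⟨⟨0, A.smooth_Φ a⟩, hv a⟩).2 (A.mapsTo hy)
  simp only [A.left_inv y hy] at this
  exact this

include hu hv in
theorem contDiffOn_target (a : Fin m) : ContDiffOn ℝ ∞ (v a) A.tgt :=
  ((((A.smooth_Φ a).contDiffOn_jc A.isOpen_src hu).comp A.smooth_σ A.mapsTo_inv)).congr (hv a)

/-- A test function on the source, as a test function on the target. -/
theorem _root_.LocalFunctionals.IsTestFn.comp_σ {h : EuclideanSpace ℝ (Fin n) → ℝ}
    (hh : IsTestFn A.src h) : IsTestFn A.tgt (A.tgt.indicator fun y => h (A.σ y)) := by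
  -- The image of the support is compact inside the open set `A.tgt`, so the extension by zero
  -- vanishes in a neighborhood of every point outside this image.
  have hc : IsCompact (A.τ '' tsupport h) :=
    hh.compact.isCompact.image_of_continuousOn (A.smooth_τ.continuousOn.mono hh.subset)
  have hsub : A.τ '' tsupport h ⊆ A.tgt := by
    rintro _ ⟨y, hy, rfl⟩
    exact A.mapsTo (hh.subset hy)
  have h0 : ∀ y ∉ A.τ '' tsupport h, (A.tgt.indicator fun y => h (A.σ y)) y = 0 := by
    intro y hy
    by_cases hyt : y ∈ A.tgt
    · rw [indicator_of_mem hyt]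
      by_contra hne
      exact hy ⟨A.σ y, subset_tsupport _ hne, A.right_inv y hyt⟩
    · exact indicator_of_notMem hyt _
  have hs : tsupport (A.tgt.indicator fun y => h (A.σ y)) ⊆ A.τ '' tsupport h :=
    closure_minimal (fun y hy => by_contra fun hn => hy (h0 y hn)) hc.isClosed
  refine ⟨contDiff_iff_contDiffAt.2 fun y => ?_, hc.of_isClosed_subset (isClosed_tsupport _) hs,
    hs.trans hsub⟩
  by_cases hy : y ∈ A.τ '' tsupport h
  · have hyt := A.isOpen_tgt.mem_nhds (hsub hy)
    refine (hh.contDiff.contDiffAt.comp y (A.smooth_σ.contDiffAt hyt)).congr_of_eventuallyEq ?_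
    filter_upwards [hyt] with x hx
    exact indicator_of_mem hx _
  · refine (contDiffAt_const (c := (0 : ℝ))).congr_of_eventuallyEq ?_
    filter_upwards [hc.isClosed.isOpen_compl.mem_nhds hy] with x hx
    exact h0 x hx

theorem image_src : A.τ '' A.src = A.tgt :=
  Subset.antisymm A.mapsTo.image_subset fun y hy => ⟨A.σ y, A.mapsTo_inv hy, A.right_inv y hy⟩

theorem injOn_τ : InjOn A.τ A.src := fun x hx y hy h => by
  rw [← A.left_inv x hx, h, A.left_inv y hy]

theorem hasFDerivAt_τ {y : EuclideanSpace ℝ (Fin n)} (hy : y ∈ A.src) :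
    HasFDerivAt A.τ (fderiv ℝ A.τ y) y :=
  (A.smooth_τ.differentiableAt_of_isOpen A.isOpen_src hy).hasFDerivAt

theorem integral_tgt (W : EuclideanSpace ℝ (Fin n) → ℝ) :
    ∫ y in A.tgt, W y = ∫ y in A.src, |A.jac y| * W (A.τ y) := by
  rw [← image_src, integral_image_eq_integral_abs_det_fderiv_smul volume A.isOpen_src.measurableSet
    (fun y hy => (hasFDerivAt_τ hy).hasFDerivWithinAt) injOn_τ]
  rfl

theorem jac_ne_zero {y : EuclideanSpace ℝ (Fin n)} (hy : y ∈ A.src) : A.jac y ≠ 0 := by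
  have h1 := (A.smooth_σ.differentiableAt_of_isOpen A.isOpen_tgt (A.mapsTo hy)).hasFDerivAt.comp y
    (hasFDerivAt_τ hy)
  have h2 : A.σ ∘ A.τ =ᶠ[nhds y] id :=
    Filter.eventuallyEq_of_mem (A.isOpen_src.mem_nhds hy) A.left_inv
  have h3 := h1.unique ((hasFDerivAt_id y).congr_of_eventuallyEq h2)
  have h4 := congrArg (fun B : EuclideanSpace ℝ (Fin n) →L[ℝ] EuclideanSpace ℝ (Fin n) =>
    LinearMap.det (B : EuclideanSpace ℝ (Fin n) →ₗ[ℝ] EuclideanSpace ℝ (Fin n))) h3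
  rw [ContinuousLinearMap.coe_id, LinearMap.det_id] at h4
  have h5 : LinearMap.det ((fderiv ℝ A.σ (A.τ y)).toLinearMap ∘ₗ (fderiv ℝ A.τ y).toLinearMap) = 1 :=
    h4
  rw [LinearMap.det_comp] at h5
  exact right_ne_zero_of_mul_eq_one h5

theorem contDiffOn_jac : ContDiffOn ℝ ∞ A.jac A.src := by
  have h1 : ContDiffOn ℝ ∞ (fderiv ℝ A.τ) A.src :=
    A.smooth_τ.fderiv_of_isOpen A.isOpen_src (by simp)
  have h2 : A.jac = fun y => (Matrix.of fun i k : Fin n =>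
      fderiv ℝ A.τ y (EuclideanSpace.basisFun (Fin n) ℝ k) i).det := by
    funext y
    rw [jac, ContinuousLinearMap.det, ← LinearMap.det_toMatrix
      (EuclideanSpace.basisFun (Fin n) ℝ).toBasis]
    congr 1
    ext i k
    simp [LinearMap.toMatrix_apply]
  rw [h2]
  simp only [Matrix.det_apply]
  refine ContDiffOn.sum fun s _ => ContDiffOn.const_smul _ (contDiffOn_prod fun i _ => ?_)
  exact contDiffOn_euclidean.1 (h1.clm_apply contDiffOn_const) _

include hu in
/-- Naturality of the Euler operator, integrated against a test function. -/
theorem integral_eulerCoord {L L' : JetCoord n m → ℝ} (hL : SmOn A.tgt p L)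
    (hL' : ∀ z : JetCoord n m, z.1 ∈ A.src → L' z = A.jac z.1 * L (A.pr z)) {s : ℝ}
    (hs : ∀ y ∈ A.src, A.jac y = s * |A.jac y|) {η : Fin m → EuclideanSpace ℝ (Fin n) → ℝ}
    (hη : ∀ a, IsTestFn A.src (η a)) :
    ∫ y in A.src, ∑ b, eulerCoord b L' (jc u y) * η b y =
      ∫ y in A.src, A.jac y * ∑ a, eulerCoord a L (A.pr (jc u y)) *
        ∑ b, partialU b 0 (A.Φ a) (jc u y) * η b y := by
  have hsm' : SmOn A.src p L' :=
    ((SmOn.base contDiffOn_jac).mul (A.smOn_comp_pr hL)).congr hL'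
  have hηs : ∀ a, ContDiffOn ℝ ∞ (η a) A.src := fun a => (hη a).contDiff.contDiffOn
  have hut : ∀ t : ℝ, ∀ a, ContDiffOn ℝ ∞ (fun y => u a y + t * η a y) A.src := fun t a =>
    (hu a).add (contDiffOn_const.mul (hηs a))
  -- `v` and `V t` are the transforms of `u` and `u + t η`. Because `Φ` has order zero, the velocity
  -- of `V t` at `t = 0` involves `η` but none of its derivatives: it is `Z`, carried over to the
  -- target as the test function `ζ`.
  set v : Fin m → EuclideanSpace ℝ (Fin n) → ℝ := fun a y => A.Φ a (jc u (A.σ y)) with hv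
  set V : ℝ → Fin m → EuclideanSpace ℝ (Fin n) → ℝ :=
    fun t a y => A.Φ a (jc (fun a y => u a y + t * η a y) (A.σ y)) with hV
  have hvs : ∀ a, ContDiffOn ℝ ∞ (v a) A.tgt := contDiffOn_target hu fun a _ _ => rfl
  set Z : Fin m → EuclideanSpace ℝ (Fin n) → ℝ := fun a y =>
    ∑ b, partialU b 0 (A.Φ a) (jc u y) * η b y with hZ
  have hZt : ∀ a, IsTestFn A.src (Z a) := fun a => IsTestFn.sum fun b _ =>
    (hη b).mul_left A.isOpen_src (((A.smooth_Φ a).partialU A.isOpen_src b 0).contDiffOn_jc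
      A.isOpen_src hu)
  set ζ : Fin m → EuclideanSpace ℝ (Fin n) → ℝ := fun a => A.tgt.indicator fun y => Z a (A.σ y)
    with hζ
  have hζt : ∀ a, IsTestFn A.tgt (ζ a) := fun a => (hZt a).comp_σ
  have hVsm : ∀ a, ContDiffOn ℝ ∞ (Function.uncurry fun t => V t a) (univ ×ˢ A.tgt) := by
    intro a
    obtain ⟨g, hg, hgΦ⟩ := A.smooth_Φ a
    refine ContDiffOn.congr (f := fun q : ℝ × EuclideanSpace ℝ (Fin n) =>
      g (A.σ q.2, fun b _ => u b (A.σ q.2) + q.1 * η b (A.σ q.2))) ?_ ?_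
    · have h1 : ContDiffOn ℝ ∞ (fun q : ℝ × EuclideanSpace ℝ (Fin n) => A.σ q.2)
          (univ ×ˢ A.tgt) := A.smooth_σ.comp contDiff_snd.contDiffOn fun _ hq => hq.2
      have h2 : MapsTo (fun q : ℝ × EuclideanSpace ℝ (Fin n) => A.σ q.2) (univ ×ˢ A.tgt) A.src :=
        fun q hq => A.mapsTo_inv hq.2
      refine hg.comp (h1.prodMk (contDiffOn_pi.2 fun b => contDiffOn_pi.2 fun _ => ?_))
        fun q hq => ⟨h2 hq, mem_univ _⟩
      exact ((hu b).comp h1 h2).add (contDiff_fst.contDiffOn.mul ((hηs b).comp h1 h2))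
    · rintro ⟨t, y⟩ ⟨_, hy⟩
      refine (hgΦ _ (by exact A.mapsTo_inv hy)).trans (congrArg g ?_)
      refine Prod.ext rfl (funext fun b => funext fun I => ?_)
      change multiPow partialD I.1 _ _ = _
      rw [mem_multiIndexLE_zero.1 I.2, multiPow_zero]
  have hVd : ∀ a, ∀ y ∈ A.tgt, HasDerivAt (fun t => V t a y) (ζ a y) 0 := by
    intro a y hy
    have := (A.smooth_Φ a).hasDerivAt_variation A.isOpen_src hu hηs (A.mapsTo_inv hy)
    simp only [multiIndexLE_zero, Finset.sum_singleton, multiPow_zero] at this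
    convert this using 1
    simp only [hζ, indicator_of_mem hy, hZ, mul_comm]
  -- `L'` at the jet of `u + t η` is the Jacobian times `L` at the jet of `V t`; both expressions
  -- are differentiated at `t = 0`.
  have hpt : ∀ y ∈ A.src, (∑ b, ∑ I ∈ multiIndexLE n p,
      multiPow partialD I (η b) y * partialU b I L' (jc u y)) =
      A.jac y * ∑ a, ∑ I ∈ multiIndexLE n p,
        multiPow partialD I (ζ a) (A.τ y) * partialU a I L (jc v (A.τ y)) := by
    intro y hy
    have h1 := hsm'.hasDerivAt_variation A.isOpen_src hu hηs hy
    have h2 := hL.hasDerivAt_curve A.isOpen_tgt (γ := fun t => jc (V t) (A.τ y)) (t := 0) (e := 0)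
      (d := fun a I => multiPow partialD I (ζ a) (A.τ y)) (A.mapsTo hy) (hasDerivAt_const _ _)
      (fun a I _ => hasDerivAt_multiPow_partialD A.isOpen_tgt I (hVsm a) (hVd a) (A.mapsTo hy))
    have h3 : ∀ t : ℝ, L' (jc (fun a y => u a y + t * η a y) y) =
        A.jac y * L (jc (V t) (A.τ y)) := fun t => by
      rw [hL' _ (by exact hy), jc_eq_pr (hut t) (v := V t) (fun a _ _ => rfl) hy]
      rfl
    simp only [h3] at h1
    have h4 := h1.unique (h2.const_mul (A.jac y))
    have h5 : V 0 = v := by simp [hV, hv]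
    simpa [h5] using h4
  -- The change of variables produces `|jac|`, whereas Lagrangians transform with `jac`; the
  -- constant sign `s` accounts for the difference.
  have hJ : ∀ W : EuclideanSpace ℝ (Fin n) → ℝ,
      ∫ y in A.src, A.jac y * W (A.τ y) = s * ∫ y in A.tgt, W y := fun W => by
    rw [integral_tgt, ← integral_const_mul]
    exact setIntegral_congr_fun A.isOpen_src.measurableSet fun y hy => by
      simp only [← mul_assoc, ← hs y hy]
  -- The first variation formula is used on the source, the integral is moved to the target, the
  -- formula is used there, and the result is moved back.
  rw [← hsm'.first_variation A.isOpen_src hu hη, setIntegral_congr_fun A.isOpen_src.measurableSet hpt,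
    hJ fun y => ∑ a, ∑ I ∈ multiIndexLE n p, multiPow partialD I (ζ a) y * partialU a I L (jc v y),
    hL.first_variation A.isOpen_tgt hvs hζt, ← hJ]
  refine setIntegral_congr_fun A.isOpen_src.measurableSet fun y hy => ?_
  congr 1
  refine Finset.sum_congr rfl fun a _ => ?_
  rw [jc_eq_pr hu (v := v) (fun a _ _ => rfl) hy]
  simp only [hζ, indicator_of_mem (A.mapsTo hy), hZ, A.left_inv y hy]

end

/-- The restriction to an open subset of the source. -/
def restrict (Ω : Set (EuclideanSpace ℝ (Fin n))) (hΩ : IsOpen Ω) : CoordMap n m where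
  src := A.src ∩ Ω
  tgt := A.tgt ∩ A.σ ⁻¹' Ω
  τ := A.τ
  σ := A.σ
  Φ := A.Φ
  isOpen_src := A.isOpen_src.inter hΩ
  isOpen_tgt := A.smooth_σ.continuousOn.isOpen_inter_preimage A.isOpen_tgt hΩ
  mapsTo := fun y hy => ⟨A.mapsTo hy.1, by simpa [A.left_inv y hy.1] using hy.2⟩
  mapsTo_inv := fun y hy => ⟨A.mapsTo_inv hy.1, hy.2⟩
  left_inv := fun y hy => A.left_inv y hy.1
  right_inv := fun y hy => A.right_inv y hy.1
  smooth_τ := A.smooth_τ.mono inter_subset_left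
  smooth_σ := A.smooth_σ.mono inter_subset_left
  smooth_Φ := fun a => (A.smooth_Φ a).subset inter_subset_left

variable {A}

/-- Naturality of the Euler operator under `(τ, Φ)`. -/
theorem eulerCoord_pr {u : Fin m → EuclideanSpace ℝ (Fin n) → ℝ}
    (hu : ∀ a, ContDiffOn ℝ ∞ (u a) A.src) {L L' : JetCoord n m → ℝ} (hL : SmOn A.tgt p L)
    (hL' : ∀ z : JetCoord n m, z.1 ∈ A.src → L' z = A.jac z.1 * L (A.pr z))
    {y : EuclideanSpace ℝ (Fin n)} (hy : y ∈ A.src) (b : Fin m) :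
    eulerCoord b L' (jc u y) = A.jac y * ∑ a, eulerCoord a L (A.pr (jc u y)) *
      partialU b 0 (A.Φ a) (jc u y) := by
  -- `s` is the sign of the Jacobian at `y`. Everything is restricted to the open set on which the
  -- Jacobian has this sign, as `integral_eulerCoord` requires.
  obtain ⟨s, hs, hsy⟩ : ∃ s : ℝ, s * s = 1 ∧ 0 < s * A.jac y := by
    rcases lt_or_gt_of_ne (jac_ne_zero hy) with h | h
    · exact ⟨-1, by norm_num, by linarith⟩
    · exact ⟨1, by norm_num, by linarith⟩
  have hopen : IsOpen (A.src ∩ (fun y => s * A.jac y) ⁻¹' Ioi 0) :=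
    (continuousOn_const.mul contDiffOn_jac.continuousOn).isOpen_inter_preimage A.isOpen_src
      isOpen_Ioi
  set B := A.restrict _ hopen with hB
  have hsub : B.src ⊆ A.src := inter_subset_left
  have hyB : y ∈ B.src := ⟨hy, hy, hsy⟩
  have huB : ∀ a, ContDiffOn ℝ ∞ (u a) B.src := fun a => (hu a).mono hsub
  have hLB : SmOn B.tgt p L := hL.subset inter_subset_left
  have hLB' : ∀ z : JetCoord n m, z.1 ∈ B.src → L' z = B.jac z.1 * L (B.pr z) :=
    fun z hz => hL' z (hsub hz)
  have hsm' : SmOn B.src p L' :=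
    ((SmOn.base contDiffOn_jac).mul (B.smOn_comp_pr hLB)).congr hLB'
  have hsB : ∀ y ∈ B.src, B.jac y = s * |B.jac y| := by
    intro x hx
    have h1 : 0 < s * B.jac x := hx.2.2
    have h2 : |s| = 1 := by
      have := abs_mul_abs_self s
      rw [hs] at this
      nlinarith [abs_nonneg s]
    have h3 : |B.jac x| = s * B.jac x := by rw [← abs_of_pos h1, abs_mul, h2, one_mul]
    rw [h3, ← mul_assoc, hs, one_mul]
  set F : EuclideanSpace ℝ (Fin n) → ℝ := fun y => eulerCoord b L' (jc u y) -
    B.jac y * ∑ a, eulerCoord a L (B.pr (jc u y)) * partialU b 0 (B.Φ a) (jc u y) with hF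
  have hF1 : ContDiffOn ℝ ∞ (fun y => eulerCoord b L' (jc u y)) B.src :=
    (hsm'.eulerCoord B.isOpen_src b).contDiffOn_jc B.isOpen_src huB
  have hF2 : ContDiffOn ℝ ∞ (fun y => B.jac y * ∑ a, eulerCoord a L (B.pr (jc u y)) *
      partialU b 0 (B.Φ a) (jc u y)) B.src := by
    refine contDiffOn_jac.mul (ContDiffOn.sum fun a _ => ContDiffOn.mul ?_ ?_)
    · exact (B.smOn_comp_pr (hLB.eulerCoord B.isOpen_tgt a)).contDiffOn_jc B.isOpen_src huB
    · exact ((B.smooth_Φ a).partialU B.isOpen_src b 0).contDiffOn_jc B.isOpen_src huB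
  -- Variations in the single component `b` isolate the `b`-th Euler expression, and the fundamental
  -- lemma turns the integrated identity into a pointwise one.
  have h0 := eq_zero_of_integral_testFn B.isOpen_src (F := F) (hF1.sub hF2).continuousOn
    (fun h hh => by
      classical
      have hη : ∀ a, IsTestFn B.src (if a = b then h else fun _ => 0) := by
        intro a
        split_ifs
        · exact hh
        · exact IsTestFn.zero
      have := integral_eulerCoord huB hLB hLB' hsB hη
      have h1 : ∀ (g : Fin m → ℝ) (y : EuclideanSpace ℝ (Fin n)),
          ∑ a, g a * (if a = b then h else fun _ => 0) y = g b * h y := by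
        intro g y
        rw [Finset.sum_eq_single b]
        · simp
        · intro a _ ha; simp [ha]
        · simp
      simp only [h1] at this
      have h2 : ∀ y, F y * h y = eulerCoord b L' (jc u y) * h y -
          B.jac y * ∑ a, eulerCoord a L (B.pr (jc u y)) *
            (partialU b 0 (B.Φ a) (jc u y) * h y) := by
        intro y
        simp only [hF, sub_mul, mul_assoc, Finset.sum_mul]
      simp only [h2]
      rw [integral_sub, this, sub_self]
      · exact (hh.mul_left B.isOpen_src hF1).integrable.integrableOn
      · have h3 := (hh.mul_left B.isOpen_src hF2).integrable.integrableOn (s := B.src)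
        simp only [mul_assoc, Finset.sum_mul] at h3
        exact h3) y hyB
  exact sub_eq_zero.1 h0

end CoordMap

end CoordMap

end

end LocalFunctionals

namespace LocalFunctionals

noncomputable section

set_option linter.unusedSectionVars false

/-! ### Charts, bundle charts and coordinates of sections -/

section Charts

variable {n m : ℕ} {M : Type*} [TopologicalSpace M] [ChartedSpace (EuclideanSpace ℝ (Fin n)) M]

local notation "κ" => chartAt (EuclideanSpace ℝ (Fin n))

theorem contDiffOn_transition [IsManifold (𝓡 n) ∞ M] {f : M → M} (hf : ContMDiff (𝓡 n) (𝓡 n) ∞ f)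
    (c c' : M) : ContDiffOn ℝ ∞ (fun y => κ c' (f ((κ c).symm y)))
      ((κ c).target ∩ (fun y => f ((κ c).symm y)) ⁻¹' (κ c').source) := by
  rw [← contMDiffOn_iff_contDiffOn]
  refine (contMDiffOn_chart (x := c')).comp (hf.contMDiffOn.comp
    ((contMDiffOn_chart_symm (x := c)).mono inter_subset_left) (t := univ)
    fun _ _ => mem_univ _) fun y hy => hy.2

theorem isOpen_transition {f : M → M} (hf : Continuous f) (c c' : M) :
    IsOpen ((κ c).target ∩ (fun y => f ((κ c).symm y)) ⁻¹' (κ c').source) :=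
  (hf.comp_continuousOn (κ c).continuousOn_symm).isOpen_inter_preimage (κ c).open_target
    (κ c').open_source

end Charts

section Bundle

variable {n m : ℕ} {M : Type*} [TopologicalSpace M] [ChartedSpace (EuclideanSpace ℝ (Fin n)) M]
  {V : M → Type*} [TopologicalSpace (TotalSpace (EuclideanSpace ℝ (Fin m)) V)]
  [∀ x, AddCommGroup (V x)] [∀ x, Module ℝ (V x)] [∀ x, TopologicalSpace (V x)]
  [FiberBundle (EuclideanSpace ℝ (Fin m)) V]

local notation "κ" => chartAt (EuclideanSpace ℝ (Fin n))

variable (n m V) in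
theorem isOpen_dom (c : M) : IsOpen (dom n m V c) :=
  (κ c).open_source.inter (triv m V c).open_baseSet

variable (n m V) in
theorem mem_dom_self (c : M) : c ∈ dom n m V c :=
  ⟨mem_chart_source _ c, FiberBundle.mem_baseSet_trivializationAt' c⟩

variable (n m V) in
theorem isOpen_domCoord (c : M) : IsOpen (domCoord n m V c) :=
  (κ c).isOpen_inter_preimage_symm (triv m V c).open_baseSet

theorem symm_mem_dom {c : M} {y : EuclideanSpace ℝ (Fin n)} (hy : y ∈ domCoord n m V c) :
    (κ c).symm y ∈ dom n m V c := ⟨(κ c).map_target hy.1, hy.2⟩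

theorem chart_symm {c : M} {y : EuclideanSpace ℝ (Fin n)} (hy : y ∈ domCoord n m V c) :
    κ c ((κ c).symm y) = y := (κ c).right_inv hy.1

theorem symm_chart {c x : M} (hx : x ∈ dom n m V c) : (κ c).symm (κ c x) = x :=
  (κ c).left_inv hx.1

theorem chart_mem {c x : M} (hx : x ∈ dom n m V c) : κ c x ∈ domCoord n m V c :=
  ⟨(κ c).map_source hx.1, by simpa [symm_chart hx] using hx.2⟩

/-- The fiber coordinates of the value of a section. -/
theorem toLp_secCoord {c x : M} (hx : x ∈ dom n m V c) (φ : Sec n m V) :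
    WithLp.toLp 2 (fun a => secCoord c φ a (κ c x)) = (triv m V c ⟨x, φ x⟩).2 := by
  ext a
  exact congrArg (fun x => (triv m V c ⟨x, φ x⟩).2 a) (symm_chart hx)

variable [IsManifold (𝓡 n) ∞ M] [VectorBundle ℝ (EuclideanSpace ℝ (Fin m)) V]
  [ContMDiffVectorBundle ∞ (EuclideanSpace ℝ (Fin m)) V (𝓡 n)]

theorem contDiffOn_secCoord (c : M) (φ : Sec n m V) (a : Fin m) :
    ContDiffOn ℝ ∞ (secCoord c φ a) (domCoord n m V c) := by
  have h1 : ContMDiffOn (𝓡 n) (𝓡 m) ∞ (fun x => (triv m V c ⟨x, φ x⟩).2) (triv m V c).baseSet :=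
    ((triv m V c).contMDiffOn_section_baseSet_iff).1 φ.contMDiff.contMDiffOn
  have h2 : ContMDiffOn (𝓡 n) (𝓡 m) ∞
      (fun y => (triv m V c ⟨(κ c).symm y, φ ((κ c).symm y)⟩).2) (domCoord n m V c) :=
    h1.comp ((contMDiffOn_chart_symm (x := c)).mono inter_subset_left) fun y hy => hy.2
  exact contDiffOn_euclidean.1 (contMDiffOn_iff_contDiffOn.1 h2) a

/-! ### Sections with given coordinates -/

section TestSec

variable [T2Space M]

/-- The support in `M` of test functions in the chart at `c`. -/
def testSupp (c : M) (η : Fin m → EuclideanSpace ℝ (Fin n) → ℝ) : Set M :=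
  (κ c).symm '' ⋃ a, tsupport (η a)

theorem isCompact_testSupp {c : M} {η : Fin m → EuclideanSpace ℝ (Fin n) → ℝ}
    (hη : ∀ a, IsTestFn (domCoord n m V c) (η a)) : IsCompact (testSupp c η) :=
  (isCompact_iUnion fun a => (hη a).compact.isCompact).image_of_continuousOn
    ((κ c).continuousOn_symm.mono (iUnion_subset fun a => (hη a).subset.trans inter_subset_left))

theorem testSupp_subset {c : M} {η : Fin m → EuclideanSpace ℝ (Fin n) → ℝ}
    (hη : ∀ a, IsTestFn (domCoord n m V c) (η a)) : testSupp c η ⊆ dom n m V c := by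
  rintro _ ⟨y, hy, rfl⟩
  obtain ⟨a, ha⟩ := mem_iUnion.1 hy
  exact symm_mem_dom ((hη a).subset ha)

theorem eq_zero_of_notMem_testSupp {c x : M} {η : Fin m → EuclideanSpace ℝ (Fin n) → ℝ}
    (hx : x ∈ dom n m V c) (h : x ∉ testSupp c η) (a : Fin m) : η a (κ c x) = 0 := by
  by_contra hne
  exact h ⟨κ c x, mem_iUnion.2 ⟨a, subset_tsupport _ hne⟩, symm_chart hx⟩

open Classical in
/-- The section with coordinates `η` in the bundle chart at `c`, extended by zero. -/
def testSecFun (V : M → Type*) [TopologicalSpace (TotalSpace (EuclideanSpace ℝ (Fin m)) V)]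
    [∀ x, AddCommGroup (V x)] [∀ x, Module ℝ (V x)] [∀ x, TopologicalSpace (V x)]
    [FiberBundle (EuclideanSpace ℝ (Fin m)) V] (c : M)
    (η : Fin m → EuclideanSpace ℝ (Fin n) → ℝ) (x : M) : V x :=
  if x ∈ dom n m V c then (triv m V c).symm x (WithLp.toLp 2 fun a => η a (κ c x)) else 0

theorem triv_testSecFun {c x : M} (hx : x ∈ dom n m V c)
    (η : Fin m → EuclideanSpace ℝ (Fin n) → ℝ) :
    triv m V c ⟨x, testSecFun V c η x⟩ = (x, WithLp.toLp 2 fun a => η a (κ c x)) := by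
  rw [testSecFun, if_pos hx]
  exact (triv m V c).apply_mk_symm hx.2 _

theorem testSecFun_eq_zero {c x : M} {η : Fin m → EuclideanSpace ℝ (Fin n) → ℝ}
    (hx : x ∉ testSupp c η) : testSecFun V c η x = 0 := by
  rw [testSecFun]
  split_ifs with h
  · have : (WithLp.toLp 2 fun a => η a (κ c x)) = (0 : EuclideanSpace ℝ (Fin m)) := by
      ext a
      exact eq_zero_of_notMem_testSupp h hx a
    rw [this, ← (triv m V c).symmₗ_apply (R := ℝ) h.2, map_zero]
  · rfl

/-- The compactly supported section with coordinates `η` in the bundle chart at `c`. -/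
def testSec (c : M) (η : Fin m → EuclideanSpace ℝ (Fin n) → ℝ)
    (hη : ∀ a, IsTestFn (domCoord n m V c) (η a)) : Sec n m V where
  toFun := testSecFun V c η
  contMDiff_toFun := by
    intro x
    by_cases hx : x ∈ testSupp c η
    · have hxd := testSupp_subset hη hx
      refine ((triv m V c).contMDiffAt_section_iff hxd.2).2 ?_
      have h1 : ContMDiffAt (𝓡 n) (𝓡 m) ∞ (fun x => WithLp.toLp 2 fun a => η a (κ c x)) x := by
        have h2 : ContDiff ℝ ∞ (fun y => WithLp.toLp 2 fun a => η a y) :=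
          contDiff_euclidean.2 fun a => (hη a).contDiff
        exact h2.contMDiff.contMDiffAt.comp x
          ((contMDiffOn_chart (x := c)).contMDiffAt ((κ c).open_source.mem_nhds hxd.1))
      refine h1.congr_of_eventuallyEq ?_
      filter_upwards [(isOpen_dom n m V c).mem_nhds hxd] with x' hx'
      rw [triv_testSecFun hx']
    · refine (contMDiff_zeroSection ℝ V x).congr_of_eventuallyEq ?_
      filter_upwards [(isCompact_testSupp hη).isClosed.isOpen_compl.mem_nhds hx] with x' hx'
      rw [testSecFun_eq_zero hx']
      rfl

variable {c : M} {η : Fin m → EuclideanSpace ℝ (Fin n) → ℝ}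
  (hη : ∀ a, IsTestFn (domCoord n m V c) (η a))

theorem testSec_eq_zero {x : M} (hx : x ∉ testSupp c η) : testSec c η hη x = 0 :=
  testSecFun_eq_zero hx

theorem compactSupp_testSec : CompactSupp (testSec c η hη) :=
  ⟨_, isCompact_testSupp hη, fun _ hx => testSec_eq_zero hη hx⟩

theorem secCoord_testSec (a : Fin m) :
    EqOn (secCoord c (testSec c η hη) a) (η a) (domCoord n m V c) := by
  intro y hy
  change (triv m V c ⟨(κ c).symm y, testSecFun V c η ((κ c).symm y)⟩).2 a = _
  rw [triv_testSecFun (symm_mem_dom hy)]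
  simp only [chart_symm hy]

theorem secCoord_add_smul (φ φ' : Sec n m V) (t : ℝ) (a : Fin m) :
    EqOn (secCoord c (φ + t • φ') a) (fun y => secCoord c φ a y + t * secCoord c φ' a y)
      (domCoord n m V c) := by
  intro y hy
  have h1 : ∀ v : V ((κ c).symm y), (triv m V c ⟨(κ c).symm y, v⟩).2 =
      (triv m V c).linearMapAt ℝ _ v := fun v => by
    rw [(triv m V c).coe_linearMapAt_of_mem hy.2]
  simp only [secCoord]
  simp only [h1, ContMDiffSection.coe_add, ContMDiffSection.coe_smul, Pi.add_apply, Pi.smul_apply,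
    map_add, map_smul]
  rfl

end TestSec

end Bundle

/-- A smooth function on an open set agrees near a point with a test function. -/
theorem exists_testFn_eventuallyEq {n : ℕ} {Ω : Set (EuclideanSpace ℝ (Fin n))} (hΩ : IsOpen Ω)
    {y : EuclideanSpace ℝ (Fin n)} (hy : y ∈ Ω) {ι : Type*}
    {u : ι → EuclideanSpace ℝ (Fin n) → ℝ} (hu : ∀ a, ContDiffOn ℝ ∞ (u a) Ω) :
    ∃ η : ι → EuclideanSpace ℝ (Fin n) → ℝ, (∀ a, IsTestFn Ω (η a)) ∧
      ∃ U, IsOpen U ∧ y ∈ U ∧ U ⊆ Ω ∧ ∀ a, EqOn (η a) (u a) U := by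
  obtain ⟨r, hr, hrΩ⟩ := Metric.isOpen_iff.1 hΩ y hy
  let b : ContDiffBump y := ⟨r / 4, r / 2, by positivity, by linarith⟩
  have hb : IsTestFn Ω b := ⟨b.contDiff, b.hasCompactSupport, by
    rw [b.tsupport_eq]
    exact (Metric.closedBall_subset_ball (by change r / 2 < r; linarith)).trans hrΩ⟩
  refine ⟨fun a y => u a y * b y, fun a => hb.mul_left hΩ (hu a), Metric.ball y (r / 4),
    Metric.isOpen_ball, Metric.mem_ball_self (by positivity),
    (Metric.ball_subset_ball (by linarith)).trans hrΩ, fun a x hx => ?_⟩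
  have := b.one_of_mem_closedBall (Metric.ball_subset_closedBall hx)
  simp only [this, mul_one]

end

end LocalFunctionals

namespace LocalFunctionals

noncomputable section

set_option linter.unusedSectionVars false

/-! ### Jets of sections and the action of automorphisms on them -/

section Jets

variable {n m : ℕ} {M : Type*} [TopologicalSpace M] [ChartedSpace (EuclideanSpace ℝ (Fin n)) M]
  {V : M → Type*} [TopologicalSpace (TotalSpace (EuclideanSpace ℝ (Fin m)) V)]
  [∀ x, AddCommGroup (V x)] [∀ x, Module ℝ (V x)] [∀ x, TopologicalSpace (V x)]
  [FiberBundle (EuclideanSpace ℝ (Fin m)) V]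
variable [IsManifold (𝓡 n) ∞ M] [VectorBundle ℝ (EuclideanSpace ℝ (Fin m)) V]
  [ContMDiffVectorBundle ∞ (EuclideanSpace ℝ (Fin m)) V (𝓡 n)]

local notation "κ" => chartAt (EuclideanSpace ℝ (Fin n))

namespace BundleAut

variable (ψ : BundleAut n m V)

variable (n m V) in
/-- The identity. -/
def refl : BundleAut n m V where
  toDiffeo := Diffeomorph.refl _ _ _
  base := Diffeomorph.refl _ _ _
  proj_eq _ := rfl

/-- A change of bundle chart is the coordinate expression of the identity. Through the lemmas on
`refl`, a statement about `ψ` in the charts at `c` and `c'` yields the corresponding change-of-chart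
statement. -/
theorem refl_onSec (φ : Sec n m V) : (BundleAut.refl n m V).onSec φ = φ := by
  refine ContMDiffSection.ext fun x => ?_
  have := (BundleAut.refl n m V).mk_onSec φ x
  exact eq_of_heq (TotalSpace.mk.inj this).2

theorem base_symm_apply (x : M) : ψ.base.symm (ψ.base x) = x := ψ.base.toEquiv.symm_apply_apply x

theorem base_apply_symm (x : M) : ψ.base (ψ.base.symm x) = x := ψ.base.toEquiv.apply_symm_apply x

/-- The set of coordinates in the chart at `c` of the points of `dom c` that `ψ_M` maps to
`dom c'`. -/
def coordSrc (c c' : M) : Set (EuclideanSpace ℝ (Fin n)) :=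
  domCoord n m V c ∩ (fun y => ψ.base ((κ c).symm y)) ⁻¹' dom n m V c'

theorem isOpen_coordSrc (c c' : M) : IsOpen (ψ.coordSrc c c') :=
  ((ψ.base.continuous.comp_continuousOn ((κ c).continuousOn_symm.mono
    inter_subset_left)).isOpen_inter_preimage (isOpen_domCoord n m V c) (isOpen_dom n m V c'))

theorem contDiffOn_fiberCoord (c c' : M) :
    ContDiffOn ℝ ∞ (fun q : EuclideanSpace ℝ (Fin n) × EuclideanSpace ℝ (Fin m) =>
      ψ.fiberCoord c c' ((κ c).symm q.1) q.2) (ψ.coordSrc c c' ×ˢ univ) := by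
  have h1 : ContMDiffOn ((𝓡 n).prod (𝓡 m)) (𝓡 m) ∞
      (fun q : EuclideanSpace ℝ (Fin n) × EuclideanSpace ℝ (Fin m) =>
        ψ.fiberCoord c c' ((κ c).symm q.1) q.2) (ψ.coordSrc c c' ×ˢ univ) := by
    have h2 : ContMDiffOn ((𝓡 n).prod (𝓡 m)) ((𝓡 n).prod (𝓡 m)) ∞
        (fun q : EuclideanSpace ℝ (Fin n) × EuclideanSpace ℝ (Fin m) => ((κ c).symm q.1, q.2))
        (ψ.coordSrc c c' ×ˢ univ) :=
      (((contMDiffOn_chart_symm (x := c)).comp contMDiffOn_fst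
        (fun q hq => hq.1.1.1))).prodMk contMDiffOn_snd
    have h3 := ((triv m V c).contMDiffOn_symm (n := ∞) (IB := 𝓡 n)).comp h2
      fun q hq => (triv m V c).mem_target.2 hq.1.1.2
    have h4 := ψ.toDiffeo.contMDiff.contMDiffOn (s := univ) |>.comp h3 fun _ _ => mem_univ _
    have h5 : ∀ q ∈ ψ.coordSrc c c' ×ˢ univ, ((triv m V c).toOpenPartialHomeomorph.symm
        ((κ c).symm q.1, q.2)) = ⟨(κ c).symm q.1, (triv m V c).symm ((κ c).symm q.1) q.2⟩ :=
      fun q hq => ((triv m V c).mk_symm hq.1.1.2 _).symm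
    have h6 := (((triv m V c').contMDiffOn_iff (s := ψ.coordSrc c c' ×ˢ univ) (by
      intro q hq
      rw [(triv m V c').mem_source]
      simp only [Function.comp, h5 q hq, ψ.proj_eq]
      exact hq.1.2.2)).1 h4).2
    refine h6.congr fun q hq => ?_
    simp only [Function.comp, h5 q hq]
    rfl
  -- The product manifold structure on the two Euclidean spaces is the one of their product as a
  -- normed space, so manifold smoothness becomes `ContDiffOn`.
  rw [← modelWithCornersSelf_prod, chartedSpaceSelf_prod] at h1
  exact contMDiffOn_iff_contDiffOn.1 h1

theorem smOn_fiberCoord (c c' : M) (a : Fin m) :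
    SmOn (ψ.coordSrc c c') 0 (fun z : JetCoord n m =>
      ψ.fiberCoord c c' ((κ c).symm z.1) (WithLp.toLp 2 fun b => z.2 b 0) a) := by
  refine ⟨fun w => ψ.fiberCoord c c' ((κ c).symm w.1)
    (WithLp.toLp 2 fun b => w.2 b ⟨0, mem_multiIndexLE_zero.2 rfl⟩) a, ?_, fun _ _ => rfl⟩
  refine contDiffOn_euclidean.1 ((ψ.contDiffOn_fiberCoord c c').comp (g := fun q : EuclideanSpace ℝ (Fin n) ×
    EuclideanSpace ℝ (Fin m) => ψ.fiberCoord c c' ((κ c).symm q.1) q.2)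
    (f := fun w : EuclideanSpace ℝ (Fin n) × (Fin m → {I // I ∈ multiIndexLE n 0} → ℝ) =>
      (w.1, WithLp.toLp 2 fun b => w.2 b ⟨0, mem_multiIndexLE_zero.2 rfl⟩)) ?_
      fun w hw => ⟨hw.1, mem_univ _⟩) a
  refine contDiffOn_fst.prodMk (contDiffOn_euclidean.2 fun b => ?_)
  fun_prop

/-- The map `ψ` in the bundle charts at `c` and `c'`. -/
def coordMap (c c' : M) : CoordMap n m where
  src := ψ.coordSrc c c'
  tgt := domCoord n m V c' ∩ (fun y => ψ.base.symm ((κ c').symm y)) ⁻¹' dom n m V c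
  τ y := κ c' (ψ.base ((κ c).symm y))
  σ y := κ c (ψ.base.symm ((κ c').symm y))
  Φ a z := ψ.fiberCoord c c' ((κ c).symm z.1) (WithLp.toLp 2 fun b => z.2 b 0) a
  isOpen_src := ψ.isOpen_coordSrc c c'
  isOpen_tgt := ((ψ.base.symm.continuous.comp_continuousOn ((κ c').continuousOn_symm.mono
    inter_subset_left)).isOpen_inter_preimage (isOpen_domCoord n m V c') (isOpen_dom n m V c))
  mapsTo y hy := ⟨chart_mem hy.2, by
    rw [mem_preimage, symm_chart hy.2, ψ.base_symm_apply]
    exact symm_mem_dom hy.1⟩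
  mapsTo_inv y hy := ⟨chart_mem hy.2, by
    rw [mem_preimage, symm_chart hy.2, ψ.base_apply_symm]
    exact symm_mem_dom hy.1⟩
  left_inv y hy := by rw [symm_chart hy.2, ψ.base_symm_apply, chart_symm hy.1]
  right_inv y hy := by rw [symm_chart hy.2, ψ.base_apply_symm, chart_symm hy.1]
  smooth_τ := (contDiffOn_transition ψ.base.contMDiff c c').mono fun _ hy => ⟨hy.1.1, hy.2.1⟩
  smooth_σ := (contDiffOn_transition ψ.base.symm.contMDiff c' c).mono
    fun _ hy => ⟨hy.1.1, hy.2.1⟩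
  smooth_Φ := ψ.smOn_fiberCoord c c'

theorem chart_mem_src {c c' x : M} (hx : x ∈ dom n m V c) (hx' : ψ.base x ∈ dom n m V c') :
    κ c x ∈ (ψ.coordMap c c').src :=
  ⟨chart_mem hx, by rwa [mem_preimage, symm_chart hx]⟩

theorem coordMap_τ_chart {c c' x : M} (hx : x ∈ dom n m V c) :
    (ψ.coordMap c c').τ (κ c x) = κ c' (ψ.base x) := by
  change κ c' (ψ.base ((κ c).symm (κ c x))) = _
  rw [symm_chart hx]

theorem secCoord_onSec (c c' : M) (φ : Sec n m V) (a : Fin m) :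
    EqOn (secCoord c' (ψ.onSec φ) a)
      (fun y => (ψ.coordMap c c').Φ a (jc (secCoord c φ) ((ψ.coordMap c c').σ y)))
      (ψ.coordMap c c').tgt := by
  intro y hy
  have hx : ψ.base.symm ((κ c').symm y) ∈ dom n m V c := hy.2
  change (triv m V c' ⟨(κ c').symm y, ψ.onSec φ ((κ c').symm y)⟩).2 a =
    ψ.fiberCoord c c' ((κ c).symm (κ c (ψ.base.symm ((κ c').symm y))))
      (WithLp.toLp 2 fun b => multiPow partialD 0 (secCoord c φ b)
        (κ c (ψ.base.symm ((κ c').symm y)))) a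
  simp only [multiPow_zero]
  rw [toLp_secCoord hx, symm_chart hx, ψ.mk_onSec, fiberCoord,
    (triv m V c).symm_apply_apply_mk hx.2]

theorem jc_onSec {c c' x : M} (hx : x ∈ dom n m V c) (hx' : ψ.base x ∈ dom n m V c')
    (φ : Sec n m V) : jc (secCoord c' (ψ.onSec φ)) (κ c' (ψ.base x)) =
      (ψ.coordMap c c').pr (jc (secCoord c φ) (κ c x)) := by
  rw [← ψ.coordMap_τ_chart hx]
  exact CoordMap.jc_eq_pr (fun a => (contDiffOn_secCoord c φ a).mono inter_subset_left)
    (ψ.secCoord_onSec c c' φ) (ψ.chart_mem_src hx hx')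

end BundleAut

theorem repr_rel (φ : Sec n m V) (x : M) : (jetSetoid n m V x).r (jet φ x).repr φ :=
  Quotient.mk_out (s := jetSetoid n m V x) φ

theorem jetCoord_jet {c x : M} (hx : x ∈ dom n m V c) (φ : Sec n m V) :
    jetCoord c (jet φ x) = jc (secCoord c φ) (κ c x) :=
  Prod.ext rfl (funext fun a => funext fun I => repr_rel φ x c hx a I)

theorem jet_repr (j : JetBundle n m V) : jet j.repr j.base = j := by
  obtain ⟨x, q⟩ := j
  exact congrArg (Sigma.mk x) (Quotient.out_eq q)

theorem jetCoord_eq_jc (c : M) (j : JetBundle n m V) :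
    jetCoord c j = jc (secCoord c j.repr) (κ c j.base) := rfl

/-- Equality of jets asks for agreement in all bundle charts. One chart suffices: the coordinates in
another one are obtained from it by the prolongation of the identity. -/
theorem jet_eq_of_jc_eq {c x : M} (hx : x ∈ dom n m V c) {φ φ' : Sec n m V}
    (h : jc (secCoord c φ) (κ c x) = jc (secCoord c φ') (κ c x)) : jet φ x = jet φ' x := by
  refine congrArg (Sigma.mk x) (Quotient.sound fun c' hx' a I => ?_)
  have key : ∀ φ : Sec n m V, jc (secCoord c' φ) (κ c' x) =
      ((BundleAut.refl n m V).coordMap c c').pr (jc (secCoord c φ) (κ c x)) := by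
    intro φ
    have := (BundleAut.refl n m V).jc_onSec hx (c' := c') hx' φ
    rwa [BundleAut.refl_onSec] at this
  have := (key φ).trans ((congrArg _ h).trans (key φ').symm)
  exact congrFun (congrFun (congrArg Prod.snd this) a) I

namespace BundleAut

theorem refl_onJet (j : JetBundle n m V) : (BundleAut.refl n m V).onJet j = j := by
  rw [onJet, refl_onSec]
  exact jet_repr j

variable (ψ : BundleAut n m V)

/-- `onJet` uses a chosen representative of the jet. The choice is irrelevant because the
prolongation `pr` sees only the jet coordinates. -/
theorem onJet_jet (φ : Sec n m V) (x : M) : ψ.onJet (jet φ x) = jet (ψ.onSec φ) (ψ.base x) := by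
  have hx := mem_dom_self n m V x
  have hx' := mem_dom_self n m V (ψ.base x)
  refine jet_eq_of_jc_eq (x := ψ.base x) hx' ?_
  rw [ψ.jc_onSec hx hx', ψ.jc_onSec hx hx', ← jetCoord_jet hx φ]
  rfl

theorem jetCoord_onJet {c c' : M} {j : JetBundle n m V} (hx : j.base ∈ dom n m V c)
    (hx' : ψ.base j.base ∈ dom n m V c') :
    jetCoord c' (ψ.onJet j) = (ψ.coordMap c c').pr (jetCoord c j) := by
  rw [onJet, jetCoord_jet hx', ψ.jc_onSec hx hx']
  rfl

end BundleAut

end Jets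

/-! ### Functions with prescribed derivatives up to a finite order -/

section Polynomial

variable {n : ℕ}

/-- For products of functions of one variable each, such as monomials, mixed partial derivatives
reduce to iterated one-variable derivatives. -/
theorem multiPow_partialD_prod (J : MultiIndex n) {f : Fin n → ℝ → ℝ}
    (hf : ∀ i, ContDiff ℝ ∞ (f i)) (y : EuclideanSpace ℝ (Fin n)) :
    multiPow partialD J (fun y => ∏ i, f i (y i)) y = ∏ i, iteratedDeriv (J i) (f i) (y i) := by
  induction J using MultiIndex.induction_single generalizing y with
  | zero => simp [multiPow_zero]
  | add J i ih =>
    have hs : ContDiffOn ℝ ∞ (fun y : EuclideanSpace ℝ (Fin n) => ∏ i, f i (y i)) univ :=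
      contDiffOn_prod fun i _ => ((hf i).comp (by fun_prop)).contDiffOn
    rw [multiPow_partialD_add_single isOpen_univ J i hs (mem_univ y)]
    have h1 : multiPow partialD J (fun y : EuclideanSpace ℝ (Fin n) => ∏ i, f i (y i)) =
        fun y => ∏ i, iteratedDeriv (J i) (f i) (y i) := funext ih
    rw [h1]
    have hd : ∀ k, Differentiable ℝ (iteratedDeriv (J k) (f k)) := fun k =>
      (hf k).differentiable_iteratedDeriv _ (by exact_mod_cast WithTop.coe_lt_top _)
    have hdiff : DifferentiableAt ℝ (fun y : EuclideanSpace ℝ (Fin n) =>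
        ∏ i, iteratedDeriv (J i) (f i) (y i)) y :=
      (HasFDerivAt.finsetProd fun k _ => (((hd k).differentiableAt (x := y k)).comp y
        (f := fun y : EuclideanSpace ℝ (Fin n) => y k) (by fun_prop)).hasFDerivAt).differentiableAt
    have h2 := hdiff.hasFDerivAt.hasLineDerivAt (EuclideanSpace.basisFun (Fin n) ℝ i)
    rw [HasLineDerivAt] at h2
    refine h2.unique ?_
    simp only [← Finset.mul_prod_erase Finset.univ _ (Finset.mem_univ i)]
    have h3 : ∀ t : ℝ, ∏ k ∈ Finset.univ.erase i, iteratedDeriv (J k) (f k)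
        ((y + t • EuclideanSpace.basisFun (Fin n) ℝ i) k) =
        ∏ k ∈ Finset.univ.erase i, iteratedDeriv ((J + Pi.single i 1 : MultiIndex n) k) (f k)
          (y k) := by
      intro t
      refine Finset.prod_congr rfl fun k hk => ?_
      have hk' := Finset.ne_of_mem_erase hk
      simp [hk']
    simp only [h3]
    refine HasDerivAt.mul_const ?_ _
    simp only [Pi.add_apply, Pi.single_eq_same, iteratedDeriv_succ]
    have h4 := ((hd i).differentiableAt (x := y i)).hasDerivAt
    have h5 : HasDerivAt (fun t : ℝ => (y + t • EuclideanSpace.basisFun (Fin n) ℝ i) i) 1 0 := by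
      simpa using (hasDerivAt_id (0 : ℝ)).const_add (y i)
    have h6 : HasDerivAt (iteratedDeriv (J i) (f i)) (deriv (iteratedDeriv (J i) (f i)) (y i))
        ((y + (0 : ℝ) • EuclideanSpace.basisFun (Fin n) ℝ i) i) := by simpa using h4
    exact (h6.comp 0 h5).congr_deriv (mul_one _)

theorem iteratedDeriv_monomial (k l : ℕ) (a : ℝ) :
    iteratedDeriv k (fun t : ℝ => (l.factorial : ℝ)⁻¹ * (t - a) ^ l) a =
      if k = l then 1 else 0 := by
  rw [iteratedDeriv_const_mul_field]
  have h1 := congrFun (iteratedDeriv_comp_sub_const (n := k) (f := fun t : ℝ => t ^ l) (s := a)) a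
  rw [h1, sub_self, iteratedDeriv_fun_pow_zero]
  split_ifs with h
  · subst h; field_simp
  · simp_all

/-- A smooth function with prescribed partial derivatives of order at most `p` at `y`. -/
theorem exists_contDiff_multiPow_eq (p : ℕ) (y : EuclideanSpace ℝ (Fin n)) (v : MultiIndex n → ℝ) :
    ∃ u : EuclideanSpace ℝ (Fin n) → ℝ, ContDiff ℝ ∞ u ∧
      ∀ I ∈ multiIndexLE n p, multiPow partialD I u y = v I := by
  -- The Taylor monomials at `y`, normalized by factorials, are dual to the derivatives at `y` (this
  -- is `hd`). Only finitely many derivatives are prescribed, so a polynomial is enough.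
  set mono : MultiIndex n → EuclideanSpace ℝ (Fin n) → ℝ := fun I x =>
    ∏ i, (((I i).factorial : ℝ)⁻¹ * (x i - y i) ^ I i) with hmono
  have hm : ∀ I, ContDiffOn ℝ ∞ (mono I) univ := fun I => by
    refine contDiffOn_prod fun i _ => ContDiff.contDiffOn ?_
    fun_prop
  have hd : ∀ I J, multiPow partialD J (mono I) y = if J = I then 1 else 0 := by
    intro I J
    rw [multiPow_partialD_prod J (f := fun i t => ((I i).factorial : ℝ)⁻¹ * (t - y i) ^ I i)
      (fun i => by fun_prop)]
    simp only [iteratedDeriv_monomial, Finset.prod_ite_zero, Finset.prod_const_one]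
    simp [funext_iff]
  have key : ∀ s : Finset (MultiIndex n), ∃ u : EuclideanSpace ℝ (Fin n) → ℝ,
      ContDiff ℝ ∞ u ∧ ∀ J, multiPow partialD J u y = if J ∈ s then v J else 0 := by
    intro s
    induction s using Finset.induction_on with
    | empty =>
      refine ⟨fun _ => 0, contDiff_const, fun J => ?_⟩
      have : multiPow partialD J (fun _ : EuclideanSpace ℝ (Fin n) => (0 : ℝ)) = fun _ => 0 :=
        multiPow_pred (Q := fun f : EuclideanSpace ℝ (Fin n) → ℝ => f = fun _ => 0)
          (fun i f hf => by subst hf; funext z; simp [partialD]) J rfl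
      simp [this]
    | insert I s hI ih =>
      obtain ⟨u, hu, huJ⟩ := ih
      refine ⟨fun x => u x + v I * mono I x, hu.add (contDiff_const.mul (contDiffOn_univ.1 (hm I))),
        fun J => ?_⟩
      refine (multiPow_partialD_lin isOpen_univ J (v I) hu.contDiffOn (hm I) (mem_univ y)).trans ?_
      simp only [huJ, hd]
      by_cases hJ : J = I
      · subst hJ; simp [hI]
      · simp [hJ]
  obtain ⟨u, hu, h⟩ := key (multiIndexLE n p)
  exact ⟨u, hu, fun I hI => by rw [h, if_pos hI]⟩

end Polynomial

end

end LocalFunctionals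

namespace LocalFunctionals

noncomputable section

set_option linter.unusedSectionVars false

theorem jc_congr {n m : ℕ} {Ω : Set (EuclideanSpace ℝ (Fin n))} (hΩ : IsOpen Ω)
    {u v : Fin m → EuclideanSpace ℝ (Fin n) → ℝ} (h : ∀ a, EqOn (u a) (v a) Ω)
    {y : EuclideanSpace ℝ (Fin n)} (hy : y ∈ Ω) : jc u y = jc v y :=
  Prod.ext rfl (funext fun a => funext fun I => multiPow_partialD_congr hΩ I (h a) hy)

/-- The restriction to the preimage of an open set. -/
theorem CoordMap.exists_restrict {n m : ℕ} (A : CoordMap n m)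
    {Ω' : Set (EuclideanSpace ℝ (Fin n))} (hΩ' : IsOpen Ω') :
    ∃ B : CoordMap n m, B.src = A.src ∩ A.τ ⁻¹' Ω' ∧ B.tgt ⊆ Ω' ∧ B.τ = A.τ ∧ B.Φ = A.Φ ∧
      B.pr = A.pr := by
  refine ⟨A.restrict _ (A.smooth_τ.continuousOn.isOpen_inter_preimage A.isOpen_src hΩ'),
    by simp [CoordMap.restrict, ← inter_assoc], fun y hy => ?_, rfl, rfl, rfl⟩
  have := hy.2.2
  rwa [mem_preimage, A.right_inv y hy.1] at this

/-! ### Local functions, tested near points of the base -/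

section LocAt

variable {n m : ℕ} {M : Type*} [TopologicalSpace M] [ChartedSpace (EuclideanSpace ℝ (Fin n)) M]
  {V : M → Type*} [TopologicalSpace (TotalSpace (EuclideanSpace ℝ (Fin m)) V)]
  [∀ x, AddCommGroup (V x)] [∀ x, Module ℝ (V x)] [∀ x, TopologicalSpace (V x)]
  [FiberBundle (EuclideanSpace ℝ (Fin m)) V]
variable [IsManifold (𝓡 n) ∞ M] [VectorBundle ℝ (EuclideanSpace ℝ (Fin m)) V]
  [ContMDiffVectorBundle ∞ (EuclideanSpace ℝ (Fin m)) V (𝓡 n)]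

local notation "κ" => chartAt (EuclideanSpace ℝ (Fin n))

/-- Over a neighborhood of `x`, `P` is a smooth function of the coordinates of order at most `p` of
the bundle chart at `c`. -/
def LocAt (c : M) (p : ℕ) (P : JetBundle n m V → ℝ) (x : M) : Prop :=
  ∃ Ω : Set (EuclideanSpace ℝ (Fin n)), IsOpen Ω ∧ Ω ⊆ domCoord n m V c ∧ κ c x ∈ Ω ∧
    ∃ f : JetCoord n m → ℝ, SmOn Ω p f ∧
      ∀ j : JetBundle n m V, j.base ∈ dom n m V c → κ c j.base ∈ Ω → P j = f (jetCoord c j)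

variable {c c' x : M} {p q : ℕ} {P Q : JetBundle n m V → ℝ}

theorem IsRep.smOn {f : JetCoord n m → ℝ} (h : IsRep c p P f) : SmOn (domCoord n m V c) p f := by
  obtain ⟨⟨g, hg, hfg⟩, -⟩ := h
  exact ⟨g, hg, fun z _ => hfg z⟩

theorem IsRep.locAt {f : JetCoord n m → ℝ} (h : IsRep c p P f) (hx : x ∈ dom n m V c) :
    LocAt c p P x :=
  ⟨_, isOpen_domCoord n m V c, subset_rfl, chart_mem hx, f, h.smOn, fun j hj _ => h.2 j hj⟩

namespace LocAt

theorem mono (h : LocAt c p P x) (hpq : p ≤ q) : LocAt c q P x := by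
  obtain ⟨Ω, hΩ, hd, hx, f, hf, hP⟩ := h
  exact ⟨Ω, hΩ, hd, hx, f, hf.mono hpq, hP⟩

theorem congr (h : LocAt c p P x) (hx : x ∈ dom n m V c) {U : Set M} (hU : U ∈ nhds x)
    (hPQ : ∀ j : JetBundle n m V, j.base ∈ U → Q j = P j) : LocAt c p Q x := by
  obtain ⟨Ω, hΩ, hd, hxΩ, f, hf, hP⟩ := h
  obtain ⟨U', hU', hU'o, hxU'⟩ := mem_nhds_iff.1 hU
  refine ⟨Ω ∩ ((κ c).target ∩ (κ c).symm ⁻¹' U'), hΩ.inter ((κ c).isOpen_inter_preimage_symm hU'o),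
    inter_subset_left.trans hd, ⟨hxΩ, (chart_mem hx).1, ?_⟩, f, hf.subset inter_subset_left,
    fun j hj hjΩ => ?_⟩
  · rwa [mem_preimage, symm_chart hx]
  · rw [hPQ j, hP j hj hjΩ.1]
    have := hjΩ.2.2
    rw [mem_preimage, symm_chart hj] at this
    exact hU' this

theorem of_base {h : M → ℝ} {g : EuclideanSpace ℝ (Fin n) → ℝ}
    {Ω : Set (EuclideanSpace ℝ (Fin n))} (hΩ : IsOpen Ω) (hd : Ω ⊆ domCoord n m V c)
    (hx : κ c x ∈ Ω) (hg : ContDiffOn ℝ ∞ g Ω)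
    (hgh : ∀ x ∈ dom n m V c, κ c x ∈ Ω → h x = g (κ c x)) :
    LocAt c p (fun j : JetBundle n m V => h j.base) x :=
  ⟨Ω, hΩ, hd, hx, fun z => g z.1, SmOn.base hg, fun _ hj hjΩ => hgh _ hj hjΩ⟩

theorem of_contMDiff {h : M → ℝ} (hh : ContMDiff (𝓡 n) 𝓘(ℝ, ℝ) ∞ h) (hx : x ∈ dom n m V c) :
    LocAt c p (fun j : JetBundle n m V => h j.base) x := by
  refine of_base (g := fun y => h ((κ c).symm y)) (isOpen_domCoord n m V c) subset_rfl
    (chart_mem hx) (contMDiffOn_iff_contDiffOn.1 ?_) fun x hx _ => by rw [symm_chart hx]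
  exact hh.comp_contMDiffOn ((contMDiffOn_chart_symm (x := c)).mono inter_subset_left)

theorem const (r : ℝ) (hx : x ∈ dom n m V c) : LocAt c p (fun _ : JetBundle n m V => r) x :=
  of_contMDiff (h := fun _ => r) contMDiff_const hx

theorem mul (h : LocAt c p P x) (h' : LocAt c p Q x) : LocAt c p (fun j => P j * Q j) x := by
  obtain ⟨Ω, hΩ, hd, hx, f, hf, hP⟩ := h
  obtain ⟨Ω', hΩ', hd', hx', f', hf', hQ⟩ := h'
  exact ⟨Ω ∩ Ω', hΩ.inter hΩ', inter_subset_left.trans hd, ⟨hx, hx'⟩, fun z => f z * f' z,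
    (hf.subset inter_subset_left).mul (hf'.subset inter_subset_right),
    fun j hj hjΩ => by simp only [hP j hj hjΩ.1, hQ j hj hjΩ.2]⟩

theorem add (h : LocAt c p P x) (h' : LocAt c p Q x) : LocAt c p (fun j => P j + Q j) x := by
  obtain ⟨Ω, hΩ, hd, hx, f, hf, hP⟩ := h
  obtain ⟨Ω', hΩ', hd', hx', f', hf', hQ⟩ := h'
  exact ⟨Ω ∩ Ω', hΩ.inter hΩ', inter_subset_left.trans hd, ⟨hx, hx'⟩, fun z => f z + f' z,
    (hf.subset inter_subset_left).add (hf'.subset inter_subset_right),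
    fun j hj hjΩ => by simp only [hP j hj hjΩ.1, hQ j hj hjΩ.2]⟩

theorem sum {ι : Type*} {s : Finset ι} {P : ι → JetBundle n m V → ℝ} (hx : x ∈ dom n m V c)
    (h : ∀ i ∈ s, LocAt c p (P i) x) : LocAt c p (fun j => ∑ i ∈ s, P i j) x := by
  classical
  induction s using Finset.induction_on with
  | empty => simpa using const 0 hx
  | insert i s hi ih =>
    simp only [Finset.sum_insert hi]
    exact (h i (Finset.mem_insert_self _ _)).add
      (ih fun k hk => h k (Finset.mem_insert_of_mem hk))

/-- Composition with `jψ`. -/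
theorem comp_onJet (ψ : BundleAut n m V) (hx : x ∈ dom n m V c) (hx' : ψ.base x ∈ dom n m V c')
    (h : LocAt c' p P (ψ.base x)) : LocAt c p (fun j => P (ψ.onJet j)) x := by
  obtain ⟨Ω', hΩ', hd', hxΩ', f, hf, hP⟩ := h
  -- Shrinking the source to the points that `τ` sends into `Ω'` puts the images where the
  -- representative `f` is valid.
  obtain ⟨B, hsrc, htgt, hτ, -, hpr⟩ := (ψ.coordMap c c').exists_restrict hΩ'
  refine ⟨B.src, B.isOpen_src, ?_, ?_, fun z => f (B.pr z), B.smOn_comp_pr (hf.subset htgt),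
    fun j hj hjΩ => ?_⟩
  · rw [hsrc]
    exact inter_subset_left.trans inter_subset_left
  · rw [hsrc]
    exact ⟨ψ.chart_mem_src hx hx', by rwa [mem_preimage, ψ.coordMap_τ_chart hx]⟩
  · rw [hsrc] at hjΩ
    have hj' : ψ.base j.base ∈ dom n m V c' := by
      have := hjΩ.1.2
      rwa [mem_preimage, symm_chart hj] at this
    have h1 := hjΩ.2
    rw [mem_preimage, ψ.coordMap_τ_chart hj] at h1
    simp only [hpr, hP (ψ.onJet j) hj' h1, ψ.jetCoord_onJet hj hj']

theorem change (hx : x ∈ dom n m V c) (hx' : x ∈ dom n m V c') (h : LocAt c' p P x) :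
    LocAt c p P x := by
  have := LocAt.comp_onJet (BundleAut.refl n m V) hx hx' h
  simpa only [BundleAut.refl_onJet] using this

end LocAt

variable [T2Space M]

theorem exists_compactSupp_jc (hx : x ∈ dom n m V c)
    {Ω : Set (EuclideanSpace ℝ (Fin n))} (hΩ : IsOpen Ω) (hxΩ : κ c x ∈ Ω)
    {u : Fin m → EuclideanSpace ℝ (Fin n) → ℝ} (hu : ∀ a, ContDiffOn ℝ ∞ (u a) Ω) :
    ∃ φ : Sec n m V, CompactSupp φ ∧ jc (secCoord c φ) (κ c x) = jc u (κ c x) := by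
  obtain ⟨η, hη, U, hU, hxU, hUs, heq⟩ := exists_testFn_eventuallyEq
    (hΩ.inter (isOpen_domCoord n m V c)) ⟨hxΩ, chart_mem hx⟩ (u := u)
    fun a => (hu a).mono inter_subset_left
  have hη' : ∀ a, IsTestFn (domCoord n m V c) (η a) := fun a => (hη a).mono inter_subset_right
  refine ⟨testSec c η hη', compactSupp_testSec hη', jc_congr hU (fun a => ?_) hxU⟩
  exact ((secCoord_testSec hη' a).mono (hUs.trans inter_subset_right)).trans (heq a)

/-- Every jet is the jet of a compactly supported section. -/
theorem exists_compactSupp_jet (j : JetBundle n m V) :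
    ∃ φ : Sec n m V, CompactSupp φ ∧ jet φ j.base = j := by
  have hx := mem_dom_self n m V j.base
  obtain ⟨φ, hφ, h⟩ := exists_compactSupp_jc hx (isOpen_domCoord n m V j.base) (chart_mem hx)
    (u := secCoord j.base j.repr) fun a => contDiffOn_secCoord _ _ a
  exact ⟨φ, hφ, (jet_eq_of_jc_eq hx h).trans (jet_repr j)⟩

/-- All values of the coordinates of finite order occur. -/
theorem exists_jet_trunc_eq (p : ℕ) (z : JetCoord n m) (hz : z.1 ∈ domCoord n m V c) :
    ∃ φ : Sec n m V, (jetCoord c (jet φ ((κ c).symm z.1))).trunc p = z.trunc p := by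
  choose u hu huI using fun a => exists_contDiff_multiPow_eq p z.1 (z.2 a)
  have hx := symm_mem_dom hz
  obtain ⟨φ, -, h⟩ := exists_compactSupp_jc hx isOpen_univ (mem_univ _) (u := u)
    fun a => (hu a).contDiffOn
  refine ⟨φ, ?_⟩
  rw [jetCoord_jet hx, h, chart_symm hz]
  exact Prod.ext rfl (funext fun a => funext fun I => huI a I I.2)

/-- Smooth functions of the coordinates that agree at all jets are equal. -/
theorem SmOn.eq_of_jets {Ω : Set (EuclideanSpace ℝ (Fin n))} {f f' : JetCoord n m → ℝ}
    (hf : SmOn Ω p f) (hf' : SmOn Ω q f') (hd : Ω ⊆ domCoord n m V c)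
    (h : ∀ j : JetBundle n m V, j.base ∈ dom n m V c → κ c j.base ∈ Ω →
      f (jetCoord c j) = f' (jetCoord c j)) {z : JetCoord n m} (hz : z.1 ∈ Ω) : f z = f' z := by
  obtain ⟨g, -, hfg⟩ := hf.mono (le_max_left p q)
  obtain ⟨g', -, hfg'⟩ := hf'.mono (le_max_right p q)
  obtain ⟨φ, hφ⟩ := exists_jet_trunc_eq (max p q) z (hd hz)
  have hx := symm_mem_dom (hd hz)
  have h1 : (jetCoord c (jet φ ((κ c).symm z.1))).1 = z.1 := chart_symm (hd hz)
  have h2 := h (jet φ ((κ c).symm z.1)) hx (by rw [← h1] at hz; exact hz)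
  rw [hfg _ (by rwa [h1]), hfg' _ (by rwa [h1]), hφ, ← hfg z hz, ← hfg' z hz] at h2
  exact h2

/-- Local smoothness in the base gives a representative over the whole bundle chart. -/
theorem exists_isRep (h : ∀ x ∈ dom n m V c, LocAt c p P x) : ∃ f, IsRep c p P f := by
  have hex : ∀ z : JetCoord n m, ∃ φ : Sec n m V, z.1 ∈ domCoord n m V c →
      (jetCoord c (jet φ ((κ c).symm z.1))).trunc p = z.trunc p := fun z => by
    by_cases hz : z.1 ∈ domCoord n m V c
    · obtain ⟨φ, hφ⟩ := exists_jet_trunc_eq p z hz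
      exact ⟨φ, fun _ => hφ⟩
    · exact ⟨0, fun h => absurd h hz⟩
  choose φ hφ using hex
  classical
  -- A representative is obtained by evaluating `P` at some jet with the given truncation; `ext`
  -- sets the coordinates of higher order to zero. The chosen jet does not matter: near each base
  -- point `P` factors through `trunc p`, so `g` agrees there with a smooth local representative.
  let ext : EuclideanSpace ℝ (Fin n) × (Fin m → {I // I ∈ multiIndexLE n p} → ℝ) → JetCoord n m :=
    fun w => (w.1, fun a I => if hI : I ∈ multiIndexLE n p then w.2 a ⟨I, hI⟩ else 0)
  have hext : ∀ w, (ext w).trunc p = w := fun w =>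
    Prod.ext rfl (funext fun a => funext fun I => dif_pos I.2)
  let g : EuclideanSpace ℝ (Fin n) × (Fin m → {I // I ∈ multiIndexLE n p} → ℝ) → ℝ :=
    fun w => P (jet (φ (ext w)) ((κ c).symm w.1))
  have key : ∀ {Ω : Set (EuclideanSpace ℝ (Fin n))} {f : JetCoord n m → ℝ}
      {g' : EuclideanSpace ℝ (Fin n) × (Fin m → {I // I ∈ multiIndexLE n p} → ℝ) → ℝ},
      Ω ⊆ domCoord n m V c → (∀ z : JetCoord n m, z.1 ∈ Ω → f z = g' (z.trunc p)) →
      (∀ j : JetBundle n m V, j.base ∈ dom n m V c → κ c j.base ∈ Ω → P j = f (jetCoord c j)) →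
      ∀ w, w.1 ∈ Ω → g w = g' w := by
    intro Ω f g' hd hf hP w hw
    have h1 : κ c ((κ c).symm w.1) ∈ Ω := by rwa [chart_symm (hd hw)]
    change P (jet (φ (ext w)) ((κ c).symm w.1)) = _
    rw [hP _ (by exact symm_mem_dom (hd hw)) (by exact h1), hf _ (by exact h1)]
    exact congrArg g' ((hφ (ext w) (hd hw)).trans (hext w))
  refine ⟨fun z => g (z.trunc p), ⟨g, fun w hw => ?_, fun _ => rfl⟩, fun j hj => ?_⟩
  · obtain ⟨Ω, hΩ, hd, hxΩ, f, ⟨g', hg', hfg'⟩, hP⟩ := h _ (symm_mem_dom hw.1)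
    rw [chart_symm hw.1] at hxΩ
    have hmem : Ω ×ˢ univ ∈ nhds w := (hΩ.prod isOpen_univ).mem_nhds ⟨hxΩ, mem_univ _⟩
    refine ((hg'.contDiffAt hmem).congr_of_eventuallyEq ?_).contDiffWithinAt
    filter_upwards [hmem] with w' hw'
    exact key hd hfg' hP w' hw'.1
  · obtain ⟨Ω, hΩ, hd, hxΩ, f, ⟨g', hg', hfg'⟩, hP⟩ := h _ hj
    rw [hP j hj hxΩ, hfg' _ (by exact hxΩ)]
    exact (key hd hfg' hP _ (by exact hxΩ)).symm

/-- With a uniform order `p`, locality may be tested near each base point in a single bundle chart.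
This reduces closure under cut-offs and pull-backs to `LocAt`. -/
theorem isLocal_iff : IsLocal P ↔ ∃ p, ∀ x, LocAt x p P x := by
  refine exists_congr fun p => ⟨fun h x => ?_, fun h c => exists_isRep fun x hx => ?_⟩
  · obtain ⟨f, hf⟩ := h x
    exact hf.locAt (mem_dom_self n m V x)
  · exact (h x).change hx (mem_dom_self n m V x)

theorem IsLocal.exists_locAt (hP : IsLocal P) : ∃ p, ∀ c x, x ∈ dom n m V c → LocAt c p P x := by
  obtain ⟨p, hp⟩ := hP
  refine ⟨p, fun c x hx => ?_⟩
  obtain ⟨f, hf⟩ := hp c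
  exact hf.locAt hx

/-- The chosen representative of a local function is smooth. -/
theorem IsLocal.rep_spec (hP : IsLocal P) (c : M) :
    ∃ p, IsRep c p P (rep c P) := by
  obtain ⟨p, hp⟩ := hP
  have h : ∃ f, ∃ p, IsRep c p P f := by
    obtain ⟨f, hf⟩ := hp c
    exact ⟨f, p, hf⟩
  rw [rep, dif_pos h]
  exact h.choose_spec

end LocAt

end

end LocalFunctionals

namespace LocalFunctionals

noncomputable section

set_option linter.unusedSectionVars false

/-! ### Top-degree forms in charts -/

section Forms

variable {n : ℕ} {M : Type*} [TopologicalSpace M] [ChartedSpace (EuclideanSpace ℝ (Fin n)) M]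

local notation "κ" => chartAt (EuclideanSpace ℝ (Fin n))

theorem alternating_comp_det (B : (EuclideanSpace ℝ (Fin n)) [⋀^Fin n]→ₗ[ℝ] ℝ)
    (L : EuclideanSpace ℝ (Fin n) →ₗ[ℝ] EuclideanSpace ℝ (Fin n)) :
    B (fun i => L (EuclideanSpace.basisFun (Fin n) ℝ i)) =
      LinearMap.det L * B (fun i => EuclideanSpace.basisFun (Fin n) ℝ i) := by
  have h1 := B.eq_smul_basis_det (EuclideanSpace.basisFun (Fin n) ℝ).toBasis
  have h2 := (EuclideanSpace.basisFun (Fin n) ℝ).toBasis.det_comp L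
    (EuclideanSpace.basisFun (Fin n) ℝ).toBasis
  rw [Module.Basis.det_self, mul_one] at h2
  have h3 := congrArg (fun C => C (fun i => L (EuclideanSpace.basisFun (Fin n) ℝ i))) h1
  simp only [AlternatingMap.smul_apply, smul_eq_mul] at h3
  have hb : ((EuclideanSpace.basisFun (Fin n) ℝ).toBasis : Fin n → EuclideanSpace ℝ (Fin n)) =
      fun i => EuclideanSpace.basisFun (Fin n) ℝ i := by
    funext i
    simp
  rw [h3, mul_comm, ← h2, hb]
  rfl

/-- The derivative of the inverse of the chart at `c`. -/
def chartD (c : M) (y : EuclideanSpace ℝ (Fin n)) :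
    EuclideanSpace ℝ (Fin n) →L[ℝ] EuclideanSpace ℝ (Fin n) :=
  mfderiv (𝓡 n) (𝓡 n) (κ c).symm y

/-- The coefficient of an `n`-form at `x` in the chart at `c`. -/
def formVal (c x : M) : TopForm n x →ₗ[ℝ] ℝ where
  toFun B := B fun i => chartD c (κ c x) (EuclideanSpace.basisFun (Fin n) ℝ i)
  map_add' _ _ := rfl
  map_smul' _ _ := rfl

theorem formVal_symm {c : M} {y : EuclideanSpace ℝ (Fin n)} (hy : y ∈ (κ c).target)
    (B : TopForm n ((κ c).symm y)) : formVal c ((κ c).symm y) B = B (coordVec c y) := by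
  change B (fun i => chartD c (κ c ((κ c).symm y)) (EuclideanSpace.basisFun (Fin n) ℝ i)) = _
  rw [(κ c).right_inv hy]
  rfl

theorem formCoeff_chart {c x : M} (hx : x ∈ (κ c).source) (ν : ∀ x : M, TopForm n x) :
    formCoeff ν c (κ c x) = formVal c x (ν x) := by
  obtain ⟨y, hy, rfl⟩ : ∃ y ∈ (κ c).target, (κ c).symm y = x :=
    ⟨κ c x, (κ c).map_source hx, (κ c).left_inv hx⟩
  rw [formVal_symm hy, (κ c).right_inv hy]
  rfl

variable [IsManifold (𝓡 n) ∞ M]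

theorem mdifferentiableAt_chart_symm {c : M} {y : EuclideanSpace ℝ (Fin n)}
    (hy : y ∈ (κ c).target) : MDifferentiableAt (𝓡 n) (𝓡 n) (κ c).symm y :=
  ((contMDiffOn_chart_symm (n := ∞) (x := c)).contMDiffAt
    ((κ c).open_target.mem_nhds hy)).mdifferentiableAt (by simp)

theorem mdifferentiableAt_chart {c x : M} (hx : x ∈ (κ c).source) :
    MDifferentiableAt (𝓡 n) (𝓡 n) (κ c) x :=
  ((contMDiffOn_chart (n := ∞) (x := c)).contMDiffAt
    ((κ c).open_source.mem_nhds hx)).mdifferentiableAt (by simp)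

theorem mfderiv_chart_comp_chartD {c x : M} (hx : x ∈ (κ c).source)
    (v : EuclideanSpace ℝ (Fin n)) :
    (mfderiv (𝓡 n) (𝓡 n) (κ c) x : EuclideanSpace ℝ (Fin n) →L[ℝ] EuclideanSpace ℝ (Fin n))
      (chartD c (κ c x) v) = v := by
  obtain ⟨y, hy, rfl⟩ : ∃ y ∈ (κ c).target, (κ c).symm y = x :=
    ⟨κ c x, (κ c).map_source hx, (κ c).left_inv hx⟩
  have h1 := mfderiv_comp y (mdifferentiableAt_chart hx) (mdifferentiableAt_chart_symm hy)
  have h2 : (κ c) ∘ (κ c).symm =ᶠ[nhds y] id :=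
    Filter.eventuallyEq_of_mem ((κ c).open_target.mem_nhds hy) fun y hy => (κ c).right_inv hy
  rw [h2.mfderiv_eq, mfderiv_id] at h1
  rw [(κ c).right_inv hy]
  exact (congrArg (fun L : EuclideanSpace ℝ (Fin n) →L[ℝ] EuclideanSpace ℝ (Fin n) => L v) h1).symm

theorem det_chartD_ne_zero {c x : M} (hx : x ∈ (κ c).source) :
    LinearMap.det (chartD c (κ c x)).toLinearMap ≠ 0 := by
  have key : ∀ A B : EuclideanSpace ℝ (Fin n) →L[ℝ] EuclideanSpace ℝ (Fin n),
      (∀ v, A (B v) = v) → LinearMap.det B.toLinearMap ≠ 0 := by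
    intro A B h
    have h1 := congrArg LinearMap.det
      (show A.toLinearMap ∘ₗ B.toLinearMap = LinearMap.id from LinearMap.ext h)
    rw [LinearMap.det_comp, LinearMap.det_id] at h1
    exact right_ne_zero_of_mul_eq_one h1
  exact key _ _ (mfderiv_chart_comp_chartD hx)

theorem formVal_eq (c x : M) (B : TopForm n x) :
    formVal c x B = LinearMap.det (chartD c (κ c x)).toLinearMap *
      B (fun i => EuclideanSpace.basisFun (Fin n) ℝ i) :=
  alternating_comp_det (show (EuclideanSpace ℝ (Fin n)) [⋀^Fin n]→ₗ[ℝ] ℝ from B)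
    (chartD c (κ c x)).toLinearMap

/-- Top-degree forms are a line, so one basis decides. `TangentSpace` unfolds to the model space,
which allows the standard basis to be used at every point, independently of charts. -/
theorem topForm_ext {x : M} {B B' : TopForm n x}
    (h : B (fun i => EuclideanSpace.basisFun (Fin n) ℝ i) =
      B' (fun i => EuclideanSpace.basisFun (Fin n) ℝ i)) : B = B' := by
  have key : ∀ C : (EuclideanSpace ℝ (Fin n)) [⋀^Fin n]→ₗ[ℝ] ℝ,
      C = C (fun i => EuclideanSpace.basisFun (Fin n) ℝ i) •
        (EuclideanSpace.basisFun (Fin n) ℝ).toBasis.det := by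
    intro C
    have h1 := C.eq_smul_basis_det (EuclideanSpace.basisFun (Fin n) ℝ).toBasis
    have h2 : (fun i => EuclideanSpace.basisFun (Fin n) ℝ i) =
        ((EuclideanSpace.basisFun (Fin n) ℝ).toBasis : Fin n → EuclideanSpace ℝ (Fin n)) := by
      funext i; simp
    rw [h2]
    exact h1
  exact (key B).trans ((congrArg (fun r : ℝ => r •
    (EuclideanSpace.basisFun (Fin n) ℝ).toBasis.det) h).trans (key B').symm)

theorem formVal_injective {c x : M} (hx : x ∈ (κ c).source) :
    Function.Injective (formVal (n := n) c x) := by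
  intro B B' h
  rw [formVal_eq, formVal_eq] at h
  exact topForm_ext (mul_left_cancel₀ (det_chartD_ne_zero hx) h)

theorem formVal_coordForm {c x : M} (hx : x ∈ (κ c).source) :
    formVal (n := n) c x (coordForm c x) = 1 := by
  change (EuclideanSpace.basisFun (Fin n) ℝ).toBasis.det (fun i =>
    (mfderiv (𝓡 n) (𝓡 n) (κ c) x : EuclideanSpace ℝ (Fin n) →L[ℝ] EuclideanSpace ℝ (Fin n))
      (chartD c (κ c x) (EuclideanSpace.basisFun (Fin n) ℝ i))) = 1
  simp only [mfderiv_chart_comp_chartD hx]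
  rw [← (EuclideanSpace.basisFun (Fin n) ℝ).toBasis.det_self]
  congr 1

theorem topForm_eq_smul {c x : M} (hx : x ∈ (κ c).source) (B : TopForm n x) :
    B = formVal c x B • coordForm c x := by
  refine formVal_injective hx ?_
  rw [map_smul, formVal_coordForm hx, smul_eq_mul, mul_one]

/-- A diffeomorphism in the charts at `c` and `c'`. -/
def transition (f : M → M) (c c' : M) (y : EuclideanSpace ℝ (Fin n)) : EuclideanSpace ℝ (Fin n) :=
  κ c' (f ((κ c).symm y))

theorem mfderiv_chartD {f : M → M} (hf : ContMDiff (𝓡 n) (𝓡 n) ∞ f) {c c' x : M}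
    (hx : x ∈ (κ c).source) (hx' : f x ∈ (κ c').source) (v : EuclideanSpace ℝ (Fin n)) :
    (mfderiv (𝓡 n) (𝓡 n) f x : EuclideanSpace ℝ (Fin n) →L[ℝ] EuclideanSpace ℝ (Fin n))
      (chartD c (κ c x) v) =
      chartD c' (κ c' (f x)) (fderiv ℝ (transition f c c') (κ c x) v) := by
  obtain ⟨y, hy, rfl⟩ : ∃ y ∈ (κ c).target, (κ c).symm y = x :=
    ⟨κ c x, (κ c).map_source hx, (κ c).left_inv hx⟩
  have hopen := isOpen_transition (n := n) hf.continuous c c'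
  have hyo : y ∈ (κ c).target ∩ (fun y => f ((κ c).symm y)) ⁻¹' (κ c').source := ⟨hy, hx'⟩
  have hτ : DifferentiableAt ℝ (transition f c c') y :=
    (contDiffOn_transition hf c c').differentiableAt_of_isOpen hopen hyo
  have h1 := mfderiv_comp y (hf.mdifferentiableAt (x := (κ c).symm y) (by simp))
    (mdifferentiableAt_chart_symm hy)
  have hτy : transition f c c' y ∈ (κ c').target := (κ c').map_source hx'
  have h2 := mfderiv_comp y (mdifferentiableAt_chart_symm hτy) hτ.mdifferentiableAt
  have h3 : f ∘ (κ c).symm =ᶠ[nhds y] (κ c').symm ∘ transition f c c' :=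
    Filter.eventuallyEq_of_mem (hopen.mem_nhds hyo) fun y hy => ((κ c').left_inv hy.2).symm
  rw [h3.mfderiv_eq] at h1
  have h4 := h1.symm.trans h2
  rw [(κ c).right_inv hy]
  have h5 := congrArg (fun L : EuclideanSpace ℝ (Fin n) →L[ℝ] EuclideanSpace ℝ (Fin n) => L v) h4
  rw [mfderiv_eq_fderiv] at h5
  exact h5

theorem formVal_pullbackForm {f : M → M} (hf : ContMDiff (𝓡 n) (𝓡 n) ∞ f) {c c' x : M}
    (hx : x ∈ (κ c).source) (hx' : f x ∈ (κ c').source) (B : TopForm n (f x)) :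
    formVal c x (pullbackForm f x B) =
      (fderiv ℝ (transition f c c') (κ c x)).det * formVal c' (f x) B := by
  change (show (EuclideanSpace ℝ (Fin n)) [⋀^Fin n]→ₗ[ℝ] ℝ from B) (fun i =>
    (mfderiv (𝓡 n) (𝓡 n) f x : EuclideanSpace ℝ (Fin n) →L[ℝ] EuclideanSpace ℝ (Fin n))
      (chartD c (κ c x) (EuclideanSpace.basisFun (Fin n) ℝ i))) = _
  simp only [mfderiv_chartD hf hx hx']
  exact alternating_comp_det ((show (EuclideanSpace ℝ (Fin n)) [⋀^Fin n]→ₗ[ℝ] ℝ from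
    B).compLinearMap (chartD c' (κ c' (f x))).toLinearMap)
    (fderiv ℝ (transition f c c') (κ c x)).toLinearMap

namespace VolumeForm

variable (ν : VolumeForm n M)

theorem form_basis_ne_zero (x : M) :
    ν.form x (fun i => EuclideanSpace.basisFun (Fin n) ℝ i) ≠ 0 := fun h =>
  ν.ne_zero x (topForm_ext h)

theorem formVal_ne_zero {c x : M} (hx : x ∈ (κ c).source) : formVal c x (ν.form x) ≠ 0 := by
  rw [formVal_eq]
  exact mul_ne_zero (det_chartD_ne_zero hx) (ν.form_basis_ne_zero x)

/-- `det` is a quotient of values on the standard basis; since top-degree forms are a line, the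
relation extends to all vectors. -/
theorem pullbackForm_eq (f : M → M) (x : M) :
    pullbackForm f x (ν.form (f x)) = ν.det f x • ν.form x := by
  refine topForm_ext ?_
  change _ = ν.det f x * ν.form x (fun i => EuclideanSpace.basisFun (Fin n) ℝ i)
  rw [VolumeForm.det]
  exact (div_mul_cancel₀ _ (ν.form_basis_ne_zero x)).symm

/-- Both sides are the coefficient of `f^* ν` in the chart at `c`. This is what converts `det` into
the coordinate Jacobian. -/
theorem det_mul_formCoeff {f : M → M} (hf : ContMDiff (𝓡 n) (𝓡 n) ∞ f) {c c' x : M}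
    (hx : x ∈ (κ c).source) (hx' : f x ∈ (κ c').source) :
    ν.det f x * formCoeff ν.form c (κ c x) =
      (fderiv ℝ (transition f c c') (κ c x)).det * formCoeff ν.form c' (κ c' (f x)) := by
  rw [formCoeff_chart hx, formCoeff_chart hx', ← formVal_pullbackForm hf hx hx', pullbackForm_eq,
    map_smul, smul_eq_mul]

theorem formCoeff_ne_zero {c : M} {y : EuclideanSpace ℝ (Fin n)} (hy : y ∈ (κ c).target) :
    formCoeff ν.form c y ≠ 0 := by
  have := ν.formVal_ne_zero ((κ c).map_target hy)
  rwa [← formCoeff_chart ((κ c).map_target hy), (κ c).right_inv hy] at this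

end VolumeForm

end Forms

end

end LocalFunctionals

namespace LocalFunctionals

noncomputable section

set_option linter.unusedSectionVars false

/-! ### Source forms and their coefficients in bundle charts -/

section SourceForms

variable {n m : ℕ} {M : Type*} [TopologicalSpace M] [ChartedSpace (EuclideanSpace ℝ (Fin n)) M]
  {V : M → Type*} [TopologicalSpace (TotalSpace (EuclideanSpace ℝ (Fin m)) V)]
  [∀ x, AddCommGroup (V x)] [∀ x, Module ℝ (V x)] [∀ x, TopologicalSpace (V x)]
  [FiberBundle (EuclideanSpace ℝ (Fin m)) V]
variable [IsManifold (𝓡 n) ∞ M] [VectorBundle ℝ (EuclideanSpace ℝ (Fin m)) V]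
  [ContMDiffVectorBundle ∞ (EuclideanSpace ℝ (Fin m)) V (𝓡 n)]

local notation "κ" => chartAt (EuclideanSpace ℝ (Fin n))

/-- The vertical coordinate vector `∂/∂u^a` of the bundle chart at `c`. -/
def fiberVec (V : M → Type*) [TopologicalSpace (TotalSpace (EuclideanSpace ℝ (Fin m)) V)]
    [∀ x, AddCommGroup (V x)] [∀ x, Module ℝ (V x)] [∀ x, TopologicalSpace (V x)]
    [FiberBundle (EuclideanSpace ℝ (Fin m)) V] (c x : M) (a : Fin m) : V x :=
  (triv m V c).symm x (EuclideanSpace.basisFun (Fin m) ℝ a)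

/-- The coefficient `f_a` of `∑ f_a θ^a ∧ d^n x` in the bundle chart at `c`. -/
def coef (c : M) (α : FormFamily n m V) (a : Fin m) (j : JetBundle n m V) : ℝ :=
  formVal c j.base (α j (fiberVec V c j.base a))

variable {c c' x : M} {p : ℕ} {α β : FormFamily n m V}

theorem linearMapAt_fiberVec (hx : x ∈ dom n m V c) (a : Fin m) :
    (triv m V c).linearMapAt ℝ x (fiberVec V c x a) = EuclideanSpace.basisFun (Fin m) ℝ a :=
  (triv m V c).linearMapAt_symm hx.2 _

theorem sum_fiberVec (hx : x ∈ dom n m V c) (v : V x) :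
    v = ∑ a, (triv m V c).linearMapAt ℝ x v a • fiberVec V c x a := by
  have h1 := (EuclideanSpace.basisFun (Fin m) ℝ).sum_repr ((triv m V c).linearMapAt ℝ x v)
  refine ((triv m V c).symmₗ_linearMapAt (R := ℝ) hx.2 v).symm.trans
    ((congrArg ((triv m V c).symmₗ ℝ x) h1.symm).trans ?_)
  rw [map_sum]
  refine Finset.sum_congr rfl fun a _ => ?_
  rw [map_smul, EuclideanSpace.basisFun_repr]
  exact congrArg _ ((triv m V c).symmₗ_apply hx.2 _)

theorem formVal_sum_smul (B : V x →ₗ[ℝ] TopForm n x) (r : Fin m → ℝ) :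
    formVal c x (B (∑ a, r a • fiberVec V c x a)) =
      ∑ a, formVal c x (B (fiberVec V c x a)) * r a := by
  rw [map_sum, map_sum]
  refine Finset.sum_congr rfl fun a _ => ?_
  rw [map_smul, map_smul, smul_eq_mul, mul_comm]

theorem continuousLinearEquivAt_symm_eq (hx : x ∈ (triv m V c).baseSet)
    (w : EuclideanSpace ℝ (Fin m)) :
    ((triv m V c).continuousLinearEquivAt ℝ x hx).symm w = (triv m V c).symm x w := rfl

theorem linearMapAt_eq (hx : x ∈ (triv m V c).baseSet) (v : V x) :
    (triv m V c).linearMapAt ℝ x v = (triv m V c).continuousLinearEquivAt ℝ x hx v := by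
  rw [(triv m V c).coe_linearMapAt_of_mem hx]
  rfl

theorem contactWedge_apply (c : M) (a : Fin m) (B : ∀ x : M, TopForm n x) (j : JetBundle n m V)
    (v : V j.base) :
    contactWedge c a B j v = (triv m V c).linearMapAt ℝ j.base v a • B j.base := rfl

/-- Two linear maps to the `n`-forms with the same coefficients are equal. -/
theorem ext_coef {j : JetBundle n m V} (hj : j.base ∈ dom n m V c)
    (h : ∀ a, coef c α a j = coef c β a j) : α j = β j := by
  refine LinearMap.ext fun v => ?_
  rw [sum_fiberVec hj v, map_sum, map_sum]
  refine Finset.sum_congr rfl fun a _ => ?_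
  rw [map_smul, map_smul]
  exact congrArg _ (formVal_injective hj.1 (h a))

theorem coef_contactWedge {j : JetBundle n m V} (hj : j.base ∈ dom n m V c) (a b : Fin m)
    (B : ∀ x : M, TopForm n x) :
    formVal c j.base (contactWedge c a B j (fiberVec V c j.base b)) =
      if a = b then formVal c j.base (B j.base) else 0 := by
  rw [contactWedge_apply, linearMapAt_fiberVec hj, map_smul, smul_eq_mul]
  simp

theorem coef_of_eq_sum {j : JetBundle n m V} (hj : j.base ∈ dom n m V c) {A : Fin m → ℝ}
    (h : α j = ∑ a, A a • contactWedge c a (coordForm c) j) (b : Fin m) : coef c α b j = A b := by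
  rw [coef, h, LinearMap.sum_apply, map_sum, Finset.sum_eq_single b]
  · rw [LinearMap.smul_apply, map_smul, coef_contactWedge hj, if_pos rfl,
      formVal_coordForm hj.1, smul_eq_mul, mul_one]
  · intro a _ ha
    rw [LinearMap.smul_apply, map_smul, coef_contactWedge hj, if_neg ha, smul_zero]
  · simp

theorem eq_sum_coef {j : JetBundle n m V} (hj : j.base ∈ dom n m V c) (α : FormFamily n m V) :
    α j = ∑ a, coef c α a j • contactWedge c a (coordForm c) j :=
  ext_coef (c := c) (β := fun j => ∑ a, coef c α a j • contactWedge c a (coordForm c) j) hj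
    fun a => (coef_of_eq_sum (A := fun a => coef c α a j)
      (α := fun j => ∑ a, coef c α a j • contactWedge c a (coordForm c) j) hj rfl a).symm

theorem IsSourceForm.exists_locAt (hα : IsSourceForm α) :
    ∃ p, ∀ c x, x ∈ dom n m V c → ∀ a, LocAt c p (coef c α a) x := by
  obtain ⟨p, hp⟩ := hα
  refine ⟨p, fun c x hx a => ?_⟩
  obtain ⟨A, hA, hα⟩ := hp c
  obtain ⟨f, hf⟩ := hA a
  exact (hf.locAt hx).congr hx ((isOpen_dom n m V c).mem_nhds hx)
    fun j hj => coef_of_eq_sum hj (hα j hj) a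

theorem isSourceForm_of_locAt [T2Space M]
    (h : ∃ p, ∀ c x, x ∈ dom n m V c → ∀ a, LocAt c p (coef c α a) x) : IsSourceForm α := by
  obtain ⟨p, hp⟩ := h
  exact ⟨p, fun c => ⟨coef c α, fun a => exists_isRep fun x hx => hp c x hx a,
    fun j hj => eq_sum_coef hj α⟩⟩

/-! ### Change of charts and pull-backs -/

namespace BundleAut

variable (ψ : BundleAut n m V)

/-- Changing the bundle charts composes the fiber map with linear isomorphisms on both sides. By the
chain rule `vertD`, defined in the charts centered at the base points, is then computed in any pair
of charts. -/
theorem fiberCoord_eq (hx : x ∈ dom n m V c) (hx' : ψ.base x ∈ dom n m V c') {c₀ c₀' : M}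
    (h₀ : x ∈ dom n m V c₀) (h₀' : ψ.base x ∈ dom n m V c₀') :
    ψ.fiberCoord c c' x =
      (((triv m V c₀').continuousLinearEquivAt ℝ _ h₀'.2).symm.trans
        ((triv m V c').continuousLinearEquivAt ℝ _ hx'.2)) ∘ ψ.fiberCoord c₀ c₀' x ∘
      (((triv m V c).continuousLinearEquivAt ℝ _ hx.2).symm.trans
        ((triv m V c₀).continuousLinearEquivAt ℝ _ h₀.2)) := by
  funext w
  simp only [Function.comp, ContinuousLinearEquiv.trans_apply, fiberCoord]
  have h1 : (triv m V c₀).symm x ((triv m V c₀).continuousLinearEquivAt ℝ x h₀.2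
      (((triv m V c).continuousLinearEquivAt ℝ x hx.2).symm w)) = (triv m V c).symm x w := by
    refine (continuousLinearEquivAt_symm_eq h₀.2 _).symm.trans ?_
    exact (ContinuousLinearEquiv.symm_apply_apply _ _).trans (continuousLinearEquivAt_symm_eq hx.2 w)
  rw [h1]
  -- Once the image point is generalized, its base point is a variable, which can be replaced by
  -- `ψ.base x`.
  obtain ⟨q, hq⟩ : ∃ q : TotalSpace (EuclideanSpace ℝ (Fin m)) V,
      ψ.toDiffeo ⟨x, (triv m V c).symm x w⟩ = q := ⟨_, rfl⟩
  have hqx : q.proj = ψ.base x := by rw [← hq, ψ.proj_eq]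
  rw [hq]
  obtain ⟨y, v⟩ := q
  change y = _ at hqx
  subst hqx
  have h2 : (triv m V c₀' ⟨ψ.base x, v⟩).2 =
      (triv m V c₀').continuousLinearEquivAt ℝ _ h₀'.2 v := rfl
  rw [h2, ContinuousLinearEquiv.symm_apply_apply]
  rfl

/-- The vertical derivative of `ψ` in arbitrary bundle charts. -/
theorem vertD_eq {j : JetBundle n m V} (hx : j.base ∈ dom n m V c)
    (hx' : ψ.base j.base ∈ dom n m V c') (v : V j.base) :
    (triv m V c').linearMapAt ℝ (ψ.base j.base) (ψ.vertD j v) =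
      fderiv ℝ (ψ.fiberCoord c c' j.base) (triv m V c ⟨j.base, j.val⟩).2
        ((triv m V c).linearMapAt ℝ j.base v) := by
  have h₀ := mem_dom_self n m V j.base
  have h₀' := mem_dom_self n m V (ψ.base j.base)
  rw [ψ.fiberCoord_eq hx hx' h₀ h₀', ContinuousLinearEquiv.comp_fderiv,
    ContinuousLinearEquiv.comp_right_fderiv]
  refine (linearMapAt_eq hx'.2 _).trans ?_
  have h1 : ψ.vertD j v = (triv m V (ψ.base j.base)).symm (ψ.base j.base)
      (fderiv ℝ (ψ.fiberCoord j.base (ψ.base j.base) j.base)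
        ((triv m V j.base).continuousLinearEquivAt ℝ _ h₀.2 j.val)
        ((triv m V j.base).linearMapAt ℝ j.base v)) :=
    (triv m V (ψ.base j.base)).symmₗ_apply h₀'.2 _
  have h2 : (triv m V c ⟨j.base, j.val⟩).2 =
      (triv m V c).continuousLinearEquivAt ℝ _ hx.2 j.val := rfl
  refine (congrArg ((triv m V c').continuousLinearEquivAt ℝ _ hx'.2) h1).trans ?_
  rw [h2, linearMapAt_eq hx.2, linearMapAt_eq h₀.2]
  simp only [ContinuousLinearMap.comp_apply, ContinuousLinearEquiv.coe_coe,
    ContinuousLinearEquiv.trans_apply, ContinuousLinearEquiv.symm_apply_apply]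
  rfl

theorem vertD_fiberVec {j : JetBundle n m V} (hx : j.base ∈ dom n m V c)
    (hx' : ψ.base j.base ∈ dom n m V c') (b : Fin m) :
    ψ.vertD j (fiberVec V c j.base b) =
      ∑ a, ψ.partialPsi c c' j a b • fiberVec V c' (ψ.base j.base) a := by
  refine (sum_fiberVec hx' _).trans (Finset.sum_congr rfl fun a _ => ?_)
  rw [ψ.vertD_eq hx hx', linearMapAt_fiberVec hx]
  rfl

/-- The Jacobian comes from the `n`-form, the matrix `∂ψ^a/∂u^b` from the contact form. -/
theorem coef_pullback {j : JetBundle n m V} (hx : j.base ∈ dom n m V c)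
    (hx' : ψ.base j.base ∈ dom n m V c') (α : FormFamily n m V) (b : Fin m) :
    coef c (ψ.pullback α) b j = (ψ.coordMap c c').jac (κ c j.base) *
      ∑ a, coef c' α a (ψ.onJet j) * ψ.partialPsi c c' j a b := by
  change formVal c j.base (pullbackForm ψ.base j.base
    (α (ψ.onJet j) (ψ.vertD j (fiberVec V c j.base b)))) = _
  refine (formVal_pullbackForm ψ.base.contMDiff hx.1 hx'.1 _).trans (congrArg _ ?_)
  refine (congrArg (fun v => formVal c' (ψ.base j.base) (α (ψ.onJet j) v))
    (ψ.vertD_fiberVec hx hx' b)).trans ?_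
  exact formVal_sum_smul (α (ψ.onJet j)) _

/-- Links the fiber derivative that defines the pull-back to the coefficient `∂Φ^a/∂u^b` in
`CoordMap.eulerCoord_pr`. -/
theorem partialPsi_eq {j : JetBundle n m V} (hx : j.base ∈ dom n m V c)
    (hx' : ψ.base j.base ∈ dom n m V c') (a b : Fin m) :
    ψ.partialPsi c c' j a b = partialU b 0 ((ψ.coordMap c c').Φ a) (jetCoord c j) := by
  have h1 := (ψ.contDiffOn_fiberCoord c c').differentiableAt_of_isOpen
    ((ψ.isOpen_coordSrc c c').prod isOpen_univ)
    (x := (κ c j.base, (triv m V c ⟨j.base, j.val⟩).2)) ⟨ψ.chart_mem_src hx hx', mem_univ _⟩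
  have h2 : DifferentiableAt ℝ (ψ.fiberCoord c c' j.base) (triv m V c ⟨j.base, j.val⟩).2 := by
    have := h1.comp (triv m V c ⟨j.base, j.val⟩).2 (f := fun w => (κ c j.base, w))
      ((differentiableAt_const _).prodMk differentiableAt_id)
    simpa only [Function.comp_def, symm_chart hx] using this
  have h3 := (h2.hasFDerivAt.hasLineDerivAt (EuclideanSpace.basisFun (Fin m) ℝ b))
  have h4 := (EuclideanSpace.proj (𝕜 := ℝ) a).hasFDerivAt.comp_hasDerivAt (0 : ℝ) h3
  change HasDerivAt _ (fderiv ℝ (ψ.fiberCoord c c' j.base) (triv m V c ⟨j.base, j.val⟩).2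
    (EuclideanSpace.basisFun (Fin m) ℝ b) a) _ at h4
  rw [partialPsi, ← h4.deriv, partialU]
  congr 1
  funext t
  change _ = ψ.fiberCoord c c' ((κ c).symm (κ c j.base)) _ a
  rw [symm_chart hx]
  refine congrArg (fun w => ψ.fiberCoord c c' j.base w a) ?_
  refine (congrArg (fun v : EuclideanSpace ℝ (Fin m) => v +
    t • EuclideanSpace.basisFun (Fin m) ℝ b) (toLp_secCoord hx j.repr).symm).trans ?_
  ext b'
  have h5 : (jetCoord c j).2 b' 0 = secCoord c j.repr b' (κ c j.base) := by
    simp only [jetCoord, multiPow_zero]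
  by_cases hb : b' = b
  · subst hb
    simp [h5]
  · simp [h5, hb]

theorem locAt_partialPsi (hx : x ∈ dom n m V c) (hx' : ψ.base x ∈ dom n m V c') (a b : Fin m) :
    LocAt c 0 (fun j => ψ.partialPsi c c' j a b) x := by
  refine ⟨(ψ.coordMap c c').src, (ψ.coordMap c c').isOpen_src, inter_subset_left,
    ψ.chart_mem_src hx hx', _, ((ψ.coordMap c c').smooth_Φ a).partialU
      (ψ.coordMap c c').isOpen_src b 0, fun j hj hjΩ => ψ.partialPsi_eq hj ?_ a b⟩
  have := hjΩ.2
  rwa [mem_preimage, symm_chart hj] at this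

theorem locAt_jac (hx : x ∈ dom n m V c) (hx' : ψ.base x ∈ dom n m V c') :
    LocAt c p (fun j : JetBundle n m V => (ψ.coordMap c c').jac (κ c j.base)) x :=
  LocAt.of_base (h := fun x => (ψ.coordMap c c').jac (κ c x)) (ψ.coordMap c c').isOpen_src
    inter_subset_left (ψ.chart_mem_src hx hx') CoordMap.contDiffOn_jac fun _ _ _ => rfl

theorem locAt_coef_pullback {a : Fin m} (hx : x ∈ dom n m V c)
    (hx' : ψ.base x ∈ dom n m V c') (h : ∀ a, LocAt c' p (coef c' α a) (ψ.base x)) :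
    LocAt c p (coef c (ψ.pullback α) a) x := by
  refine LocAt.congr ((ψ.locAt_jac hx hx').mul (LocAt.sum (s := Finset.univ) hx fun b _ =>
    ((h b).comp_onJet ψ hx hx').mul ((ψ.locAt_partialPsi hx hx' b a).mono p.zero_le))) hx
    (((isOpen_dom n m V c).inter ((isOpen_dom n m V c').preimage ψ.base.continuous)).mem_nhds
      ⟨hx, hx'⟩) fun j hj => ψ.coef_pullback hj.1 hj.2 α a

theorem isSourceForm_pullback [T2Space M] (hα : IsSourceForm α) : IsSourceForm (ψ.pullback α) := by
  obtain ⟨p, hp⟩ := hα.exists_locAt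
  exact isSourceForm_of_locAt ⟨p, fun c x hx a =>
    ψ.locAt_coef_pullback hx (mem_dom_self n m V (ψ.base x)) fun b =>
      hp _ _ (mem_dom_self n m V (ψ.base x)) b⟩

theorem refl_pullback (α : FormFamily n m V) : (BundleAut.refl n m V).pullback α = α := by
  funext j
  refine LinearMap.ext fun v => ?_
  have h1 : (BundleAut.refl n m V).vertD j v = v := by
    have hx := mem_dom_self n m V j.base
    have h2 := (BundleAut.refl n m V).vertD_eq hx (c' := j.base) hx v
    have h3 : (BundleAut.refl n m V).fiberCoord j.base j.base j.base = id := by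
      funext w
      change (triv m V j.base ⟨j.base, (triv m V j.base).symm j.base w⟩).2 = w
      rw [(triv m V j.base).apply_mk_symm hx.2]
    rw [h3, fderiv_id] at h2
    have h4 := congrArg ((triv m V j.base).symmₗ ℝ j.base) h2
    exact ((triv m V j.base).symmₗ_linearMapAt hx.2 _).symm.trans
      (h4.trans ((triv m V j.base).symmₗ_linearMapAt hx.2 _))
  have h5 : ∀ B : TopForm n j.base, pullbackForm (BundleAut.refl n m V).base j.base B = B := by
    intro B
    refine AlternatingMap.ext fun w => ?_
    change B (fun i => mfderiv (𝓡 n) (𝓡 n) id j.base (w i)) = B w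
    rw [mfderiv_id]
    rfl
  have h6 : ∀ v : V j.base, α ((BundleAut.refl n m V).onJet j) v = α j v := by
    intro v
    have h7 := BundleAut.refl_onJet j
    obtain ⟨x, q⟩ := j
    -- The two jets are equal only propositionally, while `v` lives over their base point. With the
    -- base point fixed, only the class in the quotient has to be rewritten.
    have key : ∀ (q' : Quotient (jetSetoid n m V x)),
        (⟨x, q'⟩ : JetBundle n m V) = ⟨x, q⟩ → α ⟨x, q'⟩ v = α ⟨x, q⟩ v := by
      intro q' hq
      have := eq_of_heq (Sigma.mk.inj hq).2
      subst this
      rfl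
    exact key _ h7
  change pullbackForm (BundleAut.refl n m V).base j.base
    (α ((BundleAut.refl n m V).onJet j) ((BundleAut.refl n m V).vertD j v)) = _
  rw [h1]
  exact (h5 _).trans (h6 v)

end BundleAut

end SourceForms

end

end LocalFunctionals

namespace LocalFunctionals

noncomputable section

set_option linter.unusedSectionVars false

/-! ### The Euler-Lagrange form: chart independence and naturality -/

section Euler

variable {n m : ℕ} {M : Type*} [TopologicalSpace M] [ChartedSpace (EuclideanSpace ℝ (Fin n)) M]
  {V : M → Type*} [TopologicalSpace (TotalSpace (EuclideanSpace ℝ (Fin m)) V)]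
  [∀ x, AddCommGroup (V x)] [∀ x, Module ℝ (V x)] [∀ x, TopologicalSpace (V x)]
  [FiberBundle (EuclideanSpace ℝ (Fin m)) V]

variable [IsManifold (𝓡 n) ∞ M] [VectorBundle ℝ (EuclideanSpace ℝ (Fin m)) V]
  [ContMDiffVectorBundle ∞ (EuclideanSpace ℝ (Fin m)) V (𝓡 n)] [T2Space M]

local notation "κ" => chartAt (EuclideanSpace ℝ (Fin n))

/-- The coefficient of `P ν` with respect to `d^n x` in the bundle chart at `c`. -/
def lagr (ν : VolumeForm n M) (c : M) (P : JetBundle n m V → ℝ) (z : JetCoord n m) : ℝ :=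
  formCoeff ν.form c z.1 * rep c P z

variable {ν : VolumeForm n M} {c c' x : M} {p : ℕ} {P P' : JetBundle n m V → ℝ}

theorem IsLocal.rep_jetCoord (hP : IsLocal P) {j : JetBundle n m V} (hj : j.base ∈ dom n m V c) :
    rep c P (jetCoord c j) = P j := by
  obtain ⟨p, hp⟩ := hP.rep_spec c
  exact (hp.2 j hj).symm

theorem contDiffOn_formCoeff (ν : VolumeForm n M) (c : M) :
    ContDiffOn ℝ ∞ (formCoeff ν.form c) (domCoord n m V c) :=
  (ν.smooth c).mono inter_subset_left

theorem IsLocal.smOn_lagr (hP : IsLocal P) (ν : VolumeForm n M) (c : M) :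
    ∃ p, SmOn (domCoord n m V c) p (lagr ν c P) := by
  obtain ⟨p, hp⟩ := hP.rep_spec c
  exact ⟨p, (SmOn.base (contDiffOn_formCoeff ν c)).mul hp.smOn⟩

/-- The Euler operator can be computed with any representative. -/
theorem IsLocal.eulerCoord_lagr (hP : IsLocal P) {Ω : Set (EuclideanSpace ℝ (Fin n))}
    (hΩ : IsOpen Ω) (hd : Ω ⊆ domCoord n m V c) {f : JetCoord n m → ℝ} (hf : SmOn Ω p f)
    (h : ∀ j : JetBundle n m V, j.base ∈ dom n m V c → κ c j.base ∈ Ω → P j = f (jetCoord c j))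
    (a : Fin m) {z : JetCoord n m} (hz : z.1 ∈ Ω) :
    eulerCoord a (lagr ν c P) z = eulerCoord a (fun z => formCoeff ν.form c z.1 * f z) z := by
  obtain ⟨q, hq⟩ := hP.rep_spec c
  refine eulerCoord_congr hΩ (fun z hz =>
    congrArg (formCoeff ν.form c z.1 * ·) ?_) a hz
  refine SmOn.eq_of_jets (hq.smOn.subset hd) hf hd (fun j hj hjΩ => ?_) hz
  rw [hP.rep_jetCoord hj, h j hj hjΩ]

namespace BundleAut

variable (ψ : BundleAut n m V)

theorem det_mul_formCoeff (hx : x ∈ dom n m V c) (hx' : ψ.base x ∈ dom n m V c') :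
    ν.det ψ.base x * formCoeff ν.form c (κ c x) =
      (ψ.coordMap c c').jac (κ c x) * formCoeff ν.form c' (κ c' (ψ.base x)) :=
  ν.det_mul_formCoeff ψ.base.contMDiff hx.1 hx'.1

theorem locAt_det (hx : x ∈ dom n m V c) :
    LocAt c p (fun j : JetBundle n m V => ν.det ψ.base j.base) x := by
  have hx' := mem_dom_self n m V (ψ.base x)
  set A := ψ.coordMap c (ψ.base x)
  have hsub : A.src ⊆ domCoord n m V c := inter_subset_left
  refine LocAt.of_base (h := fun x => ν.det ψ.base x)
    (g := fun y => A.jac y * formCoeff ν.form (ψ.base x) (A.τ y) / formCoeff ν.form c y)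
    A.isOpen_src hsub (ψ.chart_mem_src hx hx') ?_ fun z hz hzA => ?_
  · refine (CoordMap.contDiffOn_jac.mul (((ν.smooth (ψ.base x)).mono ?_).comp A.smooth_τ A.mapsTo)).div
      ((contDiffOn_formCoeff ν c).mono hsub) fun y hy => ν.formCoeff_ne_zero (hsub hy).1
    exact fun y hy => hy.1.1
  · have hz' : ψ.base z ∈ dom n m V (ψ.base x) := by
      have := hzA.2
      rwa [mem_preimage, symm_chart hz] at this
    rw [eq_div_iff (ν.formCoeff_ne_zero (chart_mem hz).1), ψ.det_mul_formCoeff hz hz',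
      ψ.coordMap_τ_chart hz]

/-- The pull-back of `P ν` is `P' ν` with the local function `P' = (det ψ_M) (P ∘ jψ)`. -/
theorem isLocal_det_mul (hP : IsLocal P) :
    IsLocal fun j => ν.det ψ.base j.base * P (ψ.onJet j) := by
  obtain ⟨p, hp⟩ := hP.exists_locAt
  refine isLocal_iff.2 ⟨p, fun x => ?_⟩
  have hx' := mem_dom_self n m V (ψ.base x)
  exact (ψ.locAt_det (mem_dom_self n m V x)).mul
    ((hp _ _ hx').comp_onJet ψ (mem_dom_self n m V x) hx')

/-- The Euler operator of the pull-back of `P ν`. -/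
theorem eulerCoord_lagr (hP : IsLocal P) (hP' : IsLocal P')
    (h : ∀ j, P' j = ν.det ψ.base j.base * P (ψ.onJet j)) {j : JetBundle n m V}
    (hx : j.base ∈ dom n m V c) (hx' : ψ.base j.base ∈ dom n m V c') (b : Fin m) :
    eulerCoord b (lagr ν c P') (jetCoord c j) = (ψ.coordMap c c').jac (κ c j.base) *
      ∑ a, eulerCoord a (lagr ν c' P) (jetCoord c' (ψ.onJet j)) * ψ.partialPsi c c' j a b := by
  set A := ψ.coordMap c c' with hA
  have hsub : A.src ⊆ domCoord n m V c := inter_subset_left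
  have hsub' : A.tgt ⊆ domCoord n m V c' := inter_subset_left
  obtain ⟨p, hp⟩ := hP.smOn_lagr ν c'
  obtain ⟨q, hq⟩ := hP'.smOn_lagr ν c
  have key := A.eulerCoord_pr (u := secCoord c j.repr)
    (fun a => (contDiffOn_secCoord c j.repr a).mono hsub) (hp.subset hsub') (L' := lagr ν c P')
    (fun z hz => ?_) (ψ.chart_mem_src hx hx') b
  · rw [← jetCoord_eq_jc] at key
    rw [key, ψ.jetCoord_onJet hx hx']
    simp only [ψ.partialPsi_eq hx hx']
    rfl
  -- `eulerCoord_pr` needs the transformation law of the Lagrangians at all coordinate values, but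
  -- it is known only at jets; `eq_of_jets` extends it.
  · refine SmOn.eq_of_jets (hq.subset hsub)
      ((SmOn.base A.contDiffOn_jac).mul (A.smOn_comp_pr (hp.subset hsub'))) hsub
      (fun i hi hiA => ?_) hz
    have hi' : ψ.base i.base ∈ dom n m V c' := by
      have := hiA.2
      rwa [mem_preimage, symm_chart hi] at this
    have h1 : (jetCoord c i).1 = κ c i.base := rfl
    have h2 : (jetCoord c' (ψ.onJet i)).1 = κ c' (ψ.base i.base) := rfl
    have h3 : rep c' P (jetCoord c' (ψ.onJet i)) = P (ψ.onJet i) := hP.rep_jetCoord (by exact hi')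
    rw [← ψ.jetCoord_onJet hi hi', lagr, lagr, h1, h2, hP'.rep_jetCoord hi, h3, h,
      ← mul_assoc, ← mul_assoc, ← ψ.det_mul_formCoeff hi hi']
    ring

end BundleAut

theorem det_refl (x : M) : ν.det (BundleAut.refl n m V).base x = 1 := by
  have h1 : ν.det (BundleAut.refl n m V).base x • ν.form x = ν.form x := by
    rw [← ν.pullbackForm_eq]
    refine AlternatingMap.ext fun w => ?_
    change ν.form x (fun i => mfderiv (𝓡 n) (𝓡 n) id x (w i)) = _
    rw [mfderiv_id]
    rfl
  have h2 := congrArg (formVal x x) h1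
  rw [map_smul, smul_eq_mul] at h2
  exact mul_right_cancel₀ (ν.formVal_ne_zero (mem_dom_self n m V x).1) (h2.trans (one_mul _).symm)

/-- The components of the Euler-Lagrange form in any bundle chart. -/
theorem coef_eulerForm (hP : IsLocal P) {j : JetBundle n m V} (hj : j.base ∈ dom n m V c)
    (a : Fin m) : coef c (eulerForm ν P) a j = eulerCoord a (lagr ν c P) (jetCoord c j) := by
  have hx := mem_dom_self n m V j.base
  have h1 : ∀ a, coef j.base (eulerForm ν P) a j = eulerCoord a (lagr ν j.base P) (jetCoord j.base j) :=
    fun a => coef_of_eq_sum (A := fun a => eulerCoord a (lagr ν j.base P) (jetCoord j.base j)) hx rfl a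
  -- By definition the form is computed in the chart at `j.base`; naturality under the identity,
  -- read between the charts at `c` and `j.base`, carries the formula over to `c`.
  rw [← BundleAut.refl_pullback (eulerForm ν P),
    (BundleAut.refl n m V).coef_pullback hj (c' := j.base) hx,
    (BundleAut.refl n m V).eulerCoord_lagr hP hP (fun i => by
      rw [det_refl, one_mul, BundleAut.refl_onJet]) hj (c' := j.base) hx]
  simp only [BundleAut.refl_onJet, h1]

theorem isSourceForm_eulerForm (hP : IsLocal P) : IsSourceForm (eulerForm ν P) := by
  obtain ⟨p, hp⟩ := hP.exists_locAt
  refine isSourceForm_of_locAt ⟨p + p, fun c x hx a => ?_⟩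
  obtain ⟨Ω, hΩ, hd, hxΩ, f, hf, hPf⟩ := hp c x hx
  refine ⟨Ω, hΩ, hd, hxΩ, _, SmOn.eulerCoord ((SmOn.base
    ((contDiffOn_formCoeff ν c).mono hd)).mul hf) hΩ a, fun j hj hjΩ => ?_⟩
  rw [coef_eulerForm hP hj, hP.eulerCoord_lagr hΩ hd hf hPf a (by exact hjΩ)]

/-- The Euler-Lagrange operator commutes with pull-backs. -/
theorem BundleAut.eulerForm_pullback (ψ : BundleAut n m V) (hP : IsLocal P) :
    eulerForm ν (fun j => ν.det ψ.base j.base * P (ψ.onJet j)) = ψ.pullback (eulerForm ν P) := by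
  funext j
  have hx := mem_dom_self n m V j.base
  have hx' := mem_dom_self n m V (ψ.base j.base)
  refine ext_coef (c := j.base) hx fun a => ?_
  rw [coef_eulerForm (ψ.isLocal_det_mul hP) hx, ψ.coef_pullback hx hx',
    ψ.eulerCoord_lagr hP (ψ.isLocal_det_mul hP) (fun _ => rfl) hx hx']
  refine congrArg _ (Finset.sum_congr rfl fun b _ => congrArg (· * _) ?_)
  exact (coef_eulerForm hP (by exact hx') b).symm

end Euler

end

end LocalFunctionals

namespace LocalFunctionals

noncomputable section

set_option linter.unusedSectionVars false

/-! ### The measure of a volume form and the change of variables formula -/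

section Integration

theorem _root_.MeasureTheory.setLIntegral_eq_of_subset_of_forall_diff_eq_zero' {α : Type*}
    [MeasurableSpace α] {μ : Measure α} {s t : Set α} (hs : MeasurableSet s) (ht : MeasurableSet t)
    (hst : s ⊆ t) {f : α → ENNReal} (h : ∀ x ∈ t, x ∉ s → f x = 0) :
    ∫⁻ x in t, f x ∂μ = ∫⁻ x in s, f x ∂μ := by
  rw [← lintegral_indicator ht, ← lintegral_indicator hs]
  congr 1
  funext x
  by_cases hx : x ∈ s
  · rw [indicator_of_mem hx, indicator_of_mem (hst hx)]
  · rw [indicator_of_notMem hx]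
    by_cases hx' : x ∈ t
    · rw [indicator_of_mem hx', h x hx' hx]
    · rw [indicator_of_notMem hx']

/-- The partition of unity is indexed by all points of `M`, which may be uncountable. Only countably
many of its members are nonzero, so sum and integral can still be exchanged. -/
theorem _root_.MeasureTheory.lintegral_tsum_of_countable {α ι : Type*} [MeasurableSpace α]
    {μ : Measure α} {C : Set ι} (hC : C.Countable) {G : ι → α → ENNReal}
    (hG : ∀ i, AEMeasurable (G i) μ) (h0 : ∀ i ∉ C, G i = 0) :
    ∫⁻ x, ∑' i, G i x ∂μ = ∑' i, ∫⁻ x, G i x ∂μ := by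
  have hc : Countable C := hC.to_subtype
  have h1 : ∀ x, ∑' i, G i x = ∑' i : C, G i x := fun x =>
    (tsum_subtype_eq_of_support_subset (f := fun i => G i x) fun i hi => by
      by_contra hiC
      exact hi (by simp [h0 i hiC])).symm
  have h2 : ∑' i, ∫⁻ x, G i x ∂μ = ∑' i : C, ∫⁻ x, G i x ∂μ :=
    (tsum_subtype_eq_of_support_subset (f := fun i => ∫⁻ x, G i x ∂μ) fun i hi => by
      by_contra hiC
      exact hi (by simp [h0 i hiC])).symm
  simp only [h1]
  rw [h2]
  exact lintegral_tsum fun i : C => hG i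

variable {n : ℕ} {M : Type*} [TopologicalSpace M] [ChartedSpace (EuclideanSpace ℝ (Fin n)) M]

local notation "κ" => chartAt (EuclideanSpace ℝ (Fin n))

namespace VolumeForm

variable (ν : VolumeForm n M) {c c' : M}

/-- The integral with respect to `|ν|` over the domain of the chart at `c`. -/
def chartLintegral (c : M) (h : M → ENNReal) : ENNReal :=
  ∫⁻ y in (κ c).target, ENNReal.ofReal |formCoeff ν.form c y| * h ((κ c).symm y)

variable [IsManifold (𝓡 n) ∞ M]

theorem det_id (x : M) : ν.det id x = 1 := by
  have h1 : pullbackForm (n := n) (fun x : M => x) x (ν.form x) = ν.form x := by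
    refine AlternatingMap.ext fun w => ?_
    change ν.form x (fun i => mfderiv (𝓡 n) (𝓡 n) id x (w i)) = _
    rw [mfderiv_id]
    rfl
  exact (congrArg (fun B : TopForm n x => B (fun i => EuclideanSpace.basisFun (Fin n) ℝ i) /
    ν.form x fun i => EuclideanSpace.basisFun (Fin n) ℝ i) h1).trans
    (div_self (ν.form_basis_ne_zero x))

/-- Euclidean change of variables for the transition map. The support condition `hg` confines both
integrals to the parts of the two charts that `f` identifies. -/
theorem chartLintegral_det_mul {c c' : M} (f : Diffeomorph (𝓡 n) (𝓡 n) M M ∞) {g : M → ENNReal}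
    (hg : ∀ x, g x ≠ 0 → x ∈ (κ c').source ∧ f.symm x ∈ (κ c).source) :
    ν.chartLintegral c (fun x => ENNReal.ofReal |ν.det f x| * g (f x)) =
      ν.chartLintegral c' g := by
  set s := (κ c).target ∩ (fun y => f ((κ c).symm y)) ⁻¹' (κ c').source with hs
  have hso : IsOpen s := isOpen_transition f.continuous c c'
  set τ : EuclideanSpace ℝ (Fin n) → EuclideanSpace ℝ (Fin n) := transition f c c' with hτ
  have hτs : ContDiffOn ℝ ∞ τ s := contDiffOn_transition f.contMDiff c c'
  have hsymm : ∀ y ∈ s, (κ c').symm (τ y) = f ((κ c).symm y) := fun y hy =>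
    (κ c').left_inv hy.2
  have hinj : InjOn τ s := by
    intro y hy y' hy' h
    have h1 := congrArg (κ c').symm h
    rw [hsymm y hy, hsymm y' hy'] at h1
    exact (κ c).symm.injOn hy.1 hy'.1 (f.injective h1)
  have hderiv : ∀ y ∈ s, HasFDerivWithinAt τ (fderiv ℝ τ y) s y := fun y hy =>
    (hτs.differentiableAt_of_isOpen hso hy).hasFDerivAt.hasFDerivWithinAt
  have himage : τ '' s = (κ c').target ∩ (fun y => f.symm ((κ c').symm y)) ⁻¹' (κ c).source := by
    ext z
    constructor
    · rintro ⟨y, hy, rfl⟩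
      refine ⟨(κ c').map_source hy.2, ?_⟩
      rw [mem_preimage, hsymm y hy, f.symm_apply_apply]
      exact (κ c).map_target hy.1
    · rintro ⟨hz, hz'⟩
      refine ⟨κ c (f.symm ((κ c').symm z)), ⟨(κ c).map_source hz', ?_⟩, ?_⟩
      · rw [mem_preimage, (κ c).left_inv hz', f.apply_symm_apply]
        exact (κ c').map_target hz
      · change κ c' (f ((κ c).symm (κ c (f.symm ((κ c').symm z))))) = z
        rw [(κ c).left_inv hz', f.apply_symm_apply, (κ c').right_inv hz]
  have himo : IsOpen (τ '' s) := himage ▸ isOpen_transition f.symm.continuous c' c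
  rw [chartLintegral, chartLintegral,
    setLIntegral_eq_of_subset_of_forall_diff_eq_zero' hso.measurableSet
      (κ c).open_target.measurableSet inter_subset_left,
    setLIntegral_eq_of_subset_of_forall_diff_eq_zero' himo.measurableSet
      (κ c').open_target.measurableSet (himage ▸ inter_subset_left),
    lintegral_image_eq_lintegral_abs_det_fderiv_mul volume hso.measurableSet hderiv hinj]
  · refine setLIntegral_congr_fun hso.measurableSet fun y hy => ?_
    have h1 := ν.det_mul_formCoeff f.contMDiff (c := c) (c' := c') (x := (κ c).symm y)
      ((κ c).map_target hy.1) hy.2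
    rw [(κ c).right_inv hy.1] at h1
    simp only [hsymm y hy]
    rw [← mul_assoc, ← mul_assoc, ← ENNReal.ofReal_mul (abs_nonneg _),
      ← ENNReal.ofReal_mul (abs_nonneg _), ← abs_mul, ← abs_mul, mul_comm (formCoeff _ _ _), h1]
    rfl
  · intro y hy hys
    by_contra h
    refine hys ?_
    rw [himage]
    refine ⟨hy, (hg _ fun h0 => h ?_).2⟩
    rw [h0, mul_zero]
  · intro y hy hys
    by_contra h
    refine hys ⟨hy, (hg _ fun h0 => h ?_).1⟩
    rw [h0, mul_zero, mul_zero]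

variable [T2Space M] [SigmaCompactSpace M] [MeasurableSpace M] [BorelSpace M]

theorem chartPartition_mem {c x : M} (h : chartPartition n M c x ≠ 0) : x ∈ (κ c).source :=
  (SmoothPartitionOfUnity.exists_isSubordinate_chartAt_source (𝓡 n) M).choose_spec c
    (subset_tsupport _ h)

theorem continuousOn_formCoeff (c : M) : ContinuousOn (formCoeff ν.form c) (κ c).target :=
  (ν.smooth c).continuousOn

theorem measurable_chartPartition (c : M) :
    Measurable fun x => ENNReal.ofReal (chartPartition n M c x) :=
  ENNReal.measurable_ofReal.comp (chartPartition n M c).contMDiff.continuous.measurable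

theorem aemeasurable_symm (c : M) :
    AEMeasurable (κ c).symm (volume.restrict (κ c).target) :=
  (κ c).continuousOn_symm.aemeasurable (κ c).open_target.measurableSet

theorem aemeasurable_formCoeff (c : M) :
    AEMeasurable (fun y => ENNReal.ofReal |formCoeff ν.form c y|)
      (volume.restrict (κ c).target) :=
  ((ν.continuousOn_formCoeff c).abs.aemeasurable (κ c).open_target.measurableSet).ennreal_ofReal

theorem lintegral_measure {h : M → ENNReal} (hh : Measurable h) :
    ∫⁻ x, h x ∂ν.measure =
      ∑' c, ν.chartLintegral c fun x => ENNReal.ofReal (chartPartition n M c x) * h x := by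
  rw [measure, lintegral_sum_measure]
  refine tsum_congr fun c => ?_
  have hw : AEMeasurable (fun y => ENNReal.ofReal (chartPartition n M c ((κ c).symm y) *
      |formCoeff ν.form c y|)) (volume.restrict (κ c).target) :=
    AEMeasurable.ennreal_ofReal ((((chartPartition n M c).contMDiff.continuous.comp_continuousOn
      (κ c).continuousOn_symm).mul (ν.continuousOn_formCoeff c).abs).aemeasurable
      (κ c).open_target.measurableSet)
  rw [lintegral_map' hh.aemeasurable ((aemeasurable_symm c).mono_ac
      (withDensity_absolutelyContinuous _ _)),
    lintegral_withDensity_eq_lintegral_mul₀ hw (g := fun y => h ((κ c).symm y))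
      (hh.comp_aemeasurable (aemeasurable_symm c)),
    chartLintegral]
  congr 1
  funext y
  rw [Pi.mul_apply, ENNReal.ofReal_mul ((chartPartition n M).nonneg _ _), mul_comm (ENNReal.ofReal _)
    (ENNReal.ofReal |_|), mul_assoc]

theorem countable_chartPartition : {c : M | ∃ x, chartPartition n M c x ≠ 0}.Countable := by
  have h := LocallyFinite.countable_univ (ι := {c : M | ∃ x, chartPartition n M c x ≠ 0})
    (f := fun c => Function.support (chartPartition n M c))
    ((chartPartition n M).locallyFinite.comp_injective Subtype.val_injective) fun c => c.2
  exact countable_coe_iff.1 (countable_univ_iff.1 h)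

theorem tsum_chartPartition (x : M) :
    ∑' c, ENNReal.ofReal (chartPartition n M c x) = 1 := by
  have hfin := (chartPartition n M).locallyFinite.point_finite x
  have h1 := (chartPartition n M).sum_eq_one (mem_univ x)
  rw [finsum_eq_sum_of_support_subset (s := hfin.toFinset) _ fun c hc => by simpa using hc] at h1
  rw [tsum_eq_sum (s := hfin.toFinset) fun c hc => by
      have : chartPartition n M c x = 0 := by simpa using hc
      simp [this],
    ← ENNReal.ofReal_sum_of_nonneg fun c _ => (chartPartition n M).nonneg _ _, h1,
    ENNReal.ofReal_one]

theorem lintegral_eq_tsum_chartPartition (μ : Measure M) {h : M → ENNReal} (hh : Measurable h) :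
    ∫⁻ x, h x ∂μ = ∑' c, ∫⁻ x, ENNReal.ofReal (chartPartition n M c x) * h x ∂μ := by
  rw [← lintegral_tsum_of_countable (countable_chartPartition (n := n) (M := M))
    (G := fun c x => ENNReal.ofReal (chartPartition n M c x) * h x)
    (fun c => ((measurable_chartPartition c).mul hh).aemeasurable) fun c hc => ?_]
  · refine lintegral_congr fun x => ?_
    rw [ENNReal.tsum_mul_right, tsum_chartPartition, one_mul]
  · funext x
    have : chartPartition n M c x = 0 := by
      by_contra h
      exact hc ⟨x, h⟩
    simp [this]

/-- `det f` is continuous. -/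
theorem continuous_det (f : Diffeomorph (𝓡 n) (𝓡 n) M M ∞) : Continuous (ν.det f) := by
  refine continuous_iff_continuousAt.2 fun x => ?_
  set s := (κ x).target ∩ (fun y => f ((κ x).symm y)) ⁻¹' (κ (f x)).source with hs
  have hso : IsOpen s := isOpen_transition f.continuous x (f x)
  have hxs : κ x x ∈ s := by
    refine ⟨mem_chart_target _ x, ?_⟩
    rw [mem_preimage, (κ x).left_inv (mem_chart_source _ x)]
    exact mem_chart_source _ _
  have hτ : ContDiffOn ℝ ∞ (transition f x (f x)) s := contDiffOn_transition f.contMDiff x (f x)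
  have h1 : ContinuousOn (fun y => (fderiv ℝ (transition f x (f x)) y).det *
      formCoeff ν.form (f x) (transition f x (f x) y) / formCoeff ν.form x y) s := by
    refine ((ContinuousLinearMap.continuous_det.comp_continuousOn
      (hτ.continuousOn_fderiv_of_isOpen hso (by simp))).mul
      ((ν.continuousOn_formCoeff (f x)).comp hτ.continuousOn fun y hy =>
        (κ (f x)).map_source hy.2)).div ((ν.continuousOn_formCoeff x).mono inter_subset_left)
      fun y hy => ν.formCoeff_ne_zero hy.1
  have h2 := (h1.continuousAt (hso.mem_nhds hxs)).comp
    ((κ x).continuousAt (mem_chart_source _ x))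
  refine h2.congr (Filter.eventuallyEq_of_mem (((κ x).open_source.inter
    ((κ (f x)).open_source.preimage f.continuous)).mem_nhds
    ⟨mem_chart_source _ x, mem_chart_source _ (f x)⟩) fun z hz => ?_)
  simp only [Function.comp]
  rw [div_eq_iff (ν.formCoeff_ne_zero ((κ x).map_source hz.1)),
    ν.det_mul_formCoeff f.contMDiff hz.1 hz.2, transition, (κ x).left_inv hz.1]

theorem measurable_abs_det (f : Diffeomorph (𝓡 n) (𝓡 n) M M ∞) :
    Measurable fun x => ENNReal.ofReal |ν.det f x| :=
  (ν.continuous_det f).abs.measurable.ennreal_ofReal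

/-- Each piece of the integral is carried from its own chart to the chart at `c'`, where the
transported partition functions sum to one. For `f` the identity this says that the measure does not
depend on the partition. -/
theorem lintegral_det_mul_eq_chartLintegral (f : Diffeomorph (𝓡 n) (𝓡 n) M M ∞) {h : M → ENNReal}
    (hh : Measurable h) (hc : ∀ x, h x ≠ 0 → x ∈ (κ c').source) :
    ∫⁻ x, ENNReal.ofReal |ν.det f x| * h (f x) ∂ν.measure = ν.chartLintegral c' h := by
  rw [ν.lintegral_measure (h := fun x => ENNReal.ofReal |ν.det f x| * h (f x))
    ((ν.measurable_abs_det f).mul (hh.comp f.continuous.measurable))]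
  have h1 : ∀ c, (ν.chartLintegral c fun x => ENNReal.ofReal (chartPartition n M c x) *
      (ENNReal.ofReal |ν.det f x| * h (f x))) = ν.chartLintegral c' fun x =>
        ENNReal.ofReal (chartPartition n M c (f.symm x)) * h x := by
    intro c
    rw [← ν.chartLintegral_det_mul f (c := c) (c' := c')]
    · congr 1
      funext x
      rw [f.symm_apply_apply]
      ring
    · intro x hx
      refine ⟨hc x (right_ne_zero_of_mul hx), chartPartition_mem fun h0 => ?_⟩
      exact left_ne_zero_of_mul hx (by rw [h0, ENNReal.ofReal_zero])
  refine (tsum_congr h1).trans ?_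
  simp only [chartLintegral]
  rw [← lintegral_tsum_of_countable (countable_chartPartition (n := n) (M := M))
    (G := fun c y => ENNReal.ofReal |formCoeff ν.form c' y| *
      (ENNReal.ofReal (chartPartition n M c (f.symm ((κ c').symm y))) * h ((κ c').symm y)))
    (fun c => ?_) fun c hc => ?_]
  · refine lintegral_congr fun y => ?_
    rw [ENNReal.tsum_mul_left, ENNReal.tsum_mul_right, tsum_chartPartition, one_mul]
  · exact (ν.aemeasurable_formCoeff c').mul ((((measurable_chartPartition c).comp
      f.symm.continuous.measurable).mul hh).comp_aemeasurable (aemeasurable_symm c'))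
  · funext y
    have : ∀ x, chartPartition n M c x = 0 := fun x => by
      by_contra h
      exact hc ⟨x, h⟩
    simp [this]

/-- The integral of a function supported in the domain of a chart. -/
theorem lintegral_eq_chartLintegral {h : M → ENNReal} (hh : Measurable h)
    (hc : ∀ x, h x ≠ 0 → x ∈ (κ c).source) : ∫⁻ x, h x ∂ν.measure = ν.chartLintegral c h := by
  rw [← ν.lintegral_det_mul_eq_chartLintegral (Diffeomorph.refl (𝓡 n) M ∞) hh hc]
  refine lintegral_congr fun x => ?_
  have : ν.det (Diffeomorph.refl (𝓡 n) M ∞) x = 1 := ν.det_id x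
  rw [this]
  simp

theorem lintegral_det_mul (f : Diffeomorph (𝓡 n) (𝓡 n) M M ∞) {h : M → ENNReal}
    (hh : Measurable h) :
    ∫⁻ x, ENNReal.ofReal |ν.det f x| * h (f x) ∂ν.measure = ∫⁻ x, h x ∂ν.measure := by
  have hmeas : ∀ c : M, Measurable fun x => ENNReal.ofReal (chartPartition n M c x) * h x :=
    fun c => (measurable_chartPartition c).mul hh
  have hsupp : ∀ c x : M, ENNReal.ofReal (chartPartition n M c x) * h x ≠ 0 → x ∈ (κ c).source :=
    fun c x hx => chartPartition_mem fun h0 =>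
      left_ne_zero_of_mul hx (by rw [h0, ENNReal.ofReal_zero])
  -- The partition of unity cuts `h` into pieces supported in single charts, to which the previous
  -- two lemmas apply.
  rw [lintegral_eq_tsum_chartPartition (n := n) ν.measure hh]
  have h1 : ∀ x, ENNReal.ofReal |ν.det f x| * h (f x) = ∑' c, ENNReal.ofReal |ν.det f x| *
      (ENNReal.ofReal (chartPartition n M c (f x)) * h (f x)) := fun x => by
    rw [ENNReal.tsum_mul_left, ENNReal.tsum_mul_right, tsum_chartPartition, one_mul]
  simp only [h1]
  rw [lintegral_tsum_of_countable (countable_chartPartition (n := n) (M := M))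
    (G := fun c x => ENNReal.ofReal |ν.det f x| *
      (ENNReal.ofReal (chartPartition n M c (f x)) * h (f x))) (fun c => ((ν.measurable_abs_det f).mul ((hmeas c).comp f.continuous.measurable)).aemeasurable)
    fun c hc => ?_]
  · refine tsum_congr fun c => ?_
    rw [ν.lintegral_eq_chartLintegral (hmeas c) (hsupp c)]
    exact ν.lintegral_det_mul_eq_chartLintegral f (hmeas c) (hsupp c)
  · funext y
    have : ∀ x, chartPartition n M c x = 0 := fun x => by
      by_contra h
      exact hc ⟨x, h⟩
    simp [this]

theorem map_withDensity_det (f : Diffeomorph (𝓡 n) (𝓡 n) M M ∞) :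
    (ν.measure.withDensity fun x => ENNReal.ofReal |ν.det f x|).map f = ν.measure := by
  refine Measure.ext_of_lintegral _ fun h hh => ?_
  rw [lintegral_map hh f.continuous.measurable,
    lintegral_withDensity_eq_lintegral_mul _ (ν.measurable_abs_det f) (g := fun x => h (f x))
      (hh.comp f.continuous.measurable)]
  exact ν.lintegral_det_mul f hh

/-- The change of variables formula. -/
theorem integral_det_mul (f : Diffeomorph (𝓡 n) (𝓡 n) M M ∞) (hf : ∀ x, 0 < ν.det f x)
    (g : M → ℝ) : ∫ x, ν.det f x * g (f x) ∂ν.measure = ∫ x, g x ∂ν.measure := by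
  have h1 : ∫ x, g x ∂ν.measure = ∫ x, g x
      ∂((ν.measure.withDensity fun x => ENNReal.ofReal |ν.det f x|).map
        f.toHomeomorph.toMeasurableEquiv) := by
    rw [show Measure.map f.toHomeomorph.toMeasurableEquiv _ = ν.measure from
      ν.map_withDensity_det f]
  rw [h1, integral_map_equiv, integral_withDensity_eq_integral_toReal_smul
    (ν.measurable_abs_det f) (Filter.Eventually.of_forall fun _ => ENNReal.ofReal_lt_top)]
  refine integral_congr_ae (Filter.Eventually.of_forall fun x => ?_)
  simp only [abs_of_pos (hf x), ENNReal.toReal_ofReal (hf x).le, smul_eq_mul]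
  rfl

theorem restrict_measure (c : M) : ν.measure.restrict (κ c).source =
    ((volume.restrict (κ c).target).withDensity fun y =>
      ENNReal.ofReal |formCoeff ν.form c y|).map (κ c).symm := by
  refine Measure.ext_of_lintegral _ fun h hh => ?_
  have hs : MeasurableSet (κ c).source := (κ c).open_source.measurableSet
  rw [← lintegral_indicator hs, ν.lintegral_eq_chartLintegral (c := c) (hh.indicator hs)
      fun x hx => by_contra fun h0 => hx (indicator_of_notMem h0 _),
    lintegral_map' hh.aemeasurable ((aemeasurable_symm c).mono_ac
      (withDensity_absolutelyContinuous _ _)),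
    lintegral_withDensity_eq_lintegral_mul₀ (ν.aemeasurable_formCoeff c)
      (g := fun y => h ((κ c).symm y)) (hh.comp_aemeasurable (aemeasurable_symm c)), chartLintegral]
  refine setLIntegral_congr_fun (κ c).open_target.measurableSet fun y hy => ?_
  simp only [indicator_of_mem ((κ c).map_target hy)]
  rfl

theorem integral_eq_of_source {g : M → ℝ} (hg : Continuous g)
    (hc : ∀ x ∉ (κ c).source, g x = 0) : ∫ x, g x ∂ν.measure =
      ∫ y in (κ c).target, |formCoeff ν.form c y| * g ((κ c).symm y) := by
  rw [← setIntegral_eq_integral_of_forall_compl_eq_zero hc, ν.restrict_measure c,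
    integral_map ((aemeasurable_symm c).mono_ac (withDensity_absolutelyContinuous _ _))
      hg.aestronglyMeasurable,
    integral_withDensity_eq_integral_toReal_smul₀ (ν.aemeasurable_formCoeff c)
      (Filter.Eventually.of_forall fun _ => ENNReal.ofReal_lt_top)]
  simp only [ENNReal.toReal_ofReal (abs_nonneg _), smul_eq_mul]

/-- Makes continuous functions with compact support integrable. -/
instance isLocallyFiniteMeasure_measure : IsLocallyFiniteMeasure ν.measure := by
  refine ⟨fun x => ?_⟩
  obtain ⟨K, hK, hxK, hKs⟩ := exists_compact_subset (κ x).open_target (mem_chart_target _ x)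
  set U := (κ x).source ∩ κ x ⁻¹' interior K with hU
  have hUo : IsOpen U := (κ x).isOpen_inter_preimage isOpen_interior
  refine ⟨U, hUo.mem_nhds ⟨mem_chart_source _ x, hxK⟩, ?_⟩
  rw [← lintegral_indicator_one hUo.measurableSet, ν.lintegral_eq_chartLintegral (c := x)
    (measurable_one.indicator hUo.measurableSet)
    fun z hz => (by_contra fun h0 => hz (indicator_of_notMem (fun h' => h0 h'.1) _)), chartLintegral]
  have h1 : ∫⁻ y in K, ENNReal.ofReal |formCoeff ν.form x y| < ⊤ := by
    have h2 := (((ν.continuousOn_formCoeff x).mono hKs).integrableOn_compact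
      (μ := volume) hK).hasFiniteIntegral
    rw [hasFiniteIntegral_iff_norm] at h2
    simpa only [Real.norm_eq_abs] using h2
  refine lt_of_le_of_lt ?_ h1
  rw [← lintegral_indicator hK.measurableSet, ← lintegral_indicator (κ x).open_target.measurableSet]
  refine lintegral_mono fun y => ?_
  by_cases hy : y ∈ (κ x).target
  · rw [indicator_of_mem hy]
    by_cases hyK : y ∈ K
    · rw [indicator_of_mem hyK]
      refine (mul_le_mul_right (indicator_le_self' (fun _ _ => zero_le) _) _).trans ?_
      simp
    · rw [indicator_of_notMem, mul_zero]
      · exact zero_le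
      · intro h
        have := h.2
        rw [mem_preimage, (κ x).right_inv hy] at this
        exact hyK (interior_subset this)
  · rw [indicator_of_notMem hy]
    exact zero_le

end VolumeForm

end Integration

end

end LocalFunctionals

namespace LocalFunctionals

noncomputable section

set_option linter.unusedSectionVars false

/-! ### The derivative of an action integral along compactly supported variations -/

section VariationIntegral

variable {n m : ℕ} {p : ℕ} {Ω : Set (EuclideanSpace ℝ (Fin n))} {f : JetCoord n m → ℝ}
  {u η : Fin m → EuclideanSpace ℝ (Fin n) → ℝ}

theorem SmOn.continuousOn_jc_line (hf : SmOn Ω p f) (hΩ : IsOpen Ω)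
    (hu : ∀ a, ContDiffOn ℝ ∞ (u a) Ω) (hη : ∀ a, ContDiffOn ℝ ∞ (η a) Ω) :
    ContinuousOn (fun q : ℝ × EuclideanSpace ℝ (Fin n) =>
      f (jc (fun a y => u a y + q.1 * η a y) q.2)) (univ ×ˢ Ω) := by
  obtain ⟨g, hg, hfg⟩ := hf
  have h1 : ContinuousOn (fun q : ℝ × EuclideanSpace ℝ (Fin n) =>
      g (q.2, fun a (I : {I // I ∈ multiIndexLE n p}) => multiPow partialD I.1 (u a) q.2 +
        q.1 * multiPow partialD I.1 (η a) q.2)) (univ ×ˢ Ω) := by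
    refine hg.continuousOn.comp (continuousOn_snd.prodMk ?_) fun q hq => ⟨hq.2, mem_univ _⟩
    refine continuousOn_pi.2 fun a => continuousOn_pi.2 fun I => ?_
    exact ((contDiffOn_multiPow hΩ I.1 (hu a)).continuousOn.comp continuousOn_snd
      fun q hq => hq.2).add (continuousOn_fst.mul
      ((contDiffOn_multiPow hΩ I.1 (hη a)).continuousOn.comp continuousOn_snd fun q hq => hq.2))
  refine h1.congr fun q hq => ?_
  refine (hfg _ (by exact hq.2)).trans (congrArg g (Prod.ext rfl (funext fun a => funext fun I => ?_)))
  exact multiPow_partialD_lin hΩ I.1 q.1 (hu a) (hη a) hq.2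

/-- The derivative of the integral of a Lagrangian along a compactly supported variation. -/
theorem SmOn.hasDerivAt_integral (hf : SmOn Ω p f) (hΩ : IsOpen Ω)
    (hu : ∀ a, ContDiffOn ℝ ∞ (u a) Ω) (hη : ∀ a, IsTestFn Ω (η a)) :
    HasDerivAt (fun t : ℝ => ∫ y in Ω, (f (jc (fun a y => u a y + t * η a y) y) - f (jc u y)))
      (∫ y in Ω, ∑ a, LocalFunctionals.eulerCoord a f (jc u y) * η a y) 0 := by
  have hη' : ∀ a, ContDiffOn ℝ ∞ (η a) Ω := fun a => (hη a).contDiff.contDiffOn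
  have hlin : ∀ (t : ℝ) (a : Fin m), ContDiffOn ℝ ∞ (fun y => u a y + t * η a y) Ω := fun t a =>
    (hu a).add (contDiffOn_const.mul (hη' a))
  set F' : ℝ → EuclideanSpace ℝ (Fin n) → ℝ := fun t y => ∑ a, ∑ I ∈ multiIndexLE n p,
    multiPow partialD I (η a) y *
      LocalFunctionals.partialU a I f (jc (fun a y => u a y + t * η a y) y) with hF'
  set K : Set (EuclideanSpace ℝ (Fin n)) := ⋃ a, tsupport (η a) with hK
  have hKc : IsCompact K := isCompact_iUnion fun a => (hη a).compact.isCompact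
  have hKΩ : K ⊆ Ω := iUnion_subset fun a => (hη a).subset
  have hF'c : ContinuousOn (fun q : ℝ × EuclideanSpace ℝ (Fin n) => F' q.1 q.2) (univ ×ˢ Ω) := by
    refine continuousOn_finsetSum _ fun a _ => continuousOn_finsetSum _ fun I _ => ?_
    exact (((hη a).multiPow I).contDiff.continuous.comp_continuousOn continuousOn_snd).mul
      ((hf.partialU hΩ a I).continuousOn_jc_line hΩ hu hη')
  have hF'0 : ∀ t, ∀ y ∉ K, F' t y = 0 := fun t y hy => by
    refine Finset.sum_eq_zero fun a _ => Finset.sum_eq_zero fun I _ => ?_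
    have h1 : IsTestFn (tsupport (η a)) (η a) := ⟨(hη a).contDiff, (hη a).compact, subset_rfl⟩
    rw [(h1.multiPow I).eq_zero fun h => hy (mem_iUnion.2 ⟨a, h⟩), zero_mul]
  -- `F' t` vanishes off the compact set `K`, so its maximum over `[-1, 1] × K` gives the integrable
  -- bound `K.indicator C`. Subtracting `f (jc u y)` in the integrand makes it vanish at `t = 0`, so
  -- no integrability of `f (jc u y)` over `Ω` is needed.
  obtain ⟨C, hC⟩ := ((isCompact_Icc (a := (-1 : ℝ)) (b := 1)).prod hKc).exists_bound_of_continuousOn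
    (hF'c.mono (prod_mono (subset_univ _) hKΩ))
  have h0 : F' 0 = fun y => ∑ a, ∑ I ∈ multiIndexLE n p,
      multiPow partialD I (η a) y * LocalFunctionals.partialU a I f (jc u y) := by
    funext y
    simp [hF']
  have key := hasDerivAt_integral_of_dominated_loc_of_deriv_le (μ := volume.restrict Ω)
    (F := fun (t : ℝ) y => f (jc (fun a y => u a y + t * η a y) y) - f (jc u y)) (x₀ := 0)
    (F' := F') (bound := K.indicator fun _ => C) (s := Ioo (-1) 1)
    (Ioo_mem_nhds (by norm_num) (by norm_num))
    (Filter.Eventually.of_forall fun t =>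
      ((hf.contDiffOn_jc hΩ (hlin t)).continuousOn.sub
        (hf.contDiffOn_jc hΩ hu).continuousOn).aestronglyMeasurable hΩ.measurableSet)
    (by simp)
    ((hF'c.comp (f := fun y => ((0 : ℝ), y)) (by fun_prop)
      fun y hy => ⟨mem_univ _, hy⟩).aestronglyMeasurable hΩ.measurableSet)
    (Filter.Eventually.of_forall fun y t ht => by
      by_cases hy : y ∈ K
      · rw [indicator_of_mem hy]
        exact hC (t, y) ⟨Ioo_subset_Icc_self ht, hy⟩
      · rw [indicator_of_notMem hy, hF'0 t y hy, norm_zero])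
    (((integrable_indicator_iff hKc.measurableSet).2
      (integrableOn_const hKc.measure_lt_top.ne)).integrableOn)
    ((ae_restrict_iff' hΩ.measurableSet).2 (Filter.Eventually.of_forall fun y hy t _ => by
      -- The variation formula is stated at parameter zero; it is applied to `u + t η` and the
      -- parameter is shifted by `t`.
      have h1 := hf.hasDerivAt_variation hΩ (hlin t) hη' hy
      rw [← sub_self t] at h1
      have h2 := h1.comp_sub_const t t
      refine HasDerivAt.sub_const _ (h2.congr_of_eventuallyEq
        (Filter.Eventually.of_forall fun r => ?_))
      simp only
      congr 2
      funext a y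
      ring))
  rw [← hf.first_variation hΩ hu hη, ← h0]
  exact key.2

end VariationIntegral

/-! ### A local functional determines the Euler-Lagrange form of its densities -/

section DensityIndependence

variable {n m : ℕ} {M : Type*} [TopologicalSpace M] [ChartedSpace (EuclideanSpace ℝ (Fin n)) M]
  {V : M → Type*} [TopologicalSpace (TotalSpace (EuclideanSpace ℝ (Fin m)) V)]
  [∀ x, AddCommGroup (V x)] [∀ x, Module ℝ (V x)] [∀ x, TopologicalSpace (V x)]
  [FiberBundle (EuclideanSpace ℝ (Fin m)) V]
variable [IsManifold (𝓡 n) ∞ M] [VectorBundle ℝ (EuclideanSpace ℝ (Fin m)) V]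
  [ContMDiffVectorBundle ∞ (EuclideanSpace ℝ (Fin m)) V (𝓡 n)] [T2Space M]

local notation "κ" => chartAt (EuclideanSpace ℝ (Fin n))

variable {ν : VolumeForm n M} {c c' x : M} {p : ℕ} {P R : JetBundle n m V → ℝ}

theorem jet_congr {φ φ' : Sec n m V} {U : Set M} (hU : U ∈ nhds x) (h : ∀ z ∈ U, φ z = φ' z) :
    jet φ x = jet φ' x := by
  obtain ⟨U', hU', hU'o, hxU'⟩ := mem_nhds_iff.1 hU
  have hx := mem_dom_self n m V x
  refine jet_eq_of_jc_eq (c := x) hx (jc_congr (Ω := (κ x).target ∩ (κ x).symm ⁻¹' U')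
    ((κ x).isOpen_inter_preimage_symm hU'o) (fun a y hy => ?_) ⟨(chart_mem hx).1, ?_⟩)
  · simp only [secCoord, h _ (hU' hy.2)]
  · rwa [mem_preimage, symm_chart hx]

theorem IsLocal.apply_jet (hP : IsLocal P) (hx : x ∈ dom n m V c) (φ : Sec n m V) :
    P (jet φ x) = rep c P (jc (secCoord c φ) (κ c x)) := by
  rw [← jetCoord_jet hx, hP.rep_jetCoord (by exact hx)]

theorem IsLocal.continuous_jet (hP : IsLocal P) (φ : Sec n m V) :
    Continuous fun x => P (jet φ x) := by
  refine continuous_iff_continuousAt.2 fun x => ?_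
  have hx := mem_dom_self n m V x
  obtain ⟨p, hp⟩ := hP.rep_spec x
  have h1 := ((hp.smOn.contDiffOn_jc (isOpen_domCoord n m V x)
    (contDiffOn_secCoord x φ)).continuousOn.continuousAt
    ((isOpen_domCoord n m V x).mem_nhds (chart_mem hx))).comp ((κ x).continuousAt hx.1)
  exact h1.congr (Filter.eventuallyEq_of_mem ((isOpen_dom n m V x).mem_nhds hx)
    fun z hz => (hP.apply_jet hz φ).symm)

theorem IsCompactLocal.hasCompactSupport (hP : IsCompactLocal ν P) (φ : CompactSec n m V) :
    HasCompactSupport fun x => P (jet φ.1 x) := by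
  obtain ⟨K, hK, h⟩ := hP.2 φ.1 φ.2
  exact HasCompactSupport.intro hK fun x hx => (h x hx).1

theorem CompactSupp.add_smul {φ φ' : Sec n m V} (hφ : CompactSupp φ) (hφ' : CompactSupp φ')
    (t : ℝ) : CompactSupp (φ + t • φ') := by
  obtain ⟨K, hK, h⟩ := hφ
  obtain ⟨K', hK', h'⟩ := hφ'
  refine ⟨K ∪ K', hK.union hK', fun x hx => ?_⟩
  rw [mem_union, not_or] at hx
  rw [ContMDiffSection.coe_add, ContMDiffSection.coe_smul, Pi.add_apply, Pi.smul_apply,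
    h x hx.1, h' x hx.2, smul_zero, add_zero]

variable [SigmaCompactSpace M] [MeasurableSpace M] [BorelSpace M]

theorem IsCompactLocal.integrable (hP : IsCompactLocal ν P) (φ : CompactSec n m V) :
    Integrable (fun x => P (jet φ.1 x)) ν.measure :=
  (hP.1.continuous_jet φ.1).integrable_of_hasCompactSupport (hP.hasCompactSupport φ)

/-- The first variation of a local functional. -/
theorem IsCompactLocal.hasDerivAt_integralOf (hP : IsCompactLocal ν P) (φ : CompactSec n m V)
    {Ω : Set (EuclideanSpace ℝ (Fin n))} (hΩ : IsOpen Ω) (hd : Ω ⊆ domCoord n m V c) {s : ℝ}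
    (hs : ∀ y ∈ Ω, |formCoeff ν.form c y| = s * formCoeff ν.form c y)
    {η : Fin m → EuclideanSpace ℝ (Fin n) → ℝ} (hη : ∀ a, IsTestFn Ω (η a)) :
    HasDerivAt (fun t : ℝ => integralOf ν P ⟨φ.1 + t • testSec c η fun a => (hη a).mono hd,
        φ.2.add_smul (compactSupp_testSec _) t⟩)
      (s * ∫ y in Ω, ∑ a, eulerCoord a (lagr ν c P) (jc (secCoord c φ.1) y) * η a y) 0 := by
  have hη' : ∀ a, IsTestFn (domCoord n m V c) (η a) := fun a => (hη a).mono hd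
  obtain ⟨p, hp⟩ := hP.1.smOn_lagr ν c
  have hu : ∀ a, ContDiffOn ℝ ∞ (secCoord c φ.1 a) Ω := fun a =>
    (contDiffOn_secCoord c φ.1 a).mono hd
  have key := (((hp.subset hd).hasDerivAt_integral hΩ hu hη).const_mul s).const_add
    (integralOf ν P φ)
  refine key.congr_of_eventuallyEq (Filter.Eventually.of_forall fun t => ?_)
  set φ' : CompactSec n m V := ⟨φ.1 + t • testSec c η hη',
    φ.2.add_smul (compactSupp_testSec _) t⟩ with hφ'
  have hjet : ∀ x ∉ testSupp c η, jet φ'.1 x = jet φ.1 x := fun x hx =>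
    jet_congr ((isCompact_testSupp hη').isClosed.isOpen_compl.mem_nhds hx) fun z hz => by
      change φ.1 z + t • testSec c η hη' z = φ.1 z
      rw [testSec_eq_zero hη' hz, smul_zero, add_zero]
  -- Only the difference of the integrands is supported in the chart, so only the difference is
  -- written in coordinates. The measure has density `|formCoeff|` while `lagr` contains
  -- `formCoeff`; this is the origin of the sign `s`.
  have h1 : integralOf ν P φ' = integralOf ν P φ +
      ∫ x, (P (jet φ'.1 x) - P (jet φ.1 x)) ∂ν.measure := by
    rw [integral_sub (hP.integrable φ') (hP.integrable φ)]
    simp only [integralOf]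
    ring
  change integralOf ν P φ' = _
  refine h1.trans (congrArg (integralOf ν P φ + ·) ?_)
  rw [ν.integral_eq_of_source (c := c) (g := fun x => P (jet φ'.1 x) - P (jet φ.1 x))
    ((hP.1.continuous_jet φ'.1).sub (hP.1.continuous_jet φ.1)) (fun x hx => by
      rw [hjet x fun h => hx (testSupp_subset hη' h).1, sub_self]),
    setIntegral_eq_of_subset_of_forall_sdiff_eq_zero (κ c).open_target.measurableSet
      (hd.trans inter_subset_left), ← integral_const_mul]
  · refine setIntegral_congr_fun hΩ.measurableSet fun y hy => ?_
    have hx := symm_mem_dom (hd hy)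
    have h2 : jc (secCoord c φ'.1) y = jc (fun a y => secCoord c φ.1 a y + t * η a y) y :=
      jc_congr hΩ (fun a z hz => (secCoord_add_smul φ.1 _ t a (hd hz)).trans
        (congrArg (secCoord c φ.1 a z + t * ·) (secCoord_testSec hη' a (hd hz)))) hy
    rw [hP.1.apply_jet hx, hP.1.apply_jet hx, chart_symm (hd hy), h2, hs y hy]
    simp only [lagr, jc]
    ring
  · intro y hy
    rw [hjet, sub_self, mul_zero]
    rintro ⟨z, hz, hzy⟩
    obtain ⟨a, ha⟩ := mem_iUnion.1 hz
    have hzΩ := (hη a).subset ha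
    exact hy.2 ((κ c).symm.injOn (hd hzΩ).1 hy.1 hzy ▸ hzΩ)

/-- The Euler-Lagrange form of a density of a local functional is determined by the functional. -/
theorem eulerForm_eq_of_integralOf_eq (hP : IsCompactLocal ν P) (hR : IsCompactLocal ν R)
    (h : integralOf ν P = integralOf ν R) : eulerForm ν P = eulerForm ν R := by
  funext j
  have hx := mem_dom_self n m V j.base
  obtain ⟨φ, hφ, hj⟩ := exists_compactSupp_jet j
  refine ext_coef (c := j.base) hx fun a => ?_
  rw [coef_eulerForm hP.1 hx, coef_eulerForm hR.1 hx]
  set c := j.base with hc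
  have hjc : jetCoord c j = jc (secCoord c φ) (κ c c) := by
    rw [← jetCoord_jet hx, hj]
  have hne := ν.formCoeff_ne_zero (chart_mem hx).1
  -- `s` is the sign of the coefficient of `ν` at the point; `Ω` is the open set where the
  -- coefficient keeps that sign.
  obtain ⟨s, hs, hsc⟩ : ∃ s : ℝ, s ≠ 0 ∧ 0 < s * formCoeff ν.form c (κ c c) ∧ |s| = 1 := by
    rcases lt_or_gt_of_ne hne with h | h
    · exact ⟨-1, by norm_num, by linarith, by norm_num⟩
    · exact ⟨1, by norm_num, by linarith, by norm_num⟩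
  set Ω := domCoord n m V c ∩ (fun y => s * formCoeff ν.form c y) ⁻¹' Ioi 0 with hΩdef
  have hΩ : IsOpen Ω := (continuousOn_const.mul
    (contDiffOn_formCoeff ν c).continuousOn).isOpen_inter_preimage (isOpen_domCoord n m V c)
    isOpen_Ioi
  have hd : Ω ⊆ domCoord n m V c := inter_subset_left
  have hxΩ : κ c c ∈ Ω := ⟨chart_mem hx, hsc.1⟩
  have habs : ∀ y ∈ Ω, |formCoeff ν.form c y| = s * formCoeff ν.form c y := fun y hy => by
    have h1 : |s * formCoeff ν.form c y| = s * formCoeff ν.form c y := abs_of_pos hy.2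
    rwa [abs_mul, hsc.2, one_mul] at h1
  have hcont : ∀ {P : JetBundle n m V → ℝ}, IsLocal P →
      ContDiffOn ℝ ∞ (fun y => eulerCoord a (lagr ν c P) (jc (secCoord c φ) y)) Ω := fun hP => by
    obtain ⟨p, hp⟩ := hP.smOn_lagr ν c
    exact ((hp.subset hd).eulerCoord hΩ a).contDiffOn_jc hΩ
      fun b => (contDiffOn_secCoord c φ b).mono hd
  have key := eq_zero_of_integral_testFn hΩ ((hcont hP.1).sub (hcont hR.1)).continuousOn
    (fun η hη => ?_) _ hxΩ
  · rw [hjc]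
    exact sub_eq_zero.1 key
  · have hηa : ∀ b, IsTestFn Ω ((Pi.single a η : Fin m → EuclideanSpace ℝ (Fin n) → ℝ) b) := by
      intro b
      by_cases hb : b = a
      · subst hb
        rwa [Pi.single_eq_same]
      · rw [Pi.single_eq_of_ne hb]
        exact IsTestFn.zero
    have h1 := hP.hasDerivAt_integralOf ⟨φ, hφ⟩ hΩ hd habs hηa
    have h2 := hR.hasDerivAt_integralOf ⟨φ, hφ⟩ hΩ hd habs hηa
    rw [h] at h1
    -- Equal functionals have equal derivatives along the test section, so the two integrated Euler
    -- expressions agree.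
    have h3 := mul_left_cancel₀ hs (h1.unique h2)
    have h4 : ∀ (P : JetBundle n m V → ℝ) (y : EuclideanSpace ℝ (Fin n)),
        ∑ b, eulerCoord b (lagr ν c P) (jc (secCoord c φ) y) *
          (Pi.single a η : Fin m → EuclideanSpace ℝ (Fin n) → ℝ) b y =
        eulerCoord a (lagr ν c P) (jc (secCoord c φ) y) * η y := fun P y => by
      rw [Finset.sum_eq_single a, Pi.single_eq_same]
      · intro b _ hb
        rw [Pi.single_eq_of_ne hb, Pi.zero_apply, mul_zero]
      · simp
    simp only [h4] at h3
    simp only [sub_mul]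
    rw [integral_sub (hη.mul_left hΩ (hcont hP.1)).integrable.integrableOn
      (hη.mul_left hΩ (hcont hR.1)).integrable.integrableOn, h3, sub_self]

end DensityIndependence

end

end LocalFunctionals

namespace LocalFunctionals

noncomputable section

set_option linter.unusedSectionVars false

/-! ### Skew-symmetric module homomorphisms in components -/

section Tensor

variable {n m : ℕ} {M : Type*} [TopologicalSpace M] [ChartedSpace (EuclideanSpace ℝ (Fin n)) M]
  {V : M → Type*} [TopologicalSpace (TotalSpace (EuclideanSpace ℝ (Fin m)) V)]
  [∀ x, AddCommGroup (V x)] [∀ x, Module ℝ (V x)] [∀ x, TopologicalSpace (V x)]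
  [FiberBundle (EuclideanSpace ℝ (Fin m)) V]
variable [IsManifold (𝓡 n) ∞ M] [VectorBundle ℝ (EuclideanSpace ℝ (Fin m)) V]
  [ContMDiffVectorBundle ∞ (EuclideanSpace ℝ (Fin m)) V (𝓡 n)] [T2Space M]

local notation "κ" => chartAt (EuclideanSpace ℝ (Fin n))

variable {ν : VolumeForm n M} {c c' x : M} {p : ℕ} {P : JetBundle n m V → ℝ}
  {α β : FormFamily n m V} {χ : M → ℝ}

theorem exists_bump {U : Set M} (hU : U ∈ nhds x) :
    ∃ χ : M → ℝ, ContMDiff (𝓡 n) 𝓘(ℝ, ℝ) ∞ χ ∧ HasCompactSupport χ ∧ tsupport χ ⊆ U ∧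
      ∀ᶠ z in nhds x, χ z = 1 := by
  obtain ⟨f, -, hf⟩ := (SmoothBumpFunction.nhds_basis_tsupport (I := 𝓡 n) x).mem_iff.1 hU
  exact ⟨f, f.contMDiff, f.hasCompactSupport, hf, f.eventuallyEq_one⟩

theorem isLocal_of_contMDiff (hχ : ContMDiff (𝓡 n) 𝓘(ℝ, ℝ) ∞ χ) :
    IsLocal fun j : JetBundle n m V => χ j.base :=
  isLocal_iff.2 ⟨0, fun x => LocAt.of_contMDiff hχ (mem_dom_self n m V x)⟩

/-- A function that is local over the bundle chart at `c`, cut off in that chart. -/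
theorem isLocal_mul_of_tsupport_subset (hχ : ContMDiff (𝓡 n) 𝓘(ℝ, ℝ) ∞ χ)
    (hs : tsupport χ ⊆ dom n m V c) (hP : ∀ x ∈ dom n m V c, LocAt c p P x) :
    IsLocal fun j => χ j.base * P j := by
  refine isLocal_iff.2 ⟨p, fun x => ?_⟩
  have hx := mem_dom_self n m V x
  by_cases h : x ∈ tsupport χ
  · exact (LocAt.of_contMDiff hχ hx).mul ((hP x (hs h)).change hx (hs h))
  · refine (LocAt.const 0 hx).congr hx ((isClosed_tsupport χ).isOpen_compl.mem_nhds h) fun j hj => ?_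
    rw [image_eq_zero_of_notMem_tsupport hj, zero_mul]

/-- The pull-back formula for the identity carries the coefficients from the given chart to any
other without raising the order. -/
theorem isSourceForm_of_cover
    (h : ∃ p, ∀ x : M, ∃ c : M, x ∈ dom n m V c ∧ ∀ a, LocAt c p (coef c α a) x) : IsSourceForm α := by
  obtain ⟨p, hp⟩ := h
  refine isSourceForm_of_locAt ⟨p, fun c x hx a => ?_⟩
  obtain ⟨c', hx', h⟩ := hp x
  have := (BundleAut.refl n m V).locAt_coef_pullback (a := a) hx (c' := c') hx' h
  rwa [BundleAut.refl_pullback] at this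

theorem coef_add (c : M) (α β : FormFamily n m V) (a : Fin m) (j : JetBundle n m V) :
    coef c (α + β) a j = coef c α a j + coef c β a j :=
  map_add (formVal c j.base) _ _

theorem coef_smul (c : M) (f : JetBundle n m V → ℝ) (α : FormFamily n m V) (a : Fin m)
    (j : JetBundle n m V) : coef c (fun j => f j • α j) a j = f j * coef c α a j :=
  map_smul (formVal c j.base) _ _

namespace IsSourceForm

theorem add (hα : IsSourceForm α) (hβ : IsSourceForm β) : IsSourceForm (α + β) := by
  obtain ⟨p, hp⟩ := hα.exists_locAt
  obtain ⟨q, hq⟩ := hβ.exists_locAt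
  refine isSourceForm_of_locAt ⟨max p q, fun c x hx a => ?_⟩
  exact (((hp c x hx a).mono (le_max_left p q)).add ((hq c x hx a).mono (le_max_right p q))).congr
    hx Filter.univ_mem fun j _ => coef_add c α β a j

theorem smul {f : JetBundle n m V → ℝ} (hf : IsLocal f) (hα : IsSourceForm α) :
    IsSourceForm (fun j => f j • α j) := by
  obtain ⟨p, hp⟩ := hα.exists_locAt
  obtain ⟨q, hq⟩ := hf.exists_locAt
  refine isSourceForm_of_locAt ⟨max p q, fun c x hx a => ?_⟩
  exact (((hq c x hx).mono (le_max_right p q)).mul ((hp c x hx a).mono (le_max_left p q))).congr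
    hx Filter.univ_mem fun j _ => coef_smul c f α a j

theorem zero : IsSourceForm (0 : FormFamily n m V) :=
  isSourceForm_of_locAt ⟨0, fun c _ hx _ => (LocAt.const 0 hx).congr hx Filter.univ_mem
    fun j _ => map_zero (formVal c j.base)⟩

theorem sum {ι : Type*} {s : Finset ι} {γ : ι → FormFamily n m V}
    (h : ∀ i ∈ s, IsSourceForm (γ i)) : IsSourceForm (∑ i ∈ s, γ i) :=
  Finset.sum_induction γ IsSourceForm (fun _ _ => add) zero h

end IsSourceForm

/-- The form `χ θ^a ∧ ν`, where `θ^a` belongs to the bundle chart at `c`. -/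
def bumpWedge (ν : VolumeForm n M) (c : M) (χ : M → ℝ) (a : Fin m) : FormFamily n m V :=
  fun j => χ j.base • contactWedge c a ν.form j

theorem coef_bumpWedge {j : JetBundle n m V} (hj : j.base ∈ dom n m V c) (a b : Fin m) :
    coef c (bumpWedge ν c χ a) b j =
      χ j.base * if a = b then formCoeff ν.form c (κ c j.base) else 0 := by
  refine (coef_smul c (fun j => χ j.base) (contactWedge c a ν.form) b j).trans
    (congrArg (χ j.base * ·) ?_)
  rw [formCoeff_chart hj.1]
  exact coef_contactWedge hj a b ν.form

theorem isSourceForm_bumpWedge (hχ : ContMDiff (𝓡 n) 𝓘(ℝ, ℝ) ∞ χ)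
    (hs : tsupport χ ⊆ dom n m V c) (a : Fin m) :
    IsSourceForm (bumpWedge ν c χ a : FormFamily n m V) := by
  refine isSourceForm_of_cover ⟨0, fun x => ?_⟩
  by_cases h : x ∈ tsupport χ
  · refine ⟨c, hs h, fun b => ?_⟩
    refine LocAt.congr (P := fun j => χ j.base * if a = b then formCoeff ν.form c (κ c j.base) else 0)
      ((LocAt.of_contMDiff hχ (hs h)).mul ?_) (hs h)
      ((isOpen_dom n m V c).mem_nhds (hs h)) fun j hj => coef_bumpWedge hj a b
    split_ifs
    · exact LocAt.of_base (h := fun x => formCoeff ν.form c (κ c x)) (isOpen_domCoord n m V c)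
        subset_rfl (chart_mem (hs h)) (contDiffOn_formCoeff ν c) fun _ _ _ => rfl
    · exact LocAt.const 0 (hs h)
  · have hx := mem_dom_self n m V x
    refine ⟨x, hx, fun b => (LocAt.const 0 hx).congr hx
      ((isClosed_tsupport χ).isOpen_compl.mem_nhds h) fun j hj => ?_⟩
    refine (coef_smul x (fun j => χ j.base) (contactWedge c a ν.form) b j).trans ?_
    rw [image_eq_zero_of_notMem_tsupport hj, zero_mul]

/-- The coefficients with respect to the forms `θ^a ∧ ν` of the bundle chart at `c`. -/
def ncoef (ν : VolumeForm n M) (c : M) (α : FormFamily n m V) (a : Fin m)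
    (j : JetBundle n m V) : ℝ :=
  coef c α a j / formCoeff ν.form c (κ c j.base)

theorem coef_eq_ncoef_mul {j : JetBundle n m V} (hj : j.base ∈ dom n m V c)
    (α : FormFamily n m V) (a : Fin m) :
    coef c α a j = ncoef ν c α a j * formCoeff ν.form c (κ c j.base) :=
  (div_mul_cancel₀ _ (ν.formCoeff_ne_zero (chart_mem hj).1)).symm

theorem eq_sum_ncoef (ν : VolumeForm n M) {j : JetBundle n m V} (hj : j.base ∈ dom n m V c)
    (α : FormFamily n m V) :
    α j = ∑ a, ncoef ν c α a j • contactWedge c a ν.form j := by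
  refine (eq_sum_coef hj α).trans (Finset.sum_congr rfl fun a _ => ?_)
  refine LinearMap.ext fun v => ?_
  rw [LinearMap.smul_apply, LinearMap.smul_apply, contactWedge_apply, contactWedge_apply,
    topForm_eq_smul hj.1 (ν.form j.base), ← formCoeff_chart hj.1, coef_eq_ncoef_mul (ν := ν) hj,
    smul_smul, smul_smul, smul_smul]
  congr 1
  ring

theorem ncoef_of_eq_contactWedge {j : JetBundle n m V} (hj : j.base ∈ dom n m V c) {a : Fin m}
    (h : α j = contactWedge c a ν.form j) (b : Fin m) :
    ncoef ν c α b j = if a = b then 1 else 0 := by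
  have h1 : coef c α b j = if a = b then formCoeff ν.form c (κ c j.base) else 0 := by
    rw [coef, h, coef_contactWedge hj, formCoeff_chart hj.1]
  rw [ncoef, h1]
  split_ifs
  · exact div_self (ν.formCoeff_ne_zero (chart_mem hj).1)
  · exact zero_div _

theorem IsSourceForm.exists_locAt_ncoef (hα : IsSourceForm α) (ν : VolumeForm n M) :
    ∃ p, ∀ c x, x ∈ dom n m V c → ∀ a, LocAt c p (ncoef ν c α a) x := by
  obtain ⟨p, hp⟩ := hα.exists_locAt
  refine ⟨p, fun c x hx a => ?_⟩
  have h1 : LocAt c p (fun j : JetBundle n m V => (formCoeff ν.form c (κ c j.base))⁻¹) x :=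
    LocAt.of_base (h := fun x => (formCoeff ν.form c (κ c x))⁻¹)
      (g := fun y => (formCoeff ν.form c y)⁻¹) (isOpen_domCoord n m V c) subset_rfl (chart_mem hx)
      ((contDiffOn_formCoeff ν c).inv fun y hy => ν.formCoeff_ne_zero hy.1) fun _ _ _ => rfl
  exact ((hp c x hx a).mul h1).congr hx Filter.univ_mem fun j _ => div_eq_mul_inv _ _

namespace IsSkewHom

variable {w : FormFamily n m V → FormFamily n m V → JetBundle n m V → ℝ}

theorem zero_left (hw : IsSkewHom w) (hβ : IsSourceForm β) : w 0 β = 0 := by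
  have h1 := hw.smul_left (fun _ => 0) 0 β (isLocal_of_contMDiff contMDiff_const)
    IsSourceForm.zero hβ
  have h2 : (fun j : JetBundle n m V => (0 : ℝ) • (0 : FormFamily n m V) j) = 0 :=
    funext fun j => zero_smul ℝ _
  rw [h2] at h1
  rw [h1]
  exact funext fun j => zero_mul _

theorem sum_left (hw : IsSkewHom w) {ι : Type*} {s : Finset ι} {γ : ι → FormFamily n m V}
    (h : ∀ i ∈ s, IsSourceForm (γ i)) (hβ : IsSourceForm β) :
    w (∑ i ∈ s, γ i) β = ∑ i ∈ s, w (γ i) β := by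
  classical
  induction s using Finset.induction_on with
  | empty => simpa using hw.zero_left hβ
  | insert i s hi ih =>
    have h1 := h i (Finset.mem_insert_self _ _)
    have h2 : ∀ k ∈ s, IsSourceForm (γ k) := fun k hk => h k (Finset.mem_insert_of_mem hk)
    rw [Finset.sum_insert hi, Finset.sum_insert hi, hw.add_left _ _ _ h1 (IsSourceForm.sum h2) hβ,
      ih h2]

/-- The values of `w` in terms of the coefficients of its first argument. -/
theorem expand_left (hw : IsSkewHom w) (ν : VolumeForm n M) (hα : IsSourceForm α)
    (hβ : IsSourceForm β)
    (hχ : ContMDiff (𝓡 n) 𝓘(ℝ, ℝ) ∞ χ) (hs : tsupport χ ⊆ dom n m V c) {j : JetBundle n m V}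
    (hj : χ j.base = 1) :
    w α β j = ∑ a, ncoef ν c α a j * w (bumpWedge ν c χ a) β j := by
  obtain ⟨p, hp⟩ := hα.exists_locAt_ncoef ν
  have hl : ∀ a, IsLocal fun j => χ j.base * ncoef ν c α a j := fun a =>
    isLocal_mul_of_tsupport_subset hχ hs fun x hx => hp c x hx a
  have hb : ∀ a, IsSourceForm (bumpWedge ν c χ a : FormFamily n m V) :=
    isSourceForm_bumpWedge hχ hs
  -- Two factors `χ` are needed: one extends the coefficients of `α` to global local functions, the
  -- other extends the frame to global forms. At jets over `χ = 1` neither changes the value.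
  have h1 : (fun j => (χ j.base * χ j.base) • α j) = ∑ a, fun j : JetBundle n m V =>
      (χ j.base * ncoef ν c α a j) • bumpWedge ν c χ a j := by
    funext i
    rw [Finset.sum_apply]
    by_cases hi : i.base ∈ dom n m V c
    · rw [eq_sum_ncoef ν hi α, Finset.smul_sum]
      refine Finset.sum_congr rfl fun a _ => ?_
      rw [bumpWedge, smul_smul, smul_smul]
      congr 1
      ring
    · have h0 : χ i.base = 0 := image_eq_zero_of_notMem_tsupport fun h => hi (hs h)
      simp [h0]
  have h2 := hw.smul_left _ α β (isLocal_of_contMDiff (χ := fun x => χ x * χ x) (hχ.mul hχ)) hα hβ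
  rw [h1, hw.sum_left (fun a _ => (hb a).smul (hl a)) hβ] at h2
  have h3 := congrFun h2 j
  rw [Finset.sum_apply, hj, one_mul, one_mul] at h3
  rw [← h3]
  refine Finset.sum_congr rfl fun a _ => ?_
  rw [hw.smul_left _ _ β (hl a) (hb a) hβ]
  simp only [hj, one_mul]

theorem expand (hw : IsSkewHom w) (ν : VolumeForm n M) (hα : IsSourceForm α)
    (hβ : IsSourceForm β)
    (hχ : ContMDiff (𝓡 n) 𝓘(ℝ, ℝ) ∞ χ) (hs : tsupport χ ⊆ dom n m V c) {j : JetBundle n m V}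
    (hj : χ j.base = 1) :
    w α β j = ∑ a, ∑ b, ncoef ν c α a j * ncoef ν c β b j *
      w (bumpWedge ν c χ a) (bumpWedge ν c χ b) j := by
  have hb : ∀ a, IsSourceForm (bumpWedge ν c χ a : FormFamily n m V) :=
    isSourceForm_bumpWedge hχ hs
  rw [hw.expand_left ν hα hβ hχ hs hj]
  refine Finset.sum_congr rfl fun a _ => ?_
  -- The second argument is expanded by exchanging the arguments twice; the two signs cancel.
  rw [hw.skew _ _ (hb a) hβ, Pi.neg_apply, hw.expand_left ν hβ (hb a) hχ hs hj,
    ← Finset.sum_neg_distrib, Finset.mul_sum]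
  refine Finset.sum_congr rfl fun b _ => ?_
  rw [hw.skew _ _ (hb b) (hb a), Pi.neg_apply]
  ring

end IsSkewHom

/-- A cut-off of `θ^a ∧ ν` satisfies the condition under `Classical.epsilon`, so the chosen form
satisfies it as well. -/
theorem globalContact_spec (ν : VolumeForm n M) (hx : x ∈ dom n m V c) (a : Fin m) :
    IsSourceForm (globalContact ν c a x : FormFamily n m V) ∧
      ∀ j : JetBundle n m V, j.base = x →
        (globalContact ν c a x : FormFamily n m V) j = contactWedge c a ν.form j := by
  obtain ⟨χ, hχ, -, hs, h1⟩ := exists_bump (n := n) ((isOpen_dom n m V c).mem_nhds hx)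
  have h2 : ∃ α : FormFamily n m V, IsSourceForm α ∧
      ∃ U ∈ nhds x, ∀ j : JetBundle n m V, j.base ∈ U → α j = contactWedge c a ν.form j :=
    ⟨bumpWedge ν c χ a, isSourceForm_bumpWedge hχ hs a, _, h1, fun j hj => by
      have hj' : χ j.base = 1 := hj
      rw [bumpWedge, hj', one_smul]⟩
  obtain ⟨h3, U, hU, h4⟩ := Classical.epsilon_spec h2
  exact ⟨h3, fun j hj => h4 j (hj ▸ mem_of_mem_nhds hU)⟩

theorem sum_sum_ite_mul_ite (a b : Fin m) (W : Fin m → Fin m → ℝ) :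
    ∑ k, ∑ l, (if a = k then 1 else 0) * (if b = l then 1 else 0) * W k l = W a b := by
  simp

/-- The form chosen in `globalContact` is unknown away from the point, but `expand` shows that only
its coefficients at `j` enter. -/
theorem IsSkewHom.omegaComp_eq {w : FormFamily n m V → FormFamily n m V → JetBundle n m V → ℝ}
    (hw : IsSkewHom w) (hχ : ContMDiff (𝓡 n) 𝓘(ℝ, ℝ) ∞ χ) (hs : tsupport χ ⊆ dom n m V c)
    {j : JetBundle n m V} (hjc : j.base ∈ dom n m V c) (hj : χ j.base = 1) (a b : Fin m) :
    omegaComp ν w c a b j = w (bumpWedge ν c χ a) (bumpWedge ν c χ b) j := by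
  obtain ⟨h1, h2⟩ := globalContact_spec ν hjc a
  obtain ⟨h3, h4⟩ := globalContact_spec ν hjc b
  rw [omegaComp, hw.expand ν h1 h3 hχ hs hj]
  simp only [ncoef_of_eq_contactWedge hjc (h2 j rfl), ncoef_of_eq_contactWedge hjc (h4 j rfl)]
  exact sum_sum_ite_mul_ite a b _

/-- `w` in terms of its components. -/
theorem IsSkewHom.eq_sum_omegaComp {w : FormFamily n m V → FormFamily n m V → JetBundle n m V → ℝ}
    (hw : IsSkewHom w) (ν : VolumeForm n M) (hα : IsSourceForm α) (hβ : IsSourceForm β)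
    {j : JetBundle n m V} (hj : j.base ∈ dom n m V c) :
    w α β j = ∑ a, ∑ b, ncoef ν c α a j * ncoef ν c β b j * omegaComp ν w c a b j := by
  obtain ⟨χ, hχ, -, hs, h1⟩ := exists_bump (n := n) ((isOpen_dom n m V c).mem_nhds hj)
  rw [hw.expand ν hα hβ hχ hs h1.self_of_nhds]
  simp only [hw.omegaComp_eq hχ hs hj h1.self_of_nhds]

namespace BundleAut

variable (ψ : BundleAut n m V)

theorem ncoef_pullback {j : JetBundle n m V} (hx : j.base ∈ dom n m V c)
    (hx' : ψ.base j.base ∈ dom n m V c') (α : FormFamily n m V) (b : Fin m) :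
    ncoef ν c (ψ.pullback α) b j = ν.det ψ.base j.base *
      ∑ a, ncoef ν c' α a (ψ.onJet j) * ψ.partialPsi c c' j a b := by
  have h1 : ∀ a, coef c' α a (ψ.onJet j) =
      ncoef ν c' α a (ψ.onJet j) * formCoeff ν.form c' (κ c' (ψ.base j.base)) := fun a =>
    coef_eq_ncoef_mul (by exact hx') α a
  rw [ncoef, ψ.coef_pullback hx hx', div_eq_iff (ν.formCoeff_ne_zero (chart_mem hx).1)]
  simp only [h1]
  rw [mul_right_comm, ψ.det_mul_formCoeff hx hx', mul_assoc]
  refine congrArg (_ * ·) ?_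
  rw [Finset.mul_sum]
  exact Finset.sum_congr rfl fun a _ => by ring

theorem sum_components (d : ℝ) (A B : Fin m → ℝ) (T W : Fin m → Fin m → ℝ) :
    ∑ k, ∑ l, (d * ∑ a, A a * T a k) * (d * ∑ b, B b * T b l) * W k l =
      d * ∑ a, ∑ b, A a * B b * (d * ∑ k, ∑ l, W k l * T a k * T b l) := by
  simp only [Finset.mul_sum, Finset.sum_mul, ← Fintype.sum_prod_type']
  -- Both sides are sums over quadruples of indices; the equivalence reorders the indices `k, l, b,
  -- a` as `a, b, k, l`.
  exact Fintype.sum_equiv ⟨fun x => (x.2.2.2, x.2.2.1, x.1, x.2.1),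
    fun x => (x.2.2.1, x.2.2.2, x.2.1, x.1), fun _ => rfl, fun _ => rfl⟩ _ _ fun x => by
      simp only [Equiv.coe_fn_mk]
      ring

/-- `w` on pulled back forms, in components. -/
theorem apply_pullback {w : FormFamily n m V → FormFamily n m V → JetBundle n m V → ℝ}
    (hw : IsSkewHom w) (ν : VolumeForm n M) {j : JetBundle n m V} (hx : j.base ∈ dom n m V c)
    (hx' : ψ.base j.base ∈ dom n m V c') (hα : IsSourceForm α) (hβ : IsSourceForm β) :
    w (ψ.pullback α) (ψ.pullback β) j = ν.det ψ.base j.base * ∑ a, ∑ b,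
      ncoef ν c' α a (ψ.onJet j) * ncoef ν c' β b (ψ.onJet j) * (ν.det ψ.base j.base *
        ∑ k, ∑ l, omegaComp ν w c k l j * ψ.partialPsi c c' j a k * ψ.partialPsi c c' j b l) := by
  rw [hw.eq_sum_omegaComp ν (ψ.isSourceForm_pullback hα) (ψ.isSourceForm_pullback hβ) hx]
  simp only [ψ.ncoef_pullback hx hx']
  exact sum_components _ _ _ _ _

/-- Covariance in components at a jet, from covariance for forms that coincide with `θ^a ∧ ν` and
`θ^b ∧ ν` at its image. -/
theorem component_of_apply {w : FormFamily n m V → FormFamily n m V → JetBundle n m V → ℝ}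
    (hw : IsSkewHom w) {j : JetBundle n m V} (hdet : ν.det ψ.base j.base ≠ 0)
    (hx : j.base ∈ dom n m V c)
    (hx' : ψ.base j.base ∈ dom n m V c') (hα : IsSourceForm α) (hβ : IsSourceForm β) {a b : Fin m}
    (ha : α (ψ.onJet j) = contactWedge c' a ν.form (ψ.onJet j))
    (hb : β (ψ.onJet j) = contactWedge c' b ν.form (ψ.onJet j))
    (h : w (ψ.pullback α) (ψ.pullback β) j = ν.det ψ.base j.base * w α β (ψ.onJet j)) :
    omegaComp ν w c' a b (ψ.onJet j) = ν.det ψ.base j.base *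
      ∑ k, ∑ l, omegaComp ν w c k l j * ψ.partialPsi c c' j a k * ψ.partialPsi c c' j b l := by
  have hx'' : (ψ.onJet j).base ∈ dom n m V c' := hx'
  rw [ψ.apply_pullback hw ν hx hx' hα hβ, hw.eq_sum_omegaComp ν hα hβ hx''] at h
  simp only [ncoef_of_eq_contactWedge hx'' ha, ncoef_of_eq_contactWedge hx'' hb] at h
  rw [sum_sum_ite_mul_ite a b, sum_sum_ite_mul_ite a b] at h
  exact (mul_left_cancel₀ hdet h).symm

/-- Covariance in components. -/
theorem covariant_iff {w : FormFamily n m V → FormFamily n m V → JetBundle n m V → ℝ}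
    (hw : IsSkewHom w) (hdet : ∀ x, ν.det ψ.base x ≠ 0) :
    ψ.Covariant ν w ↔ ∀ (c c' : M) (j : JetBundle n m V),
      j.base ∈ dom n m V c → ψ.base j.base ∈ dom n m V c' → ∀ a b : Fin m,
        omegaComp ν w c' a b (ψ.onJet j) = ν.det ψ.base j.base *
          ∑ k, ∑ l, omegaComp ν w c k l j * ψ.partialPsi c c' j a k * ψ.partialPsi c c' j b l := by
  refine ⟨fun h c c' j hx hx' a b => ?_, fun h α β hα hβ j => ?_⟩
  · obtain ⟨h1, h2⟩ := globalContact_spec ν hx' a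
    obtain ⟨h3, h4⟩ := globalContact_spec ν hx' b
    exact ψ.component_of_apply hw (hdet _) hx hx' h1 h3 (h2 _ rfl) (h4 _ rfl) (h _ _ h1 h3 j)
  · have hx := mem_dom_self n m V j.base
    have hx' := mem_dom_self n m V (ψ.base j.base)
    rw [ψ.apply_pullback hw ν hx hx' hα hβ,
      hw.eq_sum_omegaComp ν hα hβ (j := ψ.onJet j) (c := ψ.base j.base) hx']
    simp only [h _ _ j hx hx']

end BundleAut

end Tensor

end

end LocalFunctionals

namespace LocalFunctionals

noncomputable section

set_option linter.unusedSectionVars false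

section Bracket

variable {n m : ℕ} {M : Type*} [TopologicalSpace M] [ChartedSpace (EuclideanSpace ℝ (Fin n)) M]
  {V : M → Type*} [TopologicalSpace (TotalSpace (EuclideanSpace ℝ (Fin m)) V)]
  [∀ x, AddCommGroup (V x)] [∀ x, Module ℝ (V x)] [∀ x, TopologicalSpace (V x)]
  [FiberBundle (EuclideanSpace ℝ (Fin m)) V]
variable [IsManifold (𝓡 n) ∞ M] [VectorBundle ℝ (EuclideanSpace ℝ (Fin m)) V]
  [ContMDiffVectorBundle ∞ (EuclideanSpace ℝ (Fin m)) V (𝓡 n)] [T2Space M]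

local notation "κ" => chartAt (EuclideanSpace ℝ (Fin n))

variable {ν : VolumeForm n M} {c c' x : M} {p : ℕ} {P Q : JetBundle n m V → ℝ}
  {α β : FormFamily n m V} {ρ : M → ℝ}

/-! ### Densities that are linear in the fiber coordinates -/

/-- The local function `ρ u^a`, where `u^a` belongs to the bundle chart at `c`. -/
def coordDensity (c : M) (ρ : M → ℝ) (a : Fin m) (j : JetBundle n m V) : ℝ :=
  ρ j.base * (jetCoord c j).2 a 0

theorem isLocal_coordDensity (hρ : ContMDiff (𝓡 n) 𝓘(ℝ, ℝ) ∞ ρ) (hs : tsupport ρ ⊆ dom n m V c)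
    (a : Fin m) : IsLocal (coordDensity c ρ a : JetBundle n m V → ℝ) :=
  isLocal_mul_of_tsupport_subset (p := 0) hρ hs fun _ hx =>
    ⟨_, isOpen_domCoord n m V c, subset_rfl, chart_mem hx, fun z => z.2 a 0,
      SmOn.coord a (mem_multiIndexLE_zero.2 rfl), fun _ _ _ => rfl⟩

theorem eulerForm_eq_zero (hP : IsLocal P) {j : JetBundle n m V} {U : Set M}
    (hU : U ∈ nhds j.base) (h : ∀ i : JetBundle n m V, i.base ∈ U → P i = 0) :
    eulerForm ν P j = 0 := by
  obtain ⟨U', hU', hU'o, hxU'⟩ := mem_nhds_iff.1 hU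
  have hx := mem_dom_self n m V j.base
  refine ext_coef (c := j.base) (β := 0) hx fun a => ?_
  set c := j.base with hc
  have hmem : κ c c ∈ domCoord n m V c ∩ ((κ c).target ∩ (κ c).symm ⁻¹' U') :=
    ⟨chart_mem hx, (chart_mem hx).1, by rwa [mem_preimage, symm_chart hx]⟩
  rw [coef_eulerForm hP hx, hP.eulerCoord_lagr ((isOpen_domCoord n m V c).inter
    ((κ c).isOpen_inter_preimage_symm hU'o)) inter_subset_left (p := 0)
    (f := fun _ => 0) (SmOn.const 0) (fun i hi hiΩ => ?_) a hmem]
  · have h1 : ∀ I : MultiIndex n, partialU a I (fun _ : JetCoord n m => (0 : ℝ)) = fun _ => 0 :=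
      fun I => by
        funext z
        simp [partialU]
    simp only [mul_zero, eulerCoord, h1, multiPow_totalD_zero, finsum_zero]
    exact (map_zero (formVal c j.base)).symm
  · have h1 := hiΩ.2.2
    rw [mem_preimage, symm_chart hi] at h1
    exact h i (hU' h1)

/-- With `ν = f d^n x`, the Lagrangian `f ρ u^a` is linear in the fiber coordinates and contains no
derivatives, so its Euler expression is `f ρ` in component `a` and zero otherwise. Thus all cut-off
frame forms are Euler-Lagrange forms. -/
theorem eulerForm_coordDensity (hρ : ContMDiff (𝓡 n) 𝓘(ℝ, ℝ) ∞ ρ)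
    (hs : tsupport ρ ⊆ dom n m V c) (a : Fin m) :
    eulerForm ν (coordDensity c ρ a : JetBundle n m V → ℝ) = bumpWedge ν c ρ a := by
  have hl := isLocal_coordDensity hρ hs a
  funext j
  by_cases hj : j.base ∈ dom n m V c
  · refine ext_coef (c := c) hj fun b => ?_
    have hρc : ContDiffOn ℝ ∞ (fun y => ρ ((κ c).symm y)) (domCoord n m V c) :=
      contMDiffOn_iff_contDiffOn.1 (hρ.comp_contMDiffOn
        ((contMDiffOn_chart_symm (x := c)).mono inter_subset_left))
    have hf : SmOn (domCoord n m V c) 0 (fun z : JetCoord n m => ρ ((κ c).symm z.1) * z.2 a 0) :=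
      (SmOn.base hρc).mul (SmOn.coord a (mem_multiIndexLE_zero.2 rfl))
    have hzj : (jetCoord c j).1 ∈ domCoord n m V c := chart_mem hj
    rw [coef_eulerForm hl hj, hl.eulerCoord_lagr (isOpen_domCoord n m V c) subset_rfl hf
      (fun i hi _ => ?_) b hzj, ((SmOn.base (contDiffOn_formCoeff ν c)).mul hf).eulerCoord_eq
        (isOpen_domCoord n m V c) b hzj, multiIndexLE_zero, Finset.sum_singleton, multiPow_zero,
      coef_bumpWedge hj]
    · have h1 : (jetCoord c j).1 = κ c j.base := rfl
      have h2 : (fun t : ℝ => formCoeff ν.form c (κ c j.base) * (ρ j.base *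
          ((jetCoord c j).2 + Pi.single b (Pi.single 0 t) : Fin m → MultiIndex n → ℝ) a 0)) =
          fun t =>
          formCoeff ν.form c (κ c j.base) * (ρ j.base * (jetCoord c j).2 a 0) +
            t * (ρ j.base * if a = b then formCoeff ν.form c (κ c j.base) else 0) := by
        funext t
        by_cases hab : a = b
        · subst hab
          simp
          ring
        · simp [hab]
      simp only [partialU, h1, symm_chart hj, h2]
      rw [deriv_const_add, deriv_mul_const differentiableAt_id, deriv_id'']
      simp
    · change ρ i.base * _ = ρ ((κ c).symm (κ c i.base)) * _
      rw [symm_chart hi]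
  · have h1 : j.base ∉ tsupport ρ := fun h => hj (hs h)
    rw [eulerForm_eq_zero hl ((isClosed_tsupport ρ).isOpen_compl.mem_nhds h1) fun i hi => by
      rw [coordDensity, image_eq_zero_of_notMem_tsupport hi, zero_mul], bumpWedge,
      image_eq_zero_of_notMem_tsupport h1, zero_smul]

theorem isCompactLocal_coordDensity (hρ : ContMDiff (𝓡 n) 𝓘(ℝ, ℝ) ∞ ρ)
    (hc : HasCompactSupport ρ) (hs : tsupport ρ ⊆ dom n m V c) (a : Fin m) :
    IsCompactLocal ν (coordDensity c ρ a : JetBundle n m V → ℝ) := by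
  refine ⟨isLocal_coordDensity hρ hs a, fun φ _ => ⟨tsupport ρ, hc.isCompact, fun x hx => ?_⟩⟩
  have h0 : ρ (jet φ x).base = 0 := image_eq_zero_of_notMem_tsupport hx
  rw [eulerForm_coordDensity hρ hs, coordDensity, bumpWedge, h0]
  exact ⟨zero_mul _, zero_smul ℝ _⟩

theorem bumpWedge_mul (ν : VolumeForm n M) (c : M) (σ ρ : M → ℝ) (a : Fin m) :
    (bumpWedge ν c (fun x => σ x * ρ x) a : FormFamily n m V) =
      fun j => σ j.base • bumpWedge ν c ρ a j :=
  funext fun _ => mul_smul _ _ _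

theorem BundleAut.pullback_smul (ψ : BundleAut n m V) (σ : M → ℝ) (α : FormFamily n m V) :
    ψ.pullback (fun j => σ j.base • α j) = fun j => σ (ψ.base j.base) • ψ.pullback α j :=
  funext fun _ => LinearMap.ext fun _ => rfl

/-! ### The bracket -/

variable [SigmaCompactSpace M] [MeasurableSpace M] [BorelSpace M]

/-- `bracket` uses densities picked by choice; by `eulerForm_eq_of_integralOf_eq` they may be
replaced by given ones. -/
theorem bracket_eq (hP : IsCompactLocal ν P) (hQ : IsCompactLocal ν Q)
    (w : FormFamily n m V → FormFamily n m V → JetBundle n m V → ℝ) :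
    bracket ν w (integralOf ν P) (integralOf ν Q) =
      integralOf ν (w (eulerForm ν P) (eulerForm ν Q)) := by
  have key : ∀ {P : JetBundle n m V → ℝ}, IsCompactLocal ν P →
      eulerForm ν (density ν (integralOf ν P)) = eulerForm ν P := fun {P} hP => by
    have h : integralOf ν P ∈ localFunctionals m V ν := ⟨P, hP, rfl⟩
    have h1 := h.choose_spec
    have h2 : density ν (integralOf ν P) = h.choose := dif_pos h
    rw [h2]
    exact eulerForm_eq_of_integralOf_eq h1.1 hP h1.2
  rw [bracket, key hP, key hQ]

namespace BundleAut

variable (ψ : BundleAut n m V)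

/-- Change of variables under `ψ_M`, together with `jψ (jφ (x)) = j(ψ̂ φ) (ψ_M x)`. The orientation
hypothesis lets `det` appear without absolute value. -/
theorem integralOf_onCompactSec (hor : ∀ x, 0 < ν.det ψ.base x) (hsupp : ψ.PreservesCompactSupp)
    (P : JetBundle n m V → ℝ) :
    integralOf ν P ∘ ψ.onCompactSec hsupp =
      integralOf ν (fun j => ν.det ψ.base j.base * P (ψ.onJet j)) := by
  funext φ
  refine (ν.integral_det_mul ψ.base hor fun x => P (jet (ψ.onSec φ.1) x)).symm.trans ?_
  refine integral_congr_ae (Filter.Eventually.of_forall fun x => ?_)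
  exact congrArg (fun j => ν.det ψ.base x * P j) (ψ.onJet_jet φ.1 x).symm

theorem isCompactLocal_det_mul (hsupp : ψ.PreservesCompactSupp) (hP : IsCompactLocal ν P) :
    IsCompactLocal ν (fun j => ν.det ψ.base j.base * P (ψ.onJet j)) := by
  refine ⟨ψ.isLocal_det_mul hP.1, fun φ hφ => ?_⟩
  obtain ⟨K, hK, h⟩ := hP.2 _ (hsupp φ hφ)
  refine ⟨ψ.base ⁻¹' K, ψ.base.toHomeomorph.isClosedEmbedding.isCompact_preimage hK,
    fun x hx => ?_⟩
  have h1 := h (ψ.base x) hx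
  rw [← ψ.onJet_jet] at h1
  rw [ψ.eulerForm_pullback hP.1]
  refine ⟨(congrArg _ h1.1).trans (mul_zero _), LinearMap.ext fun v => ?_⟩
  change pullbackForm ψ.base _ (eulerForm ν P (ψ.onJet (jet φ x)) _) = 0
  rw [h1.2]
  rfl

theorem comp_onCompactSec_mem (hor : ∀ x, 0 < ν.det ψ.base x) (hsupp : ψ.PreservesCompactSupp)
    {S : CompactSec n m V → ℝ} (hS : S ∈ localFunctionals m V ν) :
    S ∘ ψ.onCompactSec hsupp ∈ localFunctionals m V ν := by
  obtain ⟨P, hP, rfl⟩ := hS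
  exact ⟨_, ψ.isCompactLocal_det_mul hsupp hP, (ψ.integralOf_onCompactSec hor hsupp P).symm⟩

theorem bracket_comp (hor : ∀ x, 0 < ν.det ψ.base x) (hsupp : ψ.PreservesCompactSupp)
    (hP : IsCompactLocal ν P) (hQ : IsCompactLocal ν Q)
    (w : FormFamily n m V → FormFamily n m V → JetBundle n m V → ℝ) :
    bracket ν w (integralOf ν P ∘ ψ.onCompactSec hsupp) (integralOf ν Q ∘ ψ.onCompactSec hsupp) =
      integralOf ν (w (ψ.pullback (eulerForm ν P)) (ψ.pullback (eulerForm ν Q))) := by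
  rw [ψ.integralOf_onCompactSec hor hsupp, ψ.integralOf_onCompactSec hor hsupp,
    bracket_eq (ψ.isCompactLocal_det_mul hsupp hP) (ψ.isCompactLocal_det_mul hsupp hQ),
    ψ.eulerForm_pullback hP.1, ψ.eulerForm_pullback hQ.1]

theorem comp_bracket (hor : ∀ x, 0 < ν.det ψ.base x) (hsupp : ψ.PreservesCompactSupp)
    (hP : IsCompactLocal ν P) (hQ : IsCompactLocal ν Q)
    (w : FormFamily n m V → FormFamily n m V → JetBundle n m V → ℝ) :
    bracket ν w (integralOf ν P) (integralOf ν Q) ∘ ψ.onCompactSec hsupp =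
      integralOf ν (fun j => ν.det ψ.base j.base *
        w (eulerForm ν P) (eulerForm ν Q) (ψ.onJet j)) := by
  rw [bracket_eq hP hQ, ψ.integralOf_onCompactSec hor hsupp]

end BundleAut

/-- Needed so that continuous functions that agree almost everywhere agree everywhere. -/
instance VolumeForm.isOpenPosMeasure_measure (ν : VolumeForm n M) :
    ν.measure.IsOpenPosMeasure := by
  refine ⟨fun U hU ⟨x, hx⟩ h0 => ?_⟩
  have hm : Measurable ((U ∩ (κ x).source).indicator (1 : M → ENNReal)) :=
    measurable_one.indicator (hU.inter (κ x).open_source).measurableSet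
  have h1 : ν.chartLintegral x ((U ∩ (κ x).source).indicator 1) = 0 := by
    rw [← ν.lintegral_eq_chartLintegral hm fun z hz =>
      (by_contra fun h => hz (indicator_of_notMem (fun h' => h h'.2) _)),
      lintegral_indicator_one (hU.inter (κ x).open_source).measurableSet]
    exact measure_mono_null inter_subset_left h0
  have h2 := (ae_restrict_iff' (κ x).open_target.measurableSet).1
    ((lintegral_eq_zero_iff' ((ν.aemeasurable_formCoeff x).mul
      (hm.comp_aemeasurable (VolumeForm.aemeasurable_symm x)))).1 h1)
  set W := (κ x).target ∩ (κ x).symm ⁻¹' U with hW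
  have hWo : IsOpen W := (κ x).isOpen_inter_preimage_symm hU
  have hxW : κ x x ∈ W := ⟨mem_chart_target _ x, by
    rwa [mem_preimage, (κ x).left_inv (mem_chart_source _ x)]⟩
  refine hWo.measure_ne_zero volume ⟨_, hxW⟩ (measure_mono_null (t := {y | ¬ (y ∈ (κ x).target → _)})
    (fun y hy hy0 => ?_) (ae_iff.1 h2))
  have h3 := hy0 hy.1
  simp only [Pi.zero_apply, Pi.mul_apply, Function.comp] at h3
  rw [indicator_of_mem (show (κ x).symm y ∈ U ∩ (κ x).source from
    ⟨hy.2, (κ x).map_target hy.1⟩), Pi.one_apply, mul_one,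
    ENNReal.ofReal_eq_zero] at h3
  exact ν.formCoeff_ne_zero hy.1 (abs_nonpos_iff.1 h3)

namespace BundleAut

variable (ψ : BundleAut n m V)

/-- If `Ψ` preserves the bracket, then `w` satisfies the covariance relation on the forms
`ρ θ^a ∧ ν`. -/
theorem apply_pullback_bumpWedge
    {w : FormFamily n m V → FormFamily n m V → JetBundle n m V → ℝ} (hw : IsSkewHom w)
    (hor : ∀ x, 0 < ν.det ψ.base x) (hsupp : ψ.PreservesCompactSupp)
    (h : ∀ S ∈ localFunctionals m V ν, ∀ T ∈ localFunctionals m V ν,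
      bracket ν w (S ∘ ψ.onCompactSec hsupp) (T ∘ ψ.onCompactSec hsupp) =
        bracket ν w S T ∘ ψ.onCompactSec hsupp)
    (hρ : ContMDiff (𝓡 n) 𝓘(ℝ, ℝ) ∞ ρ) (hc : HasCompactSupport ρ)
    (hs : tsupport ρ ⊆ dom n m V c) (a b : Fin m) (j : JetBundle n m V) :
    w (ψ.pullback (bumpWedge ν c ρ a)) (ψ.pullback (bumpWedge ν c ρ b)) j =
      ν.det ψ.base j.base * w (bumpWedge ν c ρ a) (bumpWedge ν c ρ b) (ψ.onJet j) := by
  obtain ⟨φ, hφ, hj⟩ := exists_compactSupp_jet j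
  have hb : ∀ a, IsSourceForm (bumpWedge ν c ρ a : FormFamily n m V) :=
    isSourceForm_bumpWedge hρ hs
  have hb' : ∀ a, IsSourceForm (ψ.pullback (bumpWedge ν c ρ a)) := fun a =>
    ψ.isSourceForm_pullback (hb a)
  set G : JetBundle n m V → ℝ := w (ψ.pullback (bumpWedge ν c ρ a))
    (ψ.pullback (bumpWedge ν c ρ b)) with hG
  set H : JetBundle n m V → ℝ := fun j =>
    ν.det ψ.base j.base * w (bumpWedge ν c ρ a) (bumpWedge ν c ρ b) (ψ.onJet j) with hH
  have hGl : IsLocal G := hw.isLocal _ _ (hb' a) (hb' b)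
  have hHl : IsLocal H := ψ.isLocal_det_mul (hw.isLocal _ _ (hb a) (hb b))
  have hGc := hGl.continuous_jet φ
  have hHc := hHl.continuous_jet φ
  have key : ∀ g : M → ℝ, ContMDiff (𝓡 n) 𝓘(ℝ, ℝ) ∞ g → HasCompactSupport g →
      ∫ x, g x • (G (jet φ x) - H (jet φ x)) ∂ν.measure = 0 := by
    intro g hg hgc
    -- The prescribed test function `g` is carried to the target, so that `σ ∘ ψ_M = g`. It enters
    -- only through the second density `σ ρ u^b` and leaves `w` by linearity on both sides of the
    -- bracket identity.
    set σ : M → ℝ := fun x => g (ψ.base.symm x) with hσ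
    have hσs : ContMDiff (𝓡 n) 𝓘(ℝ, ℝ) ∞ σ := hg.comp ψ.base.symm.contMDiff
    have hσψ : ∀ x, σ (ψ.base x) = g x := fun x => congrArg g (ψ.base_symm_apply x)
    have hσρ : ContMDiff (𝓡 n) 𝓘(ℝ, ℝ) ∞ (fun x => σ x * ρ x) := hσs.mul hρ
    have hσt : tsupport (fun x => σ x * ρ x) ⊆ tsupport ρ := tsupport_mul_subset_right
    have hP := isCompactLocal_coordDensity (ν := ν) hρ hc hs a
    have hQ := isCompactLocal_coordDensity (ν := ν) hσρ hc.mul_left (hσt.trans hs) b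
    have h1 := congrFun (h _ ⟨_, hP, rfl⟩ _ ⟨_, hQ, rfl⟩) ⟨φ, hφ⟩
    rw [ψ.bracket_comp hor hsupp hP hQ, ψ.comp_bracket hor hsupp hP hQ,
      eulerForm_coordDensity hρ hs, eulerForm_coordDensity hσρ (hσt.trans hs), bumpWedge_mul,
      ψ.pullback_smul, hw.smul_right (fun j => σ (ψ.base j.base)) _ _ (isLocal_of_contMDiff
        (χ := fun x => σ (ψ.base x)) (hσs.comp ψ.base.contMDiff)) (hb' a) (hb' b),
      hw.smul_right (fun j => σ j.base) _ _ (isLocal_of_contMDiff hσs) (hb a) (hb b)] at h1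
    have h2 : ∫ x, g x * G (jet φ x) ∂ν.measure = ∫ x, g x * H (jet φ x) ∂ν.measure := by
      refine Eq.trans (integral_congr_ae (Filter.Eventually.of_forall fun x => ?_))
        (h1.trans (integral_congr_ae (Filter.Eventually.of_forall fun x => ?_)))
      · exact congrArg (· * G (jet φ x)) (hσψ x).symm
      · change ν.det ψ.base x * (σ (ψ.base x) * w (bumpWedge ν c ρ a) (bumpWedge ν c ρ b)
          (ψ.onJet (jet φ x))) = g x * (ν.det ψ.base x * w (bumpWedge ν c ρ a) (bumpWedge ν c ρ b)
          (ψ.onJet (jet φ x)))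
        rw [hσψ]
        ring
    have hint : ∀ {F : M → ℝ}, Continuous F → Integrable (fun x => g x * F x) ν.measure :=
      fun hF => (hg.continuous.mul hF).integrable_of_hasCompactSupport hgc.mul_right
    simp only [smul_eq_mul, mul_sub]
    rw [integral_sub (hint hGc) (hint hHc), h2, sub_self]
  -- Fundamental lemma on `M`: the continuous function `G - H` along `φ` is zero almost everywhere,
  -- hence everywhere; it is then evaluated at the base point of `j`.
  have hae := ae_eq_zero_of_integral_contMDiff_smul_eq_zero (𝓡 n) (μ := ν.measure)
    (hGc.sub hHc).locallyIntegrable key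
  have heq := (Continuous.ae_eq_iff_eq ν.measure (hGc.sub hHc) continuous_const).1 hae
  have h3 := congrFun heq j.base
  rw [Pi.sub_apply, hj] at h3
  exact sub_eq_zero.1 h3

end BundleAut

end Bracket

end

end LocalFunctionals

/-! ### The theorem -/

theorem mainTheorem1 {n m : ℕ} {M : Type*} [TopologicalSpace M] [T2Space M] [SigmaCompactSpace M]
    [ChartedSpace (EuclideanSpace ℝ (Fin n)) M] [IsManifold (𝓡 n) ∞ M]
    [MeasurableSpace M] [BorelSpace M]
    {V : M → Type*} [TopologicalSpace (TotalSpace (EuclideanSpace ℝ (Fin m)) V)]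
    [∀ x, AddCommGroup (V x)] [∀ x, Module ℝ (V x)] [∀ x, TopologicalSpace (V x)]
    [FiberBundle (EuclideanSpace ℝ (Fin m)) V] [VectorBundle ℝ (EuclideanSpace ℝ (Fin m)) V]
    [ContMDiffVectorBundle ∞ (EuclideanSpace ℝ (Fin m)) V (𝓡 n)]
    (ν : LocalFunctionals.VolumeForm n M)
    (w : LocalFunctionals.FormFamily n m V → LocalFunctionals.FormFamily n m V →
      LocalFunctionals.JetBundle n m V → ℝ)
    (hw : LocalFunctionals.IsSkewHom w)
    (ψ : LocalFunctionals.BundleAut n m V)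
    (hor : ∀ x, 0 < ν.det ψ.base x)
    (hsupp : ψ.PreservesCompactSupp) :
    -- `Ψ(S) = S ∘ ψ̂` maps local functionals to local functionals
    (∀ S ∈ LocalFunctionals.localFunctionals m V ν,
      S ∘ ψ.onCompactSec hsupp ∈ LocalFunctionals.localFunctionals m V ν) ∧
    -- `Ψ` preserves the bracket iff `w` is covariant
    ((∀ S ∈ LocalFunctionals.localFunctionals m V ν,
        ∀ T ∈ LocalFunctionals.localFunctionals m V ν,
          LocalFunctionals.bracket ν w (S ∘ ψ.onCompactSec hsupp) (T ∘ ψ.onCompactSec hsupp) =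
            LocalFunctionals.bracket ν w S T ∘ ψ.onCompactSec hsupp) ↔
      ψ.Covariant ν w) ∧
    -- covariance in components
    (ψ.Covariant ν w ↔
      ∀ (c c' : M) (j : LocalFunctionals.JetBundle n m V),
        j.base ∈ LocalFunctionals.dom n m V c → ψ.base j.base ∈ LocalFunctionals.dom n m V c' →
        ∀ a b : Fin m,
          LocalFunctionals.omegaComp ν w c' a b (ψ.onJet j) =
            ν.det ψ.base j.base * ∑ k, ∑ l, LocalFunctionals.omegaComp ν w c k l j *
              ψ.partialPsi c c' j a k * ψ.partialPsi c c' j b l) := by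
  have hdet : ∀ x, ν.det ψ.base x ≠ 0 := fun x => (hor x).ne'
  refine ⟨fun S hS => ψ.comp_onCompactSec_mem hor hsupp hS, ⟨fun h => ?_, fun h => ?_⟩,
    ψ.covariant_iff hw hdet⟩
  · refine (ψ.covariant_iff hw hdet).2 fun c c' j hx hx' a b => ?_
    -- Since `ρ = 1` near `ψ_M x`, the form `ρ θ^a ∧ ν` coincides with `θ^a ∧ ν` at `jψ j`.
    -- Covariance on these cut-off forms therefore already gives the component identity at `j`.
    obtain ⟨ρ, hρ, hc, hs, h1⟩ := LocalFunctionals.exists_bump (n := n)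
      ((LocalFunctionals.isOpen_dom n m V c').mem_nhds hx')
    have hρ1 : ρ (ψ.onJet j).base = 1 := h1.self_of_nhds
    have hone : ∀ a, (LocalFunctionals.bumpWedge ν c' ρ a : LocalFunctionals.FormFamily n m V)
        (ψ.onJet j) = LocalFunctionals.contactWedge c' a ν.form (ψ.onJet j) := fun a => by
      rw [LocalFunctionals.bumpWedge, hρ1, one_smul]
    exact ψ.component_of_apply hw (hdet _) hx hx'
      (LocalFunctionals.isSourceForm_bumpWedge hρ hs a)
      (LocalFunctionals.isSourceForm_bumpWedge hρ hs b) (hone a) (hone b)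
      (ψ.apply_pullback_bumpWedge hw hor hsupp h hρ hc hs a b j)
  -- Both brackets are integrals with explicit integrands, and covariance on the Euler-Lagrange
  -- forms identifies these at every jet.
  · rintro _ ⟨P, hP, rfl⟩ _ ⟨Q, hQ, rfl⟩
    rw [ψ.bracket_comp hor hsupp hP hQ, ψ.comp_bracket hor hsupp hP hQ]
    exact congrArg _ (funext (h _ _ (LocalFunctionals.isSourceForm_eulerForm hP.1)
      (LocalFunctionals.isSourceForm_eulerForm hQ.1)))
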